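/- **Setting.** Let $G$ be a compact connected Lie group with Lie algebra $\mathfrak g$, equipped with an $\mathrm{Ad}(G)$-invariant inner product with norm $|\cdot|$. Fix a measurable map $\log:G\to\mathfrak g$ with bounded image such that $\exp(\log x)=x$ for all $x\in G$, $\log$ is a diffeomorphism between a neighbourhood of $1_G$ and a neighbourhood of $0$, and, for all $x$ outside a Haar-null set, $\log(yxy^{-1})=\mathrm{Ad}_y\log x$ for all $y\in G$ and $\log(x^{-1})=-\log x$. *Lattice.* For $N\ge 0$ let $\Lambda_N=2^{-N}\mathbb Z^2/\mathbb Z^2$ in the flat torus $\mathbf T^2=\mathbb R^2/\mathbb Z^2$. Its positively oriented bonds are $(x,x+2^{-N}e_\mu)$, $x\in\Lambda_N$, $\mu\in\{1,2\}$, one for each pair $(x,\mu)$. A $\mathfrak g$-valued one-form $A$ on $\Lambda_N$ assigns $A^N_\mu(x)=A(x,x+2^{-N}e_\mu)\in\mathfrak g$ to these bonds (and the negative to the reversed bonds); a gauge field $U$ assigns $U^N_\mu(x)=U(x,x+2^{-N}e_\mu)\in G$ (and the inverse to the reversed bonds). For $M\le N$ both induce objects on $\Lambda_M$, by sums, respectively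 ordered products, over the $2^{N-M}$ bonds of $\Lambda_N$ that make up a bond of $\Lambda_M$. For $g:\Lambda_N\to G$ put $U^g(x,y)=g(x)U(x,y)g(y)^{-1}$. *Rectangles.* A rectangle of $\Lambda_N$ is $r=(x,m2^{-N}e_1,n2^{-N}e_2)$ with $x\in\Lambda_N$, $1\le m,n<2^N$, and $m=1$ or $n=1$; its area is $|r|=mn2^{-2N}$. If $m=n=1$ it is a plaquette. The origin $z$ of $r$ is the corner of the south-west plaquette of $r$ that belongs to $\Lambda_{N-1}$, and $U(\partial r)$ is the ordered product of $U$ over the bonds of $\Lambda_N$ that traverse the boundary of $r$ anti-clockwise starting from $z$. If $p_1,\dots,p_k$ are the plaquettes of $r$ in order, starting from the south-west one, and $r_i$ is the subrectangle formed by $p_1,\dots,p_i$ (with $U(\partial r_0)=1_G$), the anti-development of $U$ along $r$ is the sequence $(X_i)_{i=0}^k$ with $X_0=0$ and $X_i-X_{i-1}=\log(U(\partial r_{i-1})^{-1}U(\partial r_i))$. Its $q$-variation is $|X|_{q\text{-var}}=\sup\big(\sum_i|X_{t_{i+1}}-X_{t_i}|^q\big)^{1/q}$ over all $t_0<\dots<t_n$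 in $\{0,\dots,k\}$. *Binary Landau gauge.* Let $0\le N_0\le N_1$, $K\ge 0$, and let $U$ be a gauge field on $\Lambda_{N_1}$. A pair $(A,g)$, with $A$ a $\mathfrak g$-valued one-form on $\Lambda_{N_1}$ and $g:\Lambda_{N_1}\to G$, is a binary Landau gauge of $U$ from scale $N_0$ with error constant $K$ if $g=1_G$ on $\Lambda_{N_0}$, $A=\log U$ on the positive bonds of $\Lambda_{N_0}$, $\exp A=U^g$ on the bonds of $\Lambda_N$ for every $N_0\le N\le N_1$, and for every $N_0<N\le N_1$ the following holds. (i) Each of the two bonds of $\Lambda_N$ that make up a positive bond of $\Lambda_{N-1}$ carries half of the value of $A$ on that bond. (ii) For every $x\in\Lambda_N$ both of whose coordinates are odd multiples of $2^{-N}$, write $x^\pm_\mu=x\pm2^{-N}e_\mu$, let $p_1,\dots,p_4$ be the four plaquettes of $\Lambda_N$ around $x$, anti-clockwise from the north-east one, and put $a_i=\log U^g(\partial p_i)$, $m_1=\frac12(A_1^N(x_2^+)+A_1^N(x_2^-))$, $m_2=\frac12(A_2^N(x_1^+)+A_2^N(x_1^-))$ and $\delta=\sum_{i}|\log U(\partial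 p_i)|+\sum_{\pm}\big(|A^N_1(x_2^\pm)|+|A^N_2(x_1^\pm)|\big)$. Then, for some $\mathcal E_1,\mathcal E_2,\mathcal E_3\in\mathfrak g$ with $|\mathcal E_i|\le K\delta^2$, $$A_1^N(x)=m_1+\tfrac38(a_1-a_4)+\tfrac18(a_2-a_3),\qquad A_2^N(x)=m_2+\tfrac38(a_2-a_1)+\tfrac18(a_3-a_4)+\mathcal E_1,$$ $$A_1^N(x_1^-)=m_1+\tfrac38(a_2-a_3)+\tfrac18(a_1-a_4)+\mathcal E_2,\qquad A_2^N(x_2^-)=m_2+\tfrac38(a_3-a_4)+\tfrac18(a_2-a_1)+\mathcal E_3.$$ *Segments.* Let $\mathcal X^{(N)}$ be the set of axis segments $\ell=\{x+ce_\mu: 0\le c\le|\ell|\}\subset\mathbf T^2$ with $x\in\Lambda_N$, $\mu\in\{1,2\}$ and $|\ell|\in\{2^{-N},2\cdot2^{-N},\dots,1\}$, and let $A(\ell)$ be the sum of $A$ over the positive bonds of $\Lambda_N$ in $\ell$. Segments $\ell,\bar\ell$ are parallel if they have the same direction $\mu$ and the same projection to the $\mu$-th axis; $d(\ell,\bar\ell)=\inf\{|x-y|:x\in\ell,y\in\bar\ell\}$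 in the geodesic distance of $\mathbf T^2$. **Theorem (Binary Landau gauge).** There is $K_0\ge 0$, depending only on $G$, its inner product and $\log$, such that for every $K\ge K_0$ the following holds. 1. For all $0\le N_0\le N_1$, every gauge field $U$ on $\Lambda_{N_1}$ has a binary Landau gauge $(A,g)$ from scale $N_0$ with error constant $K$. 2. There is $c>0$, depending only on $G$, its inner product, $\log$ and $K$, such that for all $N_0\ge0$, $\alpha\in(\frac23,1)$, $\bar C\ge0$, $q\in[1,\frac1{1-\alpha})$ and $\bar\alpha\in(1-q^{-1},\alpha)$ there is $C\ge0$ with the following property. Let $N_1\ge N_0$, let $U$ be a gauge field on $\Lambda_{N_1}$ and let $(A,g)$ be any binary Landau gauge of $U$ from scale $N_0$ with error constant $K$. Suppose that $$|X|_{q\text{-var}}\le\bar C|r|^{\alpha/2}$$ for every $N_0\le N\le N_1$ and every rectangle $r$ of $\Lambda_N$, where $X$ is the anti-development of $U$ along $r$, and that $$\bar C2^{-N_0\alpha}+\max_{x\in\Lambda_{N_0}}\max_{\mu=1,2}|A^{N_0}_\mu(x)|\le c.$$ Then for all $N_0\le N\le N_1$ and all parallel $\ell,\bar\ell\in\mathcal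 X^{(N)}$, $$|A(\ell)|\le C|\ell|^{\bar\alpha}\qquad\text{and}\qquad|A(\ell)-A(\bar\ell)|\le C|\ell|^{\alpha/2}d(\ell,\bar\ell)^{\bar\alpha/2}.$$ In particular $C$ does not depend on $N_1$, $U$, $A$ or $g$. -/

import Mathlib

open scoped Manifold ContDiff BigOperators

noncomputable section

namespace BinaryLandau

/-! ### Lie group preliminaries

`G` is a smooth manifold modelled on the Euclidean space `E`. In Mathlib the tangent space of `G` at
every point is the type `E`, so the Lie algebra of `G` (tangent space at `1`) is `E`, and the inner
product of `E` is the chosen inner product on the Lie algebra. -/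

section Lie

variable {E : Type*} [NormedAddCommGroup E] [InnerProductSpace ℝ E]
  {G : Type*} [TopologicalSpace G] [ChartedSpace E G] [Group G]

/-- The adjoint action `Ad_y`: the differential at `1` of the conjugation `x ↦ y x y⁻¹`. -/
def Ad (y : G) : E →L[ℝ] E :=
  mfderiv 𝓘(ℝ, E) 𝓘(ℝ, E) (fun x : G => y * x * y⁻¹) 1

/-- `φ` is the one-parameter subgroup of `G` with initial velocity `X`. -/
def IsOneParam (X : E) (φ : ℝ → G) : Prop :=
  (∀ s t : ℝ, φ (s + t) = φ s * φ t) ∧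
    HasMFDerivAt 𝓘(ℝ, ℝ) 𝓘(ℝ, E) φ 0 (ContinuousLinearMap.toSpanSingleton ℝ X : ℝ →L[ℝ] E)

open Classical in
/-- The exponential map of `G`: the time-one value of the one-parameter subgroup with velocity `X`
(which exists and is unique for every `X` in a Lie group; the value `1` is a placeholder). -/
def lieExp (X : E) : G :=
  if h : ∃ φ : ℝ → G, IsOneParam X φ then h.choose 1 else 1

/-- The requirements on the fixed logarithm `log : G → E`. The identities under conjugation and
inversion are required outside a Haar-null set. -/
structure IsLogMap [MeasurableSpace G] [MeasurableSpace E] (log : G → E) : Prop where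
  measurable : Measurable log
  bounded : ∃ R : ℝ, ∀ x, ‖log x‖ ≤ R
  exp_log : ∀ x, lieExp (log x) = x
  log_one : log 1 = 0
  local_diffeo : IsLocalDiffeomorphAt 𝓘(ℝ, E) 𝓘(ℝ, E) ∞ log 1
  conj_inv : ∀ μ : MeasureTheory.Measure G, μ.IsHaarMeasure →
    ∀ᵐ x ∂μ, (∀ y : G, log (y * x * y⁻¹) = Ad y (log x)) ∧ log x⁻¹ = -log x

end Lie

/-! ### The lattice in the two-dimensional torus

Coordinates `1, 2` of the plane are the elements `0, 1` of `Fin 2`. -/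

/-- Sites of `Λ_N`: the site `x` stands for the point `2⁻ᴺ x` of the torus `(ℝ/ℤ)²`. -/
abbrev Site (N : ℕ) : Type := Fin 2 → ZMod (2 ^ N)

/-- The unit step in direction `μ` (length `2⁻ᴺ` in the torus). -/
def step {N : ℕ} (μ : Fin 2) : Site N := Pi.single μ 1

/-- The inclusion `Λ_M ⊆ Λ_N` for `M ≤ N`. -/
def incl {M N : ℕ} (y : Site M) : Site N := fun i => ((2 ^ (N - M) * (y i).val : ℕ) : ZMod (2 ^ N))

/-- Discrete one-forms on `Λ_N`, recorded by their values `A μ x = A(x, x + 2⁻ᴺ e_μ)` on the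
positively oriented bonds; the values on reversed bonds are the negatives. -/
abbrev OneForm (E : Type*) (N : ℕ) : Type _ := Fin 2 → Site N → E

/-- Discrete gauge fields on `Λ_N`, recorded by their values `U μ x = U(x, x + 2⁻ᴺ e_μ)` on the
positively oriented bonds; the values on reversed bonds are the inverses. -/
abbrev GaugeField (G : Type*) (N : ℕ) : Type _ := Fin 2 → Site N → G

/-- The one-form on `Λ_M` induced by a one-form on `Λ_N`, `M ≤ N`: sum along the fine bonds. -/
def OneForm.restr {E : Type*} [AddCommGroup E] {N : ℕ} (A : OneForm E N) (M : ℕ) : OneForm E M :=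
  fun μ y => ∑ k ∈ Finset.range (2 ^ (N - M)), A μ (incl y + k • step μ)

/-- The gauge field on `Λ_M` induced by a gauge field on `Λ_N`, `M ≤ N`: ordered product. -/
def GaugeField.restr {G : Type*} [Group G] {N : ℕ} (U : GaugeField G N) (M : ℕ) : GaugeField G M :=
  fun μ y => ((List.range (2 ^ (N - M))).map fun k => U μ (incl y + k • step μ)).prod

/-- The gauge transform `U^g(x, y) = g(x) U(x, y) g(y)⁻¹`. -/
def GaugeField.transform {G : Type*} [Group G] {N : ℕ} (U : GaugeField G N) (g : Site N → G) :
    GaugeField G N :=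
  fun μ x => g x * U μ x * (g (x + step μ))⁻¹

/-! ### Rectangles and holonomies around their boundaries -/

/-- A rectangle `(base, w 2⁻ᴺ e₁, h 2⁻ᴺ e₂)` of `Λ_N` of width one in at least one direction. -/
structure Rect (N : ℕ) where
  base : Site N
  w : ℕ
  h : ℕ
  one_le_w : 1 ≤ w
  w_lt : w < 2 ^ N
  one_le_h : 1 ≤ h
  h_lt : h < 2 ^ N
  thin : w = 1 ∨ h = 1

/-- The area of a rectangle. -/
def Rect.area {N : ℕ} (r : Rect N) : ℝ := (r.w * r.h : ℝ) / ((2 : ℝ) ^ N) ^ 2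

/-- The values of `U` on the bonds that traverse the boundary of the `m × n` rectangle with
south-west corner `x` anti-clockwise, starting at `x`. -/
def boundaryWord {G : Type*} [Group G] {N : ℕ} (U : GaugeField G N) (x : Site N) (m n : ℕ) :
    List G :=
  ((List.range m).map fun j => U 0 (x + j • step 0)) ++
  ((List.range n).map fun j => U 1 (x + m • step 0 + j • step 1)) ++
  ((List.range m).map fun j => (U 0 (x + (m - 1 - j) • step 0 + n • step 1))⁻¹) ++
  ((List.range n).map fun j => (U 1 (x + (n - 1 - j) • step 1))⁻¹)

/-- The origin `z` of a rectangle is the corner of its south-west plaquette (with corner `x`) both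
of whose coordinates are even multiples of `2⁻ᴺ`. This is the number of bonds between `x` and `z`
on the anti-clockwise boundary of the `m × n` rectangle, where `m = 1` or `n = 1`: it is `0` for
`z = x`, `1` for `z = x + e₁`, all bonds but the last for `z = x + e₂`, and for `z = x + e₁ + e₂` it
is `2 m` if `n = 1` (`z` is on the top side) and `m + 1` if `m = 1` (`z` is on the right side). -/
def originOffset {N : ℕ} (x : Site N) (m n : ℕ) : ℕ :=
  if Even (x 0).val then
    if Even (x 1).val then 0 else 2 * m + 2 * n - 1
  else
    if Even (x 1).val then 1 else if n = 1 then 2 * m else m + 1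

/-- `U(∂r)` for the `m × n` rectangle `r` with south-west corner `x` (`m = 1` or `n = 1`): the
ordered product along the boundary, anti-clockwise from the origin of `r`. -/
def boundaryHol {G : Type*} [Group G] {N : ℕ} (U : GaugeField G N) (x : Site N) (m n : ℕ) : G :=
  ((boundaryWord U x m n).rotate (originOffset x m n)).prod

/-- `U(∂p)` for the plaquette `p` with south-west corner `x`. -/
def plaqHol {G : Type*} [Group G] {N : ℕ} (U : GaugeField G N) (x : Site N) : G :=
  boundaryHol U x 1 1

/-- `U(∂r_i)` where `r_i` is the subrectangle formed by the first `i` plaquettes of `r`, counted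
from the south-west corner; it is `1` for `i = 0`. -/
def subHol {G : Type*} [Group G] {N : ℕ} (U : GaugeField G N) (r : Rect N) (i : ℕ) : G :=
  if i = 0 then 1
  else if r.h = 1 then boundaryHol U r.base i 1 else boundaryHol U r.base 1 i

/-- The anti-development of `U` along `r`: `X_0 = 0` and
`X_i - X_{i-1} = log (U(∂r_{i-1})⁻¹ U(∂r_i))`. -/
def antiDev {G E : Type*} [Group G] [AddCommGroup E] (log : G → E) {N : ℕ} (U : GaugeField G N)
    (r : Rect N) (i : ℕ) : E :=
  ∑ j ∈ Finset.range i, log ((subHol U r j)⁻¹ * subHol U r (j + 1))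

/-- The `q`-variation of the finite sequence `X_0, …, X_k`: the supremum over all increasing
`t_0 < … < t_n ≤ k`. -/
def qVar {E : Type*} [NormedAddCommGroup E] (q : ℝ) (k : ℕ) (X : ℕ → E) : ℝ :=
  sSup {v : ℝ | ∃ (n : ℕ) (t : ℕ → ℕ), (∀ i < n, t i < t (i + 1)) ∧ t n ≤ k ∧
    v = (∑ i ∈ Finset.range n, ‖X (t (i + 1)) - X (t i)‖ ^ q) ^ (1 / q)}

/-! ### The binary Landau gauge -/

section Landau

variable {E : Type*} [NormedAddCommGroup E] [InnerProductSpace ℝ E]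
  {G : Type*} [TopologicalSpace G] [ChartedSpace E G] [Group G]

/-- The rule that defines `A` on the four bonds of `Λ_N` that meet at a site `x` both of whose
coordinates are odd multiples of `2⁻ᴺ`. The plaquettes around `x` are `p₁, …, p₄`, anti-clockwise
from the north-east one, and `a i` is `log U^g(∂p_i)`. The first value is prescribed exactly, each
of the other three up to an arbitrary error of norm at most `K δ²`. -/
def InteriorRule (log : G → E) (K : ℝ) {N : ℕ} (U : GaugeField G N) (g : Site N → G)
    (A : OneForm E N) (x : Site N) : Prop :=
  let p₁ : Site N := x
  let p₂ : Site N := x - step 0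
  let p₃ : Site N := x - step 0 - step 1
  let p₄ : Site N := x - step 1
  let a₁ : E := log (plaqHol (U.transform g) p₁)
  let a₂ : E := log (plaqHol (U.transform g) p₂)
  let a₃ : E := log (plaqHol (U.transform g) p₃)
  let a₄ : E := log (plaqHol (U.transform g) p₄)
  let δ : ℝ := ‖log (plaqHol U p₁)‖ + ‖log (plaqHol U p₂)‖ + ‖log (plaqHol U p₃)‖
    + ‖log (plaqHol U p₄)‖
    + (‖A 0 (x + step 1)‖ + ‖A 0 (x - step 1)‖ + ‖A 1 (x + step 0)‖ + ‖A 1 (x - step 0)‖)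
  let m₁ : E := (1 / 2 : ℝ) • (A 0 (x + step 1) + A 0 (x - step 1))
  let m₂ : E := (1 / 2 : ℝ) • (A 1 (x + step 0) + A 1 (x - step 0))
  A 0 x = m₁ + (3 / 8 : ℝ) • (a₁ - a₄) + (1 / 8 : ℝ) • (a₂ - a₃) ∧
  ‖A 1 x - (m₂ + (3 / 8 : ℝ) • (a₂ - a₁) + (1 / 8 : ℝ) • (a₃ - a₄))‖ ≤ K * δ ^ 2 ∧
  ‖A 0 (x - step 0) - (m₁ + (3 / 8 : ℝ) • (a₂ - a₃) + (1 / 8 : ℝ) • (a₁ - a₄))‖ ≤ K * δ ^ 2 ∧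
  ‖A 1 (x - step 1) - (m₂ + (3 / 8 : ℝ) • (a₃ - a₄) + (1 / 8 : ℝ) • (a₂ - a₁))‖ ≤ K * δ ^ 2

/-- `(A, g)` is an output of the binary Landau gauge construction applied to `U` on `Λ_{N₁}`, started
at the scale `N₀` and with errors of size at most `K δ²`. -/
structure IsBinaryLandau (log : G → E) (K : ℝ) (N₀ : ℕ) {N₁ : ℕ} (U : GaugeField G N₁)
    (A : OneForm E N₁) (g : Site N₁ → G) : Prop where
  /-- the gauge transform is trivial on `Λ_{N₀}` -/
  gauge_init : ∀ y : Site N₀, g (incl y) = 1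
  /-- `A = log U` on the bonds of `Λ_{N₀}` -/
  form_init : ∀ (μ : Fin 2) (y : Site N₀), A.restr N₀ μ y = log (U.restr N₀ μ y)
  /-- `exp A = U^g` at every scale -/
  exp_eq : ∀ N, N₀ ≤ N → N ≤ N₁ → ∀ (μ : Fin 2) (y : Site N),
    lieExp (A.restr N μ y) = (U.restr N).transform (fun x => g (incl x)) μ y
  /-- each bond of `Λ_M` is split into two bonds of `Λ_{M+1}` that carry half of its value -/
  halving : ∀ M, N₀ ≤ M → M < N₁ → ∀ (μ : Fin 2) (y : Site M),
    A.restr (M + 1) μ (incl y) = (1 / 2 : ℝ) • A.restr M μ y ∧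
    A.restr (M + 1) μ (incl y + step μ) = (1 / 2 : ℝ) • A.restr M μ y
  /-- the values on the four new bonds of `Λ_{M+1}` in the interior of each plaquette of `Λ_M` -/
  interior : ∀ M, N₀ ≤ M → M < N₁ → ∀ y : Site M,
    InteriorRule log K (U.restr (M + 1)) (fun x => g (incl x)) (A.restr (M + 1))
      (incl y + step 0 + step 1)

end Landau

/-! ### Axis segments -/

/-- The torus `(ℝ/ℤ)²` with its flat geodesic metric. -/
abbrev Torus : Type := PiLp 2 (fun _ : Fin 2 => UnitAddCircle)

/-- An axis line segment that is a union of `len ≥ 1` consecutive bonds of `Λ_N`, starting at `base`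
in direction `dir`; the whole circle (`len = 2ᴺ`) is allowed. -/
structure Seg (N : ℕ) where
  base : Site N
  dir : Fin 2
  len : ℕ
  one_le_len : 1 ≤ len
  len_le : len ≤ 2 ^ N

/-- The length `|ℓ|`. -/
def Seg.length {N : ℕ} (l : Seg N) : ℝ := (l.len : ℝ) / (2 : ℝ) ^ N

/-- The subset of the torus covered by the segment. -/
def Seg.carrier {N : ℕ} (l : Seg N) : Set Torus :=
  (fun c : ℝ => WithLp.toLp 2 fun i : Fin 2 =>
    ((((l.base i).val : ℝ) / (2 : ℝ) ^ N + if i = l.dir then c else 0 : ℝ) : UnitAddCircle)) ''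
    Set.Icc 0 l.length

/-- Two segments are parallel if they have the same direction and the same projection to the axis
in that direction. -/
def Seg.Parallel {N : ℕ} (l l' : Seg N) : Prop :=
  l.dir = l'.dir ∧
    (fun p : Torus => p l.dir) '' l.carrier = (fun p : Torus => p l.dir) '' l'.carrier

/-- The distance `d(ℓ, ℓ') = inf {|x - y| : x ∈ ℓ, y ∈ ℓ'}`. -/
def Seg.distance {N : ℕ} (l l' : Seg N) : ℝ :=
  sInf {t : ℝ | ∃ x ∈ l.carrier, ∃ y ∈ l'.carrier, t = dist x y}

/-- `A(ℓ)`: the sum of `A` over the bonds of the segment. -/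
def OneForm.eval {E : Type*} [AddCommGroup E] {N : ℕ} (A : OneForm E N) (l : Seg N) : E :=
  ∑ j ∈ Finset.range l.len, A l.dir (l.base + j • step l.dir)

end BinaryLandau

end

/-!
The proof works with a local calculus of `exp` and `log` on a ball of the Lie algebra
(`LocalCalculus`): the Baker–Campbell–Hausdorff formula to first order, conjugation covariance of the
logarithm (`IsLogMap.exists_log_conj`; the almost everywhere identity extends by density and
continuity), and a first order expansion of `Ad (exp X)`. The exponential map is defined through
one-parameter subgroups; their existence follows from the local inverse of the logarithm, their
uniqueness from that of integral curves.

*Existence.* A gauge on `Λ_N` is refined to `Λ_{N+1}`: the gauge transform at the midpoint of a bond is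
chosen so that the two halves carry equal values, and the one at the centre of a plaquette so that the
first inner bond carries the value that the interior rule prescribes. The other three inner bonds are
then determined by the plaquette holonomies. If the data `δ` are small, linearizing the four holonomy
equations gives the rule up to `O(δ²)` (`LocalCalculus.interior_small`); otherwise the boundedness of
the logarithm gives it, for large `K` (`LocalCalculus.interior_bound`).

*Regularity.* The interior rule says that the bonds of a level are at most half as large as those of
the previous level plus plaquette terms, up to quadratic errors. For small initial data this gives
`|A^N| ≲ 2 ^ (-N α)` (`LocalCalculus.norm_level_le`). To compare two neighbouring parallel segments,
the holonomies of the `k` plaquettes between them are multiplied up: each logarithm is a difference of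
values of `A`, and also an increment of the anti-development, rotated by the adjoint action of the
parallel transport along one of the segments. That transport is Hölder continuous, with a constant
controlled by the Hölder constant `H` of `A` on lines (`exists_norm_prod_sub_one_le`), so that
Young's inequality (`young_sum_le`) bounds the difference by `(1 + H) (k / 4 ^ N) ^ (α / 2)`; the
quadratic errors `k θ²` with `θ ≲ 2 ^ (-N α)` are of this order because `α ≥ 2 / 3`
(`LocalCalculus.exists_lineSum_sub_le`).

On the even lines of `Λ_{N+1}` a segment carries the average of two segments of `Λ_N`, so that by
concavity of `t ↦ t ^ b` the Hölder bound is inherited with the same constant; the odd lines are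
compared with the even ones. Hence `H (N + 1) ≤ H N + C (1 + H (N + 1)) y ^ (N + 1)` with `y < 1`, and
`H` stays bounded (`exists_bound_of_recursion`). The bound for neighbouring lines of every coarser
level is inherited by concavity in the same way, and dyadic chaining over the transverse coordinate
yields the bound for arbitrary parallel segments (`exists_holder_bound`).
-/

namespace BinaryLandau

/-! ### Exponential map and logarithm near the identity -/

section LieCalculus

open Set Filter Topology Metric

/-- Second order Taylor estimate: a `C²` function agrees with its linearization up to a quadratic
error. -/
theorem exists_taylor_quadratic {F F' : Type*} [NormedAddCommGroup F] [NormedSpace ℝ F]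
    [NormedAddCommGroup F'] [NormedSpace ℝ F'] {f : F → F'} {p : F} (hf : ContDiffAt ℝ 2 f p) :
    ∃ ε : ℝ, 0 < ε ∧ ∃ C : ℝ, 0 ≤ C ∧ ∀ h : F, ‖h‖ < ε →
      ‖f (p + h) - f p - fderiv ℝ f p h‖ ≤ C * ‖h‖ ^ 2 := by
  have hd : ContDiffAt ℝ 1 (fderiv ℝ f) p := hf.fderiv_right (m := 1) (by norm_num)
  obtain ⟨L, t, ht, hL⟩ := hd.exists_lipschitzOnWith
  have hdiff : ∀ᶠ x in 𝓝 p, DifferentiableAt ℝ f x := by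
    filter_upwards [hf.eventually (by simp)] with x hx
    exact hx.differentiableAt (by norm_num)
  obtain ⟨ε, hε, hball⟩ := Metric.mem_nhds_iff.1 (Filter.inter_mem ht hdiff)
  refine ⟨ε, hε, L, L.2, fun h hh => ?_⟩
  have key := (convex_closedBall p ‖h‖).norm_image_sub_le_of_norm_fderiv_le' (𝕜 := ℝ) (f := f)
    (φ := fderiv ℝ f p) (C := L * ‖h‖) (x := p) (y := p + h) ?_ ?_ ?_ ?_
  · simpa [pow_two, mul_assoc] using key
  · intro x hx
    exact (hball (mem_ball.2 (lt_of_le_of_lt (mem_closedBall.1 hx) hh))).2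
  · intro x hx
    have hx' := (hball (mem_ball.2 (lt_of_le_of_lt (mem_closedBall.1 hx) hh))).1
    have hp : p ∈ t := (hball (mem_ball_self hε)).1
    have := hL.dist_le_mul x hx' p hp
    rw [dist_eq_norm, dist_eq_norm] at this
    refine this.trans (mul_le_mul_of_nonneg_left ?_ L.2)
    simpa [dist_eq_norm] using hx
  · simp
  · simp [dist_eq_norm]

variable {E : Type*} [NormedAddCommGroup E] [InnerProductSpace ℝ E]
  {G : Type*} [TopologicalSpace G] [ChartedSpace E G] [Group G]
  [MeasurableSpace G] [MeasurableSpace E]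

/-- Near `0` the exponential map is the smooth local inverse of the logarithm. -/
theorem IsLogMap.exists_local_inverse {log : G → E} (hlog : IsLogMap log) :
    ∃ ε : ℝ, 0 < ε ∧ ∃ S : Set G, IsOpen S ∧ (1 : G) ∈ S ∧
      ContMDiffOn 𝓘(ℝ, E) 𝓘(ℝ, E) ∞ log S ∧
      ContMDiffOn 𝓘(ℝ, E) 𝓘(ℝ, E) ∞ (lieExp : E → G) (ball 0 ε) ∧
      ∀ X ∈ ball (0 : E) ε, (lieExp X : G) ∈ S ∧ log (lieExp X) = X := by
  obtain ⟨Φ, h1, hEq⟩ := hlog.local_diffeo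
  have h0 : (0 : E) ∈ Φ.target := by
    have := Φ.map_source h1
    rwa [show Φ.toPartialEquiv 1 = 0 from (hEq h1).symm.trans hlog.log_one] at this
  obtain ⟨ε, hε, hball⟩ := Metric.isOpen_iff.1 Φ.open_target 0 h0
  have hinv : ∀ X ∈ ball (0 : E) ε, (lieExp X : G) = Φ.toPartialEquiv.symm X := by
    intro X hX
    have hs := Φ.map_target (hball hX)
    have h2 : log (Φ.toPartialEquiv.symm X) = X := (hEq hs).trans (Φ.right_inv (hball hX))
    rw [← hlog.exp_log (Φ.toPartialEquiv.symm X), h2]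
  refine ⟨ε, hε, Φ.source, Φ.open_source, h1, ?_, ?_, ?_⟩
  · exact Φ.contMDiffOn_toFun.congr hEq
  · exact (Φ.contMDiffOn_invFun.mono hball).congr hinv
  · intro X hX
    have hs := Φ.map_target (hball hX)
    rw [hinv X hX]
    exact ⟨hs, (hEq hs).trans (Φ.right_inv (hball hX))⟩

theorem IsLogMap.lieExp_zero {log : G → E} (hlog : IsLogMap log) : (lieExp (0 : E) : G) = 1 := by
  rw [← hlog.log_one, hlog.exp_log]

variable [LieGroup 𝓘(ℝ, E) ∞ G]

/-- First order Baker–Campbell–Hausdorff estimate near the identity. -/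
theorem IsLogMap.exists_log_mul {log : G → E} (hlog : IsLogMap log) :
    ∃ ε : ℝ, 0 < ε ∧ ∃ C : ℝ, 0 ≤ C ∧ ∀ X Y : E, ‖X‖ < ε → ‖Y‖ < ε →
      log (lieExp X : G) = X ∧
      ‖log ((lieExp X : G) * lieExp Y) - (X + Y)‖ ≤ C * (‖X‖ + ‖Y‖) ^ 2 := by
  obtain ⟨ε, hε, S, hS, h1, hlogS, hexp, hinv⟩ := hlog.exists_local_inverse
  have he0 := hlog.lieExp_zero
  let f : E × E → E := fun p => log ((lieExp p.1 : G) * lieExp p.2)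
  have hexp0 : ContMDiffAt 𝓘(ℝ, E) 𝓘(ℝ, E) ∞ (lieExp : E → G) 0 :=
    hexp.contMDiffAt (ball_mem_nhds _ hε)
  have hf : ContDiffAt ℝ ∞ f 0 := by
    rw [← contMDiffAt_iff_contDiffAt]
    have hA : ContMDiffAt 𝓘(ℝ, E × E) 𝓘(ℝ, E) ∞
        (fun p : E × E => (lieExp p.1 : G) * lieExp p.2) 0 :=
      (ContMDiffAt.comp (0 : E × E) (g := (lieExp : E → G)) hexp0
        contDiff_fst.contMDiff.contMDiffAt).mul
        (ContMDiffAt.comp (0 : E × E) (g := (lieExp : E → G)) hexp0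
          contDiff_snd.contMDiff.contMDiffAt)
    refine ContMDiffAt.comp (0 : E × E) (g := log) ?_ hA
    refine hlogS.contMDiffAt (hS.mem_nhds ?_)
    simpa [he0] using h1
  obtain ⟨ε', hε', C, hC, hT⟩ := exists_taylor_quadratic (hf.of_le ENat.LEInfty.out)
  have hdf : HasFDerivAt f (fderiv ℝ f 0) 0 := (hf.differentiableAt (by simp)).hasFDerivAt
  have hf0 : f 0 = 0 := by simp [f, he0, hlog.log_one]
  have hl : ∀ X : E, fderiv ℝ f 0 (X, 0) = X := by
    intro X
    have h2 : HasFDerivAt (fun X : E => f (X, 0))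
        ((fderiv ℝ f 0).comp (ContinuousLinearMap.inl ℝ E E)) 0 :=
      HasFDerivAt.comp (0 : E) (g := f) hdf (ContinuousLinearMap.inl ℝ E E).hasFDerivAt
    have h3 : HasFDerivAt (fun X : E => f (X, 0)) (ContinuousLinearMap.id ℝ E) 0 := by
      refine (hasFDerivAt_id (𝕜 := ℝ) (0 : E)).congr_of_eventuallyEq ?_
      filter_upwards [ball_mem_nhds (0 : E) hε] with Y hY
      simp [f, he0, (hinv Y hY).2]
    simpa using congrArg (fun T : E →L[ℝ] E => T X) (h2.unique h3)
  have hr : ∀ X : E, fderiv ℝ f 0 (0, X) = X := by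
    intro X
    have h2 : HasFDerivAt (fun X : E => f (0, X))
        ((fderiv ℝ f 0).comp (ContinuousLinearMap.inr ℝ E E)) 0 :=
      HasFDerivAt.comp (0 : E) (g := f) hdf (ContinuousLinearMap.inr ℝ E E).hasFDerivAt
    have h3 : HasFDerivAt (fun X : E => f (0, X)) (ContinuousLinearMap.id ℝ E) 0 := by
      refine (hasFDerivAt_id (𝕜 := ℝ) (0 : E)).congr_of_eventuallyEq ?_
      filter_upwards [ball_mem_nhds (0 : E) hε] with Y hY
      simp [f, he0, (hinv Y hY).2]
    simpa using congrArg (fun T : E →L[ℝ] E => T X) (h2.unique h3)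
  refine ⟨min ε ε', lt_min hε hε', C, hC, fun X Y hX hY => ?_⟩
  refine ⟨(hinv X (by simpa using lt_of_lt_of_le hX (min_le_left _ _))).2, ?_⟩
  have hXY : ‖(X, Y)‖ < ε' := by
    rw [Prod.norm_def]
    exact max_lt (lt_of_lt_of_le hX (min_le_right _ _)) (lt_of_lt_of_le hY (min_le_right _ _))
  have h4 := hT (X, Y) hXY
  have h5 : fderiv ℝ f 0 (X, Y) = X + Y := by
    rw [show ((X, Y) : E × E) = (X, 0) + (0, Y) by simp, map_add, hl, hr]
  rw [zero_add, hf0, sub_zero, h5] at h4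
  refine h4.trans (mul_le_mul_of_nonneg_left ?_ hC)
  refine pow_le_pow_left₀ (norm_nonneg _) ?_ 2
  rw [Prod.norm_def]
  exact max_le (by simp) (by simp)

/-- The logarithm intertwines conjugation and the adjoint action near the identity: the identity
that is assumed almost everywhere extends by continuity. -/
theorem IsLogMap.exists_log_conj [CompactSpace G] [T2Space G] [BorelSpace G]
    {log : G → E} (hlog : IsLogMap log) :
    ∃ ε : ℝ, 0 < ε ∧ ∀ x : G, ‖log x‖ < ε → ∀ y : G, log (y * x * y⁻¹) = Ad y (log x) := by
  obtain ⟨ε, hε, S, hS, h1, hlogS, hexp, hinv⟩ := hlog.exists_local_inverse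
  have : IsTopologicalGroup G := topologicalGroup_of_lieGroup 𝓘(ℝ, E) ∞
  have hdense := MeasureTheory.Measure.dense_of_ae
    (hlog.conj_inv (MeasureTheory.Measure.haar : MeasureTheory.Measure G) inferInstance)
  -- by compactness a neighbourhood of `1` has all its conjugates in the domain of smoothness of `log`
  have hev : ∀ᶠ x in 𝓝 (1 : G), ∀ y ∈ (univ : Set G), y * x * y⁻¹ ∈ S := by
    refine isCompact_univ.eventually_forall_of_forall_eventually fun y _ => ?_
    have hc : Continuous fun p : G × G => p.2 * p.1 * p.2⁻¹ := by fun_prop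
    refine hc.continuousAt.eventually_mem ?_
    exact hS.mem_nhds (by simpa using h1)
  have hcexp : ContinuousAt (lieExp : E → G) 0 :=
    (hexp.contMDiffAt (ball_mem_nhds _ hε)).continuousAt
  rw [ContinuousAt, hlog.lieExp_zero] at hcexp
  obtain ⟨ε', hε', hb⟩ := Metric.eventually_nhds_iff_ball.1 (hcexp.eventually hev)
  refine ⟨ε', hε', fun x hx y => ?_⟩
  have hxS := hb (log x) (by simpa using hx)
  rw [hlog.exp_log] at hxS
  have hx1 : x ∈ S := by simpa using hxS 1 (mem_univ _)
  have hcl : ∀ z ∈ S, ContinuousAt log z := fun z hz =>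
    (hlogS.contMDiffAt (hS.mem_nhds hz)).continuousAt
  have : (𝓝[{x | (∀ y : G, log (y * x * y⁻¹) = Ad y (log x)) ∧ log x⁻¹ = -log x}] x).NeBot :=
    mem_closure_iff_nhdsWithin_neBot.1 (hdense x)
  have t1 : Tendsto (fun z => log (y * z * y⁻¹))
      (𝓝[{x | (∀ y : G, log (y * x * y⁻¹) = Ad y (log x)) ∧ log x⁻¹ = -log x}] x)
      (𝓝 (log (y * x * y⁻¹))) := by
    refine Tendsto.mono_left ?_ nhdsWithin_le_nhds
    have hc : Continuous fun z : G => y * z * y⁻¹ := by fun_prop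
    exact (ContinuousAt.comp (f := fun z : G => y * z * y⁻¹)
      (hcl _ (hxS y (mem_univ _))) hc.continuousAt)
  have t2 : Tendsto (fun z => Ad y (log z))
      (𝓝[{x | (∀ y : G, log (y * x * y⁻¹) = Ad y (log x)) ∧ log x⁻¹ = -log x}] x)
      (𝓝 (Ad y (log x))) := by
    refine Tendsto.mono_left ?_ nhdsWithin_le_nhds
    exact (Ad (E := E) y).continuous.continuousAt.comp (hcl x hx1)
  refine tendsto_nhds_unique_of_eventuallyEq t1 t2 ?_
  filter_upwards [self_mem_nhdsWithin] with z hz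
  exact hz.1 y

end LieCalculus

/-! ### The adjoint action -/

section LieAdjoint

open Set Filter Topology Metric

variable {E : Type*} [NormedAddCommGroup E] [InnerProductSpace ℝ E]
  {G : Type*} [TopologicalSpace G] [ChartedSpace E G] [Group G]

theorem norm_Ad_apply (hAd : ∀ (y : G) (X Y : E), inner ℝ (Ad y X) (Ad y Y) = inner ℝ X Y)
    (y : G) (X : E) : ‖Ad y X‖ = ‖X‖ := by
  rw [norm_eq_sqrt_real_inner, hAd, ← norm_eq_sqrt_real_inner]

/-- Two linear maps that agree on a ball are equal. -/
theorem clm_ext_of_ball {T S : E →L[ℝ] E} {ε : ℝ} (hε : 0 < ε)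
    (h : ∀ v : E, ‖v‖ < ε → T v = S v) : T = S := by
  ext v
  obtain ⟨t, ht, htv⟩ : ∃ t : ℝ, 0 < t ∧ ‖t • v‖ < ε := by
    refine ⟨ε / (‖v‖ + 1), by positivity, ?_⟩
    rw [norm_smul, Real.norm_of_nonneg (by positivity), div_mul_eq_mul_div,
      div_lt_iff₀ (by positivity)]
    nlinarith [norm_nonneg v]
  have := h _ htv
  rw [map_smul, map_smul] at this
  exact smul_right_injective E ht.ne' this

variable [MeasurableSpace G] [MeasurableSpace E] [LieGroup 𝓘(ℝ, E) ∞ G]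
  [CompactSpace G] [T2Space G] [BorelSpace G]

/-- The adjoint action is multiplicative: on small vectors this is the conjugation covariance of
the logarithm applied twice. -/
theorem IsLogMap.Ad_mul (hAd : ∀ (y : G) (X Y : E), inner ℝ (Ad y X) (Ad y Y) = inner ℝ X Y)
    {log : G → E} (hlog : IsLogMap log) (x y : G) :
    Ad (E := E) (x * y) = Ad (E := E) x * Ad (E := E) y := by
  obtain ⟨ε, hε, C, hC, hbch⟩ := hlog.exists_log_mul
  obtain ⟨ε', hε', hconj⟩ := hlog.exists_log_conj
  refine clm_ext_of_ball (lt_min hε hε') fun v hv => ?_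
  have h1 := (hbch v v (lt_of_lt_of_le hv (min_le_left _ _))
    (lt_of_lt_of_le hv (min_le_left _ _))).1
  have h2 : ‖log (lieExp v : G)‖ < ε' := by rw [h1]; exact lt_of_lt_of_le hv (min_le_right _ _)
  have h3 := hconj _ h2 y
  have h4 : ‖log (y * (lieExp v : G) * y⁻¹)‖ < ε' := by
    rw [h3, norm_Ad_apply hAd]; exact h2
  have h5 := hconj _ h4 x
  have h6 := hconj _ h2 (x * y)
  rw [h3, h1] at h5
  rw [h1] at h6
  rw [mul_apply_eq_comp, ← h5, ← h6]
  congr 1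
  group

theorem IsLogMap.Ad_one {log : G → E} (hlog : IsLogMap log) :
    Ad (E := E) (1 : G) = 1 := by
  obtain ⟨ε, hε, C, hC, hbch⟩ := hlog.exists_log_mul
  obtain ⟨ε', hε', hconj⟩ := hlog.exists_log_conj
  refine clm_ext_of_ball (lt_min hε hε') fun v hv => ?_
  have h1 := (hbch v v (lt_of_lt_of_le hv (min_le_left _ _))
    (lt_of_lt_of_le hv (min_le_left _ _))).1
  have h2 : ‖log (lieExp v : G)‖ < ε' := by rw [h1]; exact lt_of_lt_of_le hv (min_le_right _ _)
  have h3 := hconj _ h2 1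
  simpa [h1] using h3.symm

/-- The adjoint action of `exp X` is `1 + L X` up to a quadratic error, with `L` linear. -/
theorem IsLogMap.exists_Ad_taylor [FiniteDimensional ℝ E]
    (hAd : ∀ (y : G) (X Y : E), inner ℝ (Ad y X) (Ad y Y) = inner ℝ X Y)
    {log : G → E} (hlog : IsLogMap log) :
    ∃ ε : ℝ, 0 < ε ∧ ∃ C : ℝ, 0 ≤ C ∧ ∃ L : E →L[ℝ] (E →L[ℝ] E), ∀ X : E, ‖X‖ < ε →
      ‖Ad (E := E) (lieExp X : G) - 1 - L X‖ ≤ C * ‖X‖ ^ 2 := by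
  obtain ⟨ε, hε, S, hS, h1, hlogS, hexp, hinv⟩ := hlog.exists_local_inverse
  obtain ⟨ε', hε', hconj⟩ := hlog.exists_log_conj
  -- `Ad (exp X) v = t⁻¹ log (exp X exp (t v) (exp X)⁻¹)` for small `t > 0` is smooth in `X`
  have hsm : ContDiffOn ℝ ∞ (fun X : E => Ad (E := E) (lieExp X : G)) (ball 0 ε) := by
    rw [contDiffOn_clm_apply]
    intro v
    obtain ⟨t, ht, htv⟩ : ∃ t : ℝ, 0 < t ∧ ‖t • v‖ < min ε ε' := by
      have hm := lt_min hε hε'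
      refine ⟨min ε ε' / (‖v‖ + 1), by positivity, ?_⟩
      rw [norm_smul, Real.norm_of_nonneg (by positivity), div_mul_eq_mul_div,
        div_lt_iff₀ (by positivity)]
      nlinarith [norm_nonneg v]
    have hv := hinv (t • v) (by simpa using lt_of_lt_of_le htv (min_le_left _ _))
    have hc : ∀ y : G, log (y * lieExp (t • v) * y⁻¹) = Ad y (t • v) := fun y => by
      rw [hconj _ (by rw [hv.2]; exact lt_of_lt_of_le htv (min_le_right _ _)), hv.2]
    have hmem : ∀ y : G, y * lieExp (t • v) * y⁻¹ ∈ S := fun y => by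
      rw [← hlog.exp_log (y * lieExp (t • v) * y⁻¹), hc]
      refine (hinv _ ?_).1
      rw [mem_ball_zero_iff, norm_Ad_apply hAd]
      exact lt_of_lt_of_le htv (min_le_left _ _)
    have hprod : ContMDiffOn 𝓘(ℝ, E) 𝓘(ℝ, E) ∞
        (fun X : E => (lieExp X : G) * lieExp (t • v) * (lieExp X)⁻¹) (ball 0 ε) :=
      (hexp.mul contMDiffOn_const).mul hexp.inv
    have hcomp : ContDiffOn ℝ ∞
        (fun X : E => log ((lieExp X : G) * lieExp (t • v) * (lieExp X)⁻¹)) (ball 0 ε) := by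
      rw [← contMDiffOn_iff_contDiffOn]
      exact hlogS.comp hprod fun X _ => hmem _
    refine (hcomp.const_smul t⁻¹).congr fun X _ => ?_
    rw [hc, map_smul, smul_smul, inv_mul_cancel₀ ht.ne', one_smul]
  obtain ⟨δ, hδ, C, hC, hT⟩ := exists_taylor_quadratic
    ((hsm.contDiffAt (ball_mem_nhds _ hε)).of_le ENat.LEInfty.out)
  refine ⟨δ, hδ, C, hC, fderiv ℝ (fun X : E => Ad (E := E) (lieExp X : G)) 0, fun X hX => ?_⟩
  have := hT X hX
  rwa [zero_add, hlog.lieExp_zero, hlog.Ad_one] at this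

end LieAdjoint

/-! ### One-parameter subgroups -/

section OneParameter

open Set Filter Topology Metric

variable {E : Type*} [NormedAddCommGroup E] [InnerProductSpace ℝ E]
  {G : Type*} [TopologicalSpace G] [ChartedSpace E G] [Group G]

theorem IsOneParam.map_zero {X : E} {φ : ℝ → G} (h : IsOneParam X φ) : φ 0 = 1 := by
  have := h.1 0 0
  simpa using this

theorem IsOneParam.rescale {X : E} {φ : ℝ → G} (h : IsOneParam X φ) (c : ℝ) :
    IsOneParam (c • X) (fun t => φ (c * t)) := by
  refine ⟨fun s t => by simp only [mul_add, h.1], ?_⟩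
  have h1 : HasMFDerivAt 𝓘(ℝ, ℝ) 𝓘(ℝ, ℝ) (fun t : ℝ => c * t) 0
      (c • ContinuousLinearMap.id ℝ ℝ) := by
    exact HasFDerivAt.hasMFDerivAt ((hasFDerivAt_id (𝕜 := ℝ) (0 : ℝ)).const_mul c)
  have h2 : HasMFDerivAt 𝓘(ℝ, ℝ) 𝓘(ℝ, E) φ (c * 0)
      (ContinuousLinearMap.toSpanSingleton ℝ X : ℝ →L[ℝ] E) := by
    rw [mul_zero]; exact h.2
  have h3 := HasMFDerivAt.comp (0 : ℝ) (f := fun t : ℝ => c * t) h2 h1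
  have h4 : (ContinuousLinearMap.toSpanSingleton ℝ X : ℝ →L[ℝ] E).comp
      (c • ContinuousLinearMap.id ℝ ℝ) = ContinuousLinearMap.toSpanSingleton ℝ (c • X) := by
    ext
    simp
  exact h4 ▸ h3

variable [LieGroup 𝓘(ℝ, E) ∞ G]

/-- A one-parameter subgroup is an integral curve of the left-invariant vector field given by its
velocity: translate the derivative at `0`. -/
theorem IsOneParam.isMIntegralCurve {X : E} {φ : ℝ → G} (h : IsOneParam X φ) :
    IsMIntegralCurve (I := 𝓘(ℝ, E)) φ (mulInvariantVectorField (I := 𝓘(ℝ, E)) (G := G) X) := by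
  intro t
  have h1 : HasMFDerivAt 𝓘(ℝ, ℝ) 𝓘(ℝ, ℝ) (fun s : ℝ => s - t) t
      (ContinuousLinearMap.id ℝ ℝ) := by
    refine HasFDerivAt.hasMFDerivAt ?_
    exact (hasFDerivAt_id (𝕜 := ℝ) t).sub_const t
  have h2 : HasMFDerivAt 𝓘(ℝ, ℝ) 𝓘(ℝ, E) φ (t - t)
      (ContinuousLinearMap.toSpanSingleton ℝ X : ℝ →L[ℝ] E) := by
    rw [sub_self]; exact h.2
  have h3 := HasMFDerivAt.comp t (f := fun s : ℝ => s - t) h2 h1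
  have h4 : HasMFDerivAt 𝓘(ℝ, E) 𝓘(ℝ, E) (fun b : G => φ t * b) (φ (t - t))
      (mfderiv 𝓘(ℝ, E) 𝓘(ℝ, E) (fun b : G => φ t * b) 1) := by
    rw [sub_self, h.map_zero]
    exact ((contMDiff_mul_left (I := 𝓘(ℝ, E)) (n := ∞) (a := φ t)).mdifferentiable
      (by simp)).mdifferentiableAt.hasMFDerivAt
  have h5 := HasMFDerivAt.comp t (f := φ ∘ fun s : ℝ => s - t) (g := fun b : G => φ t * b) h4 h3
  have h6 : ((fun b : G => φ t * b) ∘ φ ∘ fun s : ℝ => s - t) = φ := by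
    funext s
    simp only [Function.comp]
    rw [← h.1]; congr 1; ring
  rw [h6] at h5
  have h7 : (mfderiv 𝓘(ℝ, E) 𝓘(ℝ, E) (fun b : G => φ t * b) 1).comp
      ((ContinuousLinearMap.toSpanSingleton ℝ X : ℝ →L[ℝ] E).comp
        (ContinuousLinearMap.id ℝ ℝ)) = ContinuousLinearMap.smulRight (1 : ℝ →L[ℝ] ℝ)
        (mulInvariantVectorField (I := 𝓘(ℝ, E)) (G := G) X (φ t)) := by
    refine ContinuousLinearMap.ext_ring ?_
    change (mfderiv 𝓘(ℝ, E) 𝓘(ℝ, E) (fun b : G => φ t * b) 1) ((1 : ℝ) • X) =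
      (1 : ℝ) • (mfderiv 𝓘(ℝ, E) 𝓘(ℝ, E) (fun b : G => φ t * b) 1) X
    exact map_smul _ _ _
  exact h7 ▸ h5


variable [MeasurableSpace G] [MeasurableSpace E]

/-- Every vector is the velocity of a one-parameter subgroup: for small `X ≠ 0` the value of the
exponential differs from `1` by injectivity of the local inverse of the logarithm, so it does not
come from the placeholder; the general case follows by rescaling. -/
theorem IsLogMap.exists_isOneParam {log : G → E} (hlog : IsLogMap log) (X : E) :
    ∃ φ : ℝ → G, IsOneParam X φ := by
  obtain ⟨ε, hε, C, hC, hbch⟩ := hlog.exists_log_mul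
  by_cases hX : X = 0
  · refine ⟨fun _ => 1, fun s t => by simp, ?_⟩
    rw [hX, ContinuousLinearMap.toSpanSingleton_zero]
    exact hasMFDerivAt_const _ _
  obtain ⟨t, ht, htv⟩ : ∃ t : ℝ, 0 < t ∧ ‖t • X‖ < ε := by
    refine ⟨ε / (‖X‖ + 1), by positivity, ?_⟩
    rw [norm_smul, Real.norm_of_nonneg (by positivity), div_mul_eq_mul_div,
      div_lt_iff₀ (by positivity)]
    nlinarith [norm_nonneg X]
  have hex : ∃ φ : ℝ → G, IsOneParam (t • X) φ := by
    by_contra hno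
    have h1 : log (lieExp (t • X) : G) = t • X := (hbch _ _ htv htv).1
    rw [lieExp, dif_neg hno, hlog.log_one] at h1
    exact hX ((smul_eq_zero.1 h1.symm).resolve_left ht.ne')
  obtain ⟨φ, hφ⟩ := hex
  have := hφ.rescale t⁻¹
  rw [smul_smul, inv_mul_cancel₀ ht.ne', one_smul] at this
  exact ⟨_, this⟩

variable [T2Space G]

omit [MeasurableSpace G] [MeasurableSpace E] in
/-- A one-parameter subgroup is determined by its velocity, as an integral curve of a left-invariant
vector field. -/
theorem IsOneParam.unique {X : E} {φ ψ : ℝ → G} (h : IsOneParam X φ) (h' : IsOneParam X ψ) :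
    φ = ψ := by
  have : LieGroup 𝓘(ℝ, E) (minSmoothness ℝ 3) G := by
    rw [minSmoothness_of_isRCLikeNormedField]; infer_instance
  have hv := contMDiff_mulInvariantVectorField (I := 𝓘(ℝ, E)) (G := G) X
  exact isMIntegralCurve_Ioo_eq_of_contMDiff_boundaryless (t₀ := 0)
    (hv.of_le (by rw [minSmoothness_of_isRCLikeNormedField]; norm_num))
    h.isMIntegralCurve h'.isMIntegralCurve (by rw [h.map_zero, h'.map_zero])

omit [MeasurableSpace G] [MeasurableSpace E] in
theorem IsOneParam.lieExp_eq {X : E} {φ : ℝ → G} (h : IsOneParam X φ) : lieExp X = φ 1 := by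
  have hex : ∃ φ : ℝ → G, IsOneParam X φ := ⟨φ, h⟩
  rw [lieExp, dif_pos hex, hex.choose_spec.unique h]

theorem IsLogMap.lieExp_half_mul_self {log : G → E} (hlog : IsLogMap log) (X : E) :
    (lieExp ((1 / 2 : ℝ) • X) : G) * lieExp ((1 / 2 : ℝ) • X) = lieExp X := by
  obtain ⟨φ, hφ⟩ := hlog.exists_isOneParam X
  rw [(hφ.rescale (1 / 2)).lieExp_eq, hφ.lieExp_eq, ← hφ.1]
  norm_num

theorem IsLogMap.lieExp_neg {log : G → E} (hlog : IsLogMap log) (X : E) :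
    (lieExp (-X) : G) = (lieExp X)⁻¹ := by
  obtain ⟨φ, hφ⟩ := hlog.exists_isOneParam X
  have h := hφ.rescale (-1)
  rw [neg_one_smul] at h
  rw [h.lieExp_eq, hφ.lieExp_eq, eq_inv_iff_mul_eq_one, ← hφ.1]
  simpa using hφ.map_zero

end OneParameter

/-! ### The local calculus of exponential map and logarithm -/

section LocalCalculus

variable {E : Type*} [NormedAddCommGroup E] [InnerProductSpace ℝ E]
  {G : Type*} [TopologicalSpace G] [ChartedSpace E G] [Group G]

/-- The local calculus of the pair `exp`, `log` on the ball of radius `ε`, with constant `C` in the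
quadratic error terms; `L` is the differential of `X ↦ Ad (exp X)` at `0`. All analytic information
about the group that is needed below is contained in this structure. -/
structure LocalCalculus (log : G → E) (ε C : ℝ) (L : E →L[ℝ] (E →L[ℝ] E)) : Prop where
  pos : 0 < ε
  nonneg : 0 ≤ C
  small : ε * C ≤ 1
  exp_log : ∀ x : G, lieExp (log x) = x
  log_exp : ∀ X : E, ‖X‖ < ε → log (lieExp X : G) = X
  log_mul : ∀ X Y : E, ‖X‖ < ε → ‖Y‖ < ε →
    ‖log ((lieExp X : G) * lieExp Y) - (X + Y)‖ ≤ C * (‖X‖ + ‖Y‖) ^ 2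
  log_conj : ∀ x : G, ‖log x‖ < ε → ∀ y : G, log (y * x * y⁻¹) = Ad y (log x)
  exp_neg : ∀ X : E, (lieExp (-X) : G) = (lieExp X)⁻¹
  exp_half : ∀ X : E, (lieExp ((1 / 2 : ℝ) • X) : G) * lieExp ((1 / 2 : ℝ) • X) = lieExp X
  Ad_mul : ∀ x y : G, Ad (E := E) (x * y) = Ad (E := E) x * Ad (E := E) y
  Ad_one : Ad (E := E) (1 : G) = 1
  norm_Ad : ∀ (y : G) (X : E), ‖Ad y X‖ = ‖X‖
  Ad_exp : ∀ X : E, ‖X‖ < ε → ‖Ad (E := E) (lieExp X : G) - 1 - L X‖ ≤ C * ‖X‖ ^ 2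

theorem IsLogMap.exists_localCalculus [FiniteDimensional ℝ E] [MeasurableSpace E]
    [LieGroup 𝓘(ℝ, E) ∞ G] [CompactSpace G] [T2Space G] [MeasurableSpace G] [BorelSpace G]
    (hAd : ∀ (y : G) (X Y : E), inner ℝ (Ad y X) (Ad y Y) = inner ℝ X Y)
    {log : G → E} (hlog : IsLogMap log) :
    ∃ (ε C : ℝ) (L : E →L[ℝ] (E →L[ℝ] E)), LocalCalculus log ε C L := by
  obtain ⟨ε₁, hε₁, C₁, hC₁, h₁⟩ := hlog.exists_log_mul
  obtain ⟨ε₂, hε₂, h₂⟩ := hlog.exists_log_conj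
  obtain ⟨ε₃, hε₃, C₃, hC₃, L, h₃⟩ := hlog.exists_Ad_taylor hAd
  have hC : 0 ≤ max C₁ C₃ := hC₁.trans (le_max_left _ _)
  refine ⟨min (min ε₁ ε₂) (min ε₃ (1 / (max C₁ C₃ + 1))), max C₁ C₃, L, ?_, hC, ?_, hlog.exp_log,
    fun X hX => ?_, fun X Y hX hY => ?_, fun x hx => ?_, hlog.lieExp_neg,
    hlog.lieExp_half_mul_self, hlog.Ad_mul hAd, hlog.Ad_one, norm_Ad_apply hAd, fun X hX => ?_⟩
  · exact lt_min (lt_min hε₁ hε₂) (lt_min hε₃ (by positivity))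
  · calc min (min ε₁ ε₂) (min ε₃ (1 / (max C₁ C₃ + 1))) * max C₁ C₃
        ≤ 1 / (max C₁ C₃ + 1) * max C₁ C₃ :=
          mul_le_mul_of_nonneg_right ((min_le_right _ _).trans (min_le_right _ _)) hC
      _ ≤ 1 := by
          rw [div_mul_eq_mul_div, div_le_one (by positivity)]
          linarith
  · simp only [lt_min_iff] at hX
    exact (h₁ X X hX.1.1 hX.1.1).1
  · simp only [lt_min_iff] at hX hY
    exact (h₁ X Y hX.1.1 hY.1.1).2.trans
      (mul_le_mul_of_nonneg_right (le_max_left _ _) (by positivity))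
  · simp only [lt_min_iff] at hx
    exact h₂ x hx.1.2
  · simp only [lt_min_iff] at hX
    exact (h₃ X hX.2.1).trans (mul_le_mul_of_nonneg_right (le_max_right _ _) (by positivity))

namespace LocalCalculus

variable {log : G → E} {ε C : ℝ} {L : E →L[ℝ] (E →L[ℝ] E)} (h : LocalCalculus log ε C L)
include h

theorem norm_log_conj {x : G} (hx : ‖log x‖ < ε) (y : G) : ‖log (y * x * y⁻¹)‖ = ‖log x‖ := by
  rw [h.log_conj x hx, h.norm_Ad]

theorem norm_Ad_le (y : G) : ‖Ad (E := E) y‖ ≤ 1 :=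
  ContinuousLinearMap.opNorm_le_bound _ zero_le_one fun X => by rw [h.norm_Ad, one_mul]

/-- The logarithm of a product of four small exponentials is the sum up to a quadratic error. -/
theorem log_mul_four {η : ℝ} (hη : 4 * η < ε) {x₁ x₂ x₃ x₄ : G} {X₁ X₂ X₃ X₄ : E}
    (e₁ : x₁ = lieExp X₁) (e₂ : x₂ = lieExp X₂) (e₃ : x₃ = lieExp X₃) (e₄ : x₄ = lieExp X₄)
    (h₁ : ‖X₁‖ ≤ η) (h₂ : ‖X₂‖ ≤ η) (h₃ : ‖X₃‖ ≤ η) (h₄ : ‖X₄‖ ≤ η) :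
    ‖log (x₁ * x₂ * x₃ * x₄) - (X₁ + X₂ + X₃ + X₄)‖ ≤ 44 * C * η ^ 2 := by
  subst e₁ e₂ e₃ e₄
  have hη0 : 0 ≤ η := (norm_nonneg _).trans h₁
  have hC := h.nonneg
  have hsm : 4 * C * η ≤ 1 := by nlinarith [h.small]
  have pair : ∀ X Y : E, ‖X‖ ≤ η → ‖Y‖ ≤ η →
      ‖log ((lieExp X : G) * lieExp Y) - (X + Y)‖ ≤ 4 * C * η ^ 2 ∧
      ‖log ((lieExp X : G) * lieExp Y)‖ ≤ 3 * η := by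
    intro X Y hX hY
    have h5 : ‖log ((lieExp X : G) * lieExp Y) - (X + Y)‖ ≤ 4 * C * η ^ 2 := by
      refine (h.log_mul X Y (by linarith) (by linarith)).trans ?_
      have : (‖X‖ + ‖Y‖) ^ 2 ≤ (2 * η) ^ 2 := pow_le_pow_left₀ (by positivity) (by linarith) 2
      nlinarith
    refine ⟨h5, ?_⟩
    have h6 := norm_le_norm_add_norm_sub' (log ((lieExp X : G) * lieExp Y)) (X + Y)
    have h7 := norm_add_le X Y
    nlinarith
  obtain ⟨a1, a2⟩ := pair X₁ X₂ h₁ h₂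
  obtain ⟨b1, b2⟩ := pair X₃ X₄ h₃ h₄
  have hm := h.log_mul (log ((lieExp X₁ : G) * lieExp X₂)) (log ((lieExp X₃ : G) * lieExp X₄))
    (by linarith) (by linarith)
  rw [h.exp_log, h.exp_log, ← mul_assoc] at hm
  have hsq : (‖log ((lieExp X₁ : G) * lieExp X₂)‖ + ‖log ((lieExp X₃ : G) * lieExp X₄)‖) ^ 2
      ≤ (6 * η) ^ 2 := pow_le_pow_left₀ (by positivity) (by linarith) 2
  have key : log ((lieExp X₁ : G) * lieExp X₂ * lieExp X₃ * lieExp X₄) - (X₁ + X₂ + X₃ + X₄)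
      = (log ((lieExp X₁ : G) * lieExp X₂ * lieExp X₃ * lieExp X₄)
        - (log ((lieExp X₁ : G) * lieExp X₂) + log ((lieExp X₃ : G) * lieExp X₄)))
        + (log ((lieExp X₁ : G) * lieExp X₂) - (X₁ + X₂))
        + (log ((lieExp X₃ : G) * lieExp X₄) - (X₃ + X₄)) := by abel
  rw [key]
  refine (norm_add₃_le).trans ?_
  nlinarith

end LocalCalculus

end LocalCalculus

/-! ### Integer coordinates on the lattice -/

section Coordinates

/-- The site of `Λ_N` with integer coordinates `(a, b)`. -/
def pt (N : ℕ) (a b : ℤ) : Site N := ![(a : ZMod (2 ^ N)), (b : ZMod (2 ^ N))]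

theorem exists_pt {N : ℕ} (x : Site N) : ∃ a b : ℤ, x = pt N a b := by
  refine ⟨(x 0).val, (x 1).val, ?_⟩
  funext i
  fin_cases i <;> simp [pt]

variable {N : ℕ}

theorem pt_add_nsmul_step_zero (a b : ℤ) (k : ℕ) : pt N a b + k • step 0 = pt N (a + k) b := by
  funext i
  fin_cases i <;> simp [pt, step]

theorem pt_add_nsmul_step_one (a b : ℤ) (k : ℕ) : pt N a b + k • step 1 = pt N a (b + k) := by
  funext i
  fin_cases i <;> simp [pt, step]

theorem pt_add_step_zero (a b : ℤ) : pt N a b + step 0 = pt N (a + 1) b := by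
  simpa using pt_add_nsmul_step_zero (N := N) a b 1

theorem pt_add_step_one (a b : ℤ) : pt N a b + step 1 = pt N a (b + 1) := by
  simpa using pt_add_nsmul_step_one (N := N) a b 1

theorem pt_sub_step_zero (a b : ℤ) : pt N a b - step 0 = pt N (a - 1) b := by
  rw [sub_eq_iff_eq_add, pt_add_step_zero, sub_add_cancel]

theorem pt_sub_step_one (a b : ℤ) : pt N a b - step 1 = pt N a (b - 1) := by
  rw [sub_eq_iff_eq_add, pt_add_step_one, sub_add_cancel]

theorem cast_two_pow_mul_val {M N : ℕ} (hMN : M ≤ N) (a : ℤ) :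
    ((2 ^ (N - M) * (a : ZMod (2 ^ M)).val : ℕ) : ZMod (2 ^ N)) = ((2 ^ (N - M) * a : ℤ) : ZMod _) := by
  have h : (((a : ZMod (2 ^ M)).val : ℕ) : ℤ) = a % (2 ^ M : ℕ) := ZMod.val_intCast a
  have h2 : ((2 ^ (N - M) * (a : ZMod (2 ^ M)).val : ℕ) : ZMod (2 ^ N))
      = ((2 ^ (N - M) * (a % (2 ^ M : ℕ)) : ℤ) : ZMod (2 ^ N)) := by
    rw [← h]; push_cast; rfl
  rw [h2, ZMod.intCast_eq_intCast_iff_dvd_sub]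
  refine ⟨a / (2 ^ M : ℕ), ?_⟩
  have h3 := Int.emod_add_mul_ediv a (2 ^ M : ℕ)
  have h4 : ((2 ^ N : ℕ) : ℤ) = 2 ^ (N - M) * (2 ^ M : ℕ) := by
    push_cast
    rw [← pow_add, Nat.sub_add_cancel hMN]
  rw [h4]
  linear_combination -(2 : ℤ) ^ (N - M) * h3

theorem incl_pt {M N : ℕ} (hMN : M ≤ N) (a b : ℤ) :
    (incl (pt M a b) : Site N) = pt N (2 ^ (N - M) * a) (2 ^ (N - M) * b) := by
  funext i
  fin_cases i
  · exact cast_two_pow_mul_val hMN a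
  · exact cast_two_pow_mul_val hMN b

theorem incl_pt_succ (a b : ℤ) : (incl (pt N a b) : Site (N + 1)) = pt (N + 1) (2 * a) (2 * b) := by
  simpa using incl_pt (Nat.le_succ N) a b

theorem incl_self (x : Site N) : (incl x : Site N) = x := by
  obtain ⟨a, b, rfl⟩ := exists_pt x
  simpa using incl_pt (le_refl N) a b

theorem incl_incl {L M N : ℕ} (hLM : L ≤ M) (hMN : M ≤ N) (x : Site L) :
    (incl (incl x : Site M) : Site N) = incl x := by
  obtain ⟨a, b, rfl⟩ := exists_pt x
  rw [incl_pt hLM, incl_pt hMN, incl_pt (hLM.trans hMN)]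
  have : (2 : ℤ) ^ (N - L) = 2 ^ (N - M) * 2 ^ (M - L) := by
    rw [← pow_add]; congr 1; omega
  rw [this, mul_assoc, mul_assoc]

theorem even_val_intCast (a : ℤ) : Even ((a : ZMod (2 ^ (N + 1))).val) ↔ Even a := by
  have h : (((a : ZMod (2 ^ (N + 1))).val : ℕ) : ℤ) = a % (2 ^ (N + 1) : ℕ) := ZMod.val_intCast a
  rw [← Int.even_coe_nat, h, Int.even_iff, Int.even_iff, Int.emod_emod_of_dvd]
  exact ⟨2 ^ N, by push_cast; ring⟩

theorem cast_val_div_two (a : ℤ) :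
    (((a : ZMod (2 ^ (N + 1))).val / 2 : ℕ) : ZMod (2 ^ N)) = ((a / 2 : ℤ) : ZMod (2 ^ N)) := by
  have h : (((a : ZMod (2 ^ (N + 1))).val : ℕ) : ℤ) = a % (2 ^ (N + 1) : ℕ) := ZMod.val_intCast a
  have h2 : (((a : ZMod (2 ^ (N + 1))).val / 2 : ℕ) : ZMod (2 ^ N))
      = ((a % (2 ^ (N + 1) : ℕ) / 2 : ℤ) : ZMod (2 ^ N)) := by
    rw [← h]; norm_cast
  rw [h2, ZMod.intCast_eq_intCast_iff_dvd_sub]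
  refine ⟨a / (2 ^ (N + 1) : ℕ), ?_⟩
  have h3 := Int.emod_add_mul_ediv a (2 ^ (N + 1) : ℕ)
  have h4 : ((2 ^ (N + 1) : ℕ) : ℤ) = 2 * (2 ^ N : ℕ) := by push_cast; ring
  generalize hq : a / ((2 ^ (N + 1) : ℕ) : ℤ) = q at *
  generalize hr : a % ((2 ^ (N + 1) : ℕ) : ℤ) = r at *
  rw [h4, mul_assoc] at h3
  generalize ((2 ^ N : ℕ) : ℤ) * q = z at *
  omega

/-- The site of `Λ_N` obtained from a site of `Λ_{N+1}` by rounding both coordinates down: the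
south-west corner of a plaquette of `Λ_N` that contains it. -/
def half (x : Site (N + 1)) : Site N := fun i => (((x i).val / 2 : ℕ) : ZMod (2 ^ N))

theorem half_pt (a b : ℤ) : half (pt (N + 1) a b) = pt N (a / 2) (b / 2) := by
  funext i
  fin_cases i
  · exact cast_val_div_two a
  · exact cast_val_div_two b

theorem even_pt_zero (a b : ℤ) : Even ((pt (N + 1) a b) 0).val ↔ Even a := even_val_intCast a

theorem even_pt_one (a b : ℤ) : Even ((pt (N + 1) a b) 1).val ↔ Even b := even_val_intCast b

end Coordinates

/-! ### Restriction to coarser lattices -/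

section Restriction

theorem sum_range_mul {β : Type*} [AddCommMonoid β] (f : ℕ → β) (p q : ℕ) :
    ∑ i ∈ Finset.range (p * q), f i
      = ∑ k ∈ Finset.range p, ∑ j ∈ Finset.range q, f (k * q + j) := by
  induction p with
  | zero => simp
  | succ p ih => rw [Nat.succ_mul, Finset.sum_range_add, ih, Finset.sum_range_succ]

theorem prod_map_range_mul {β : Type*} [Monoid β] (f : ℕ → β) (p q : ℕ) :
    ((List.range (p * q)).map f).prod
      = ((List.range p).map fun k => ((List.range q).map fun j => f (k * q + j)).prod).prod := by
  induction p with
  | zero => simp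
  | succ p ih =>
    rw [Nat.succ_mul, List.range_add, List.map_append, List.prod_append, ih, List.range_succ,
      List.map_append, List.prod_append, List.map_map]
    simp [Function.comp_def]

theorem incl_add_nsmul {M N : ℕ} (hMN : M ≤ N) (x : Site M) (k : ℕ) (μ : Fin 2) :
    (incl (x + k • step μ) : Site N) = incl x + (k * 2 ^ (N - M)) • step μ := by
  obtain ⟨a, b, rfl⟩ := exists_pt x
  fin_cases μ
  · simp only [Fin.zero_eta, pt_add_nsmul_step_zero, incl_pt hMN]
    congr 1; push_cast; ring
  · simp only [Fin.mk_one, pt_add_nsmul_step_one, incl_pt hMN]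
    congr 1; push_cast; ring

theorem OneForm.restr_restr {E : Type*} [AddCommGroup E] {L M N : ℕ} (hLM : L ≤ M) (hMN : M ≤ N)
    (A : OneForm E N) : OneForm.restr (A.restr M) L = A.restr L := by
  funext μ y
  simp only [OneForm.restr]
  rw [show 2 ^ (N - L) = 2 ^ (M - L) * 2 ^ (N - M) by rw [← pow_add]; congr 1; omega,
    sum_range_mul]
  refine Finset.sum_congr rfl fun k _ => Finset.sum_congr rfl fun j _ => ?_
  rw [incl_add_nsmul hMN, incl_incl hLM hMN, add_assoc, ← add_nsmul]

theorem GaugeField.restr_restr {G : Type*} [Group G] {L M N : ℕ} (hLM : L ≤ M) (hMN : M ≤ N)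
    (U : GaugeField G N) : GaugeField.restr (U.restr M) L = U.restr L := by
  funext μ y
  simp only [GaugeField.restr]
  rw [show 2 ^ (N - L) = 2 ^ (M - L) * 2 ^ (N - M) by rw [← pow_add]; congr 1; omega,
    prod_map_range_mul]
  simp only [incl_add_nsmul hMN, incl_incl hLM hMN, add_assoc, ← add_nsmul]

theorem OneForm.restr_self {E : Type*} [AddCommGroup E] {N : ℕ} (A : OneForm E N) :
    A.restr N = A := by
  funext μ y
  simp [OneForm.restr, incl_self]

theorem GaugeField.restr_self {G : Type*} [Group G] {N : ℕ} (U : GaugeField G N) :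
    U.restr N = U := by
  funext μ y
  simp [GaugeField.restr, incl_self]

theorem GaugeField.restr_pt_zero {G : Type*} [Group G] {N : ℕ} (U : GaugeField G (N + 1)) (a b : ℤ) :
    U.restr N 0 (pt N a b) =
    U 0 (pt (N + 1) (2 * a) (2 * b)) * U 0 (pt (N + 1) (2 * a + 1) (2 * b)) := by
  simp [GaugeField.restr, incl_pt_succ, List.range_succ, pt_add_step_zero]

theorem GaugeField.restr_pt_one {G : Type*} [Group G] {N : ℕ} (U : GaugeField G (N + 1)) (a b : ℤ) :
    U.restr N 1 (pt N a b) =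
    U 1 (pt (N + 1) (2 * a) (2 * b)) * U 1 (pt (N + 1) (2 * a) (2 * b + 1)) := by
  simp [GaugeField.restr, incl_pt_succ, List.range_succ, pt_add_step_one]

end Restriction

/-! ### Boundary holonomies -/

section Plaquettes

variable {G : Type*} [Group G] {N : ℕ}

theorem prod_map_range_reverse_inv (f : ℕ → G) (m : ℕ) :
    ((List.range m).map fun j => (f (m - 1 - j))⁻¹).prod = (((List.range m).map f).prod)⁻¹ := by
  induction m with
  | zero => simp
  | succ m ih =>
    rw [List.range_succ_eq_map, List.map_cons, List.prod_cons, List.map_map,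
      ← List.range_succ_eq_map, List.range_succ, List.map_append, List.prod_append, mul_inv_rev,
      ← ih]
    simp only [Nat.add_sub_cancel, Nat.sub_zero, List.map_cons, List.map_nil, List.prod_cons,
      List.prod_nil, mul_one]
    congr 3
    funext j
    simp only [Function.comp]
    congr 2
    omega

/-- The ordered product of `U` along `m` horizontal bonds, starting at `(a, b)`. -/
def hprod (U : GaugeField G N) (a b : ℤ) (m : ℕ) : G :=
  ((List.range m).map fun j => U 0 (pt N (a + (j : ℕ)) b)).prod

/-- The ordered product of `U` along `n` vertical bonds, starting at `(a, b)`. -/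
def vprod (U : GaugeField G N) (a b : ℤ) (n : ℕ) : G :=
  ((List.range n).map fun j => U 1 (pt N a (b + (j : ℕ)))).prod

theorem hprod_succ (U : GaugeField G N) (a b : ℤ) (m : ℕ) :
    hprod U a b (m + 1) = hprod U a b m * U 0 (pt N (a + m) b) := by
  simp [hprod, List.range_succ]

theorem vprod_succ (U : GaugeField G N) (a b : ℤ) (n : ℕ) :
    vprod U a b (n + 1) = vprod U a b n * U 1 (pt N a (b + n)) := by
  simp [vprod, List.range_succ]

theorem boundaryWord_prod (U : GaugeField G N) (a b : ℤ) (m n : ℕ) :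
    (boundaryWord U (pt N a b) m n).prod
      = hprod U a b m * vprod U (a + m) b n * (hprod U a (b + n) m)⁻¹ * (vprod U a b n)⁻¹ := by
  have h1 := prod_map_range_reverse_inv (fun j => U 0 (pt N (a + (j : ℕ)) (b + n))) m
  have h2 := prod_map_range_reverse_inv (fun j => U 1 (pt N a (b + (j : ℕ)))) n
  simp only [boundaryWord, List.prod_append, pt_add_nsmul_step_zero, pt_add_nsmul_step_one, h1, h2]
  rfl

theorem prod_rotate_conj (l p s : List G) (k : ℕ) (hl : l = p ++ s) (hk : p.length = k) :
    (l.rotate k).prod = s.prod * l.prod * (s.prod)⁻¹ := by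
  subst hl hk
  rw [List.rotate_append_length_eq, List.prod_append, List.prod_append]
  group

/-- The boundary holonomies of the horizontal strips with a given south-west plaquette, read from
their origins, are conjugate to those read from the south-west corner, by a factor that does not
depend on the length of the strip. -/
theorem exists_boundaryHol_horizontal (U : GaugeField G N) (a b : ℤ) :
    ∃ κ : G, ∀ m : ℕ, 1 ≤ m → boundaryHol U (pt N a b) m 1
      = κ * (boundaryWord U (pt N a b) m 1).prod * κ⁻¹ := by
  by_cases h0 : Even ((pt N a b) 0).val <;> by_cases h1 : Even ((pt N a b) 1).val
  · refine ⟨1, fun m hm => ?_⟩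
    simp [boundaryHol, originOffset, h0, h1]
  · refine ⟨[(U 1 (pt N a b))⁻¹].prod, fun m hm => ?_⟩
    rw [boundaryHol]
    refine prod_rotate_conj _ (((List.range m).map fun j => U 0 (pt N a b + j • step 0)) ++
      ((List.range 1).map fun j => U 1 (pt N a b + m • step 0 + j • step 1)) ++
      ((List.range m).map fun j => (U 0 (pt N a b + (m - 1 - j) • step 0 + 1 • step 1))⁻¹)) _ _ ?_ ?_
    · simp [boundaryWord, List.range_succ]
    · simp [originOffset, h0, h1]; omega
  · refine ⟨(U 0 (pt N a b))⁻¹, fun m hm => ?_⟩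
    obtain ⟨m, rfl⟩ : ∃ m', m = m' + 1 := ⟨m - 1, by omega⟩
    rw [boundaryHol, prod_rotate_conj (boundaryWord U (pt N a b) (m + 1) 1) [U 0 (pt N a b)]
      (boundaryWord U (pt N a b) (m + 1) 1).tail _ ?_ (by simp [originOffset, h0, h1])]
    · have h : (boundaryWord U (pt N a b) (m + 1) 1).prod
          = U 0 (pt N a b) * (boundaryWord U (pt N a b) (m + 1) 1).tail.prod := by
        simp [boundaryWord, List.range_succ_eq_map]
      rw [h]; group
    · simp [boundaryWord, List.range_succ_eq_map]
  · refine ⟨(U 0 (pt N a b + step 1))⁻¹ * (U 1 (pt N a b))⁻¹, fun m hm => ?_⟩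
    obtain ⟨m, rfl⟩ : ∃ m', m = m' + 1 := ⟨m - 1, by omega⟩
    rw [boundaryHol, prod_rotate_conj (boundaryWord U (pt N a b) (m + 1) 1)
      (((List.range (m + 1)).map fun j => U 0 (pt N a b + j • step 0)) ++
      ((List.range 1).map fun j => U 1 (pt N a b + (m + 1) • step 0 + j • step 1)) ++
      ((List.range m).map fun j => (U 0 (pt N a b + (m + 1 - 1 - j) • step 0 + 1 • step 1))⁻¹))
      [(U 0 (pt N a b + step 1))⁻¹, (U 1 (pt N a b))⁻¹] _ ?_ ?_]
    · simp
    · simp only [boundaryWord]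
      rw [List.range_succ (n := m)]
      simp [List.range_succ]
    · simp [originOffset, h0, h1]; omega

/-- The analogue of `exists_boundaryHol_horizontal` for vertical strips. -/
theorem exists_boundaryHol_vertical (U : GaugeField G N) (a b : ℤ) :
    ∃ κ : G, ∀ n : ℕ, 1 ≤ n → boundaryHol U (pt N a b) 1 n
      = κ * (boundaryWord U (pt N a b) 1 n).prod * κ⁻¹ := by
  by_cases h0 : Even ((pt N a b) 0).val <;> by_cases h1 : Even ((pt N a b) 1).val
  · refine ⟨1, fun n hn => ?_⟩
    simp [boundaryHol, originOffset, h0, h1]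
  · refine ⟨[(U 1 (pt N a b))⁻¹].prod, fun n hn => ?_⟩
    obtain ⟨n, rfl⟩ : ∃ n', n = n' + 1 := ⟨n - 1, by omega⟩
    rw [boundaryHol]
    refine prod_rotate_conj _ (((List.range 1).map fun j => U 0 (pt N a b + j • step 0)) ++
      ((List.range (n + 1)).map fun j => U 1 (pt N a b + 1 • step 0 + j • step 1)) ++
      ((List.range 1).map fun j => (U 0 (pt N a b + (1 - 1 - j) • step 0 + (n + 1) • step 1))⁻¹) ++
      ((List.range n).map fun j => (U 1 (pt N a b + (n + 1 - 1 - j) • step 1))⁻¹)) _ _ ?_ ?_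
    · simp only [boundaryWord]
      rw [List.range_succ (n := n)]
      simp
    · simp [originOffset, h0, h1]; omega
  · refine ⟨(U 0 (pt N a b))⁻¹, fun n hn => ?_⟩
    rw [boundaryHol, prod_rotate_conj (boundaryWord U (pt N a b) 1 n) [U 0 (pt N a b)]
      (boundaryWord U (pt N a b) 1 n).tail _ ?_ (by simp [originOffset, h0, h1])]
    · have h : (boundaryWord U (pt N a b) 1 n).prod
          = U 0 (pt N a b) * (boundaryWord U (pt N a b) 1 n).tail.prod := by
        simp [boundaryWord, List.range_succ_eq_map]
      rw [h]; group
    · simp [boundaryWord, List.range_succ_eq_map]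
  · refine ⟨(U 0 (pt N a b) * U 1 (pt N a b + step 0))⁻¹, fun n hn => ?_⟩
    obtain ⟨n, rfl⟩ : ∃ n', n = n' + 1 := ⟨n - 1, by omega⟩
    rw [boundaryHol, prod_rotate_conj (boundaryWord U (pt N a b) 1 (n + 1))
      [U 0 (pt N a b), U 1 (pt N a b + step 0)]
      ((boundaryWord U (pt N a b) 1 (n + 1)).drop 2) _ ?_ ?_]
    · have h : (boundaryWord U (pt N a b) 1 (n + 1)).prod
          = U 0 (pt N a b) * U 1 (pt N a b + step 0) *
            ((boundaryWord U (pt N a b) 1 (n + 1)).drop 2).prod := by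
        simp [boundaryWord, List.range_succ_eq_map, mul_assoc]
      rw [h]; group
    · simp [boundaryWord, List.range_succ_eq_map]
    · by_cases hn : n = 0 <;> simp [originOffset, h0, h1, hn]

/-- The four bonds around the plaquette south-west of an odd site, from its even corner; similarly
for the other three positions below. -/
theorem plaqHol_even_even (U : GaugeField G (N + 1)) {a b : ℤ} (ha : Even a) (hb : Even b) :
    plaqHol U (pt (N + 1) a b) = U 0 (pt (N + 1) a b) * U 1 (pt (N + 1) (a + 1) b) *
      (U 0 (pt (N + 1) a (b + 1)))⁻¹ * (U 1 (pt (N + 1) a b))⁻¹ := by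
  have h0 := (even_pt_zero (N := N) a b).2 ha
  have h1 := (even_pt_one (N := N) a b).2 hb
  simp [plaqHol, boundaryHol, boundaryWord, originOffset, h0, h1, List.range_succ,
    pt_add_step_zero, pt_add_step_one, mul_assoc]

theorem plaqHol_even_odd (U : GaugeField G (N + 1)) {a b : ℤ} (ha : Even a) (hb : ¬ Even b) :
    plaqHol U (pt (N + 1) a b) = (U 1 (pt (N + 1) a b))⁻¹ * U 0 (pt (N + 1) a b) *
      U 1 (pt (N + 1) (a + 1) b) * (U 0 (pt (N + 1) a (b + 1)))⁻¹ := by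
  have h0 := (even_pt_zero (N := N) a b).2 ha
  have h1 := mt (even_pt_one (N := N) a b).1 hb
  simp [plaqHol, boundaryHol, boundaryWord, originOffset, h0, h1, List.range_succ,
    pt_add_step_zero, pt_add_step_one, mul_assoc]

theorem plaqHol_odd_even (U : GaugeField G (N + 1)) {a b : ℤ} (ha : ¬ Even a) (hb : Even b) :
    plaqHol U (pt (N + 1) a b) = U 1 (pt (N + 1) (a + 1) b) * (U 0 (pt (N + 1) a (b + 1)))⁻¹ *
      (U 1 (pt (N + 1) a b))⁻¹ * U 0 (pt (N + 1) a b) := by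
  have h0 := mt (even_pt_zero (N := N) a b).1 ha
  have h1 := (even_pt_one (N := N) a b).2 hb
  simp [plaqHol, boundaryHol, boundaryWord, originOffset, h0, h1, List.range_succ,
    pt_add_step_zero, pt_add_step_one, mul_assoc]

theorem plaqHol_odd_odd (U : GaugeField G (N + 1)) {a b : ℤ} (ha : ¬ Even a) (hb : ¬ Even b) :
    plaqHol U (pt (N + 1) a b) = (U 0 (pt (N + 1) a (b + 1)))⁻¹ * (U 1 (pt (N + 1) a b))⁻¹ *
      U 0 (pt (N + 1) a b) * U 1 (pt (N + 1) (a + 1) b) := by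
  have h0 := mt (even_pt_zero (N := N) a b).1 ha
  have h1 := mt (even_pt_one (N := N) a b).1 hb
  simp [plaqHol, boundaryHol, boundaryWord, originOffset, h0, h1, List.range_succ,
    pt_add_step_zero, pt_add_step_one, mul_assoc]

/-- Gauge covariance of the plaquette holonomy: it is conjugated by the gauge transform at the even
corner `(2 ⌈a / 2⌉, 2 ⌈b / 2⌉)`. -/
theorem plaqHol_transform (U : GaugeField G (N + 1)) (g : Site (N + 1) → G) (a b : ℤ) :
    plaqHol (U.transform g) (pt (N + 1) a b) =
      g (pt (N + 1) (2 * ((a + 1) / 2)) (2 * ((b + 1) / 2))) * plaqHol U (pt (N + 1) a b) *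
      (g (pt (N + 1) (2 * ((a + 1) / 2)) (2 * ((b + 1) / 2))))⁻¹ := by
  by_cases ha : Even a <;> by_cases hb : Even b
  · rw [plaqHol_even_even _ ha hb, plaqHol_even_even _ ha hb]
    rw [Int.even_iff] at ha hb
    rw [show 2 * ((a + 1) / 2) = a by omega, show 2 * ((b + 1) / 2) = b by omega]
    simp only [GaugeField.transform, pt_add_step_zero, pt_add_step_one]
    group
  · rw [plaqHol_even_odd _ ha hb, plaqHol_even_odd _ ha hb]
    rw [Int.even_iff] at ha hb
    rw [show 2 * ((a + 1) / 2) = a by omega, show 2 * ((b + 1) / 2) = b + 1 by omega]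
    simp only [GaugeField.transform, pt_add_step_zero, pt_add_step_one]
    group
  · rw [plaqHol_odd_even _ ha hb, plaqHol_odd_even _ ha hb]
    rw [Int.even_iff] at ha hb
    rw [show 2 * ((a + 1) / 2) = a + 1 by omega, show 2 * ((b + 1) / 2) = b by omega]
    simp only [GaugeField.transform, pt_add_step_zero, pt_add_step_one]
    group
  · rw [plaqHol_odd_odd _ ha hb, plaqHol_odd_odd _ ha hb]
    rw [Int.even_iff] at ha hb
    rw [show 2 * ((a + 1) / 2) = a + 1 by omega, show 2 * ((b + 1) / 2) = b + 1 by omega]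
    simp only [GaugeField.transform, pt_add_step_zero, pt_add_step_one]
    group

end Plaquettes

/-! ### The inner bonds of a plaquette -/

section Existence

variable {E : Type*} [NormedAddCommGroup E] [InnerProductSpace ℝ E]
  {G : Type*} [TopologicalSpace G] [ChartedSpace E G] [Group G]

namespace LocalCalculus

variable {log : G → E} {ε C : ℝ} {L : E →L[ℝ] (E →L[ℝ] E)} (h : LocalCalculus log ε C L)
include h

/-- The values forced on three of the four inner bonds of a plaquette by the value on the first one
and by the holonomies `exp aᵢ` of the four small plaquettes, when everything is small. The four
holonomy equations are linearized; their remainders are `r₁, …, r₄`. -/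
theorem interior_small {δ : ℝ} (hδ : 1100 * δ < ε) {T B R W a₁ a₂ a₃ a₄ A₀ : E} {v w s : G}
    (hsum : ‖a₁‖ + ‖a₂‖ + ‖a₃‖ + ‖a₄‖ + (‖T‖ + ‖B‖ + ‖R‖ + ‖W‖) ≤ δ)
    (hA : A₀ = (1 / 2 : ℝ) • (T + B) + (3 / 8 : ℝ) • (a₁ - a₄) + (1 / 8 : ℝ) • (a₂ - a₃))
    (h₁ : (lieExp T : G)⁻¹ * v⁻¹ * lieExp A₀ * lieExp R = lieExp a₁)
    (h₂ : (lieExp W : G)⁻¹ * w * v * (lieExp T)⁻¹ = lieExp a₂)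
    (h₃ : (lieExp B : G) * s * w⁻¹ * (lieExp W)⁻¹ = lieExp a₃)
    (h₄ : (lieExp R : G) * (lieExp A₀)⁻¹ * s⁻¹ * lieExp B = lieExp a₄) :
    ‖log v - ((1 / 2 : ℝ) • (R + W) + (3 / 8 : ℝ) • (a₂ - a₁) + (1 / 8 : ℝ) • (a₃ - a₄))‖
      ≤ 10000 * C * δ ^ 2 ∧
    ‖log w - ((1 / 2 : ℝ) • (T + B) + (3 / 8 : ℝ) • (a₂ - a₃) + (1 / 8 : ℝ) • (a₁ - a₄))‖
      ≤ 10000 * C * δ ^ 2 ∧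
    ‖log s - ((1 / 2 : ℝ) • (R + W) + (3 / 8 : ℝ) • (a₃ - a₄) + (1 / 8 : ℝ) • (a₂ - a₁))‖
      ≤ 10000 * C * δ ^ 2 := by
  have n1 := norm_nonneg a₁
  have n2 := norm_nonneg a₂
  have n3 := norm_nonneg a₃
  have n4 := norm_nonneg a₄
  have nT := norm_nonneg T
  have nB := norm_nonneg B
  have nR := norm_nonneg R
  have nW := norm_nonneg W
  have hδ0 : 0 ≤ δ := by linarith
  have hC := h.nonneg
  have hsm : 1100 * C * δ ≤ 1 := by nlinarith [h.small]
  have hCδ : 1100 * C * δ ^ 2 ≤ δ := by nlinarith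
  have hA₀ : ‖A₀‖ ≤ δ := by
    rw [hA]
    refine (norm_add₃_le).trans ?_
    rw [norm_smul, norm_smul, norm_smul, Real.norm_of_nonneg (by norm_num),
      Real.norm_of_nonneg (by norm_num), Real.norm_of_nonneg (by norm_num)]
    have := norm_add_le T B
    have := norm_sub_le a₁ a₄
    have := norm_sub_le a₂ a₃
    linarith
  -- the first and last equations determine `v` and `s`, then the second determines `w`; the third is
  -- a constraint that is consistent with the rule up to quadratic terms
  have hv : v = lieExp A₀ * lieExp R * lieExp (-a₁) * lieExp (-T) := by
    rw [h.exp_neg, h.exp_neg, ← h₁]; group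
  have hs : s = lieExp B * lieExp (-a₄) * lieExp R * lieExp (-A₀) := by
    rw [h.exp_neg, h.exp_neg, ← h₄]; group
  have hr₁ := h.log_mul_four (η := δ) (by linarith) rfl rfl rfl rfl
    hA₀ (by linarith : ‖R‖ ≤ δ) (by rw [norm_neg]; linarith : ‖-a₁‖ ≤ δ)
    (by rw [norm_neg]; linarith : ‖-T‖ ≤ δ)
  have hr₄ := h.log_mul_four (η := δ) (by linarith) rfl rfl rfl rfl
    (by linarith : ‖B‖ ≤ δ) (by rw [norm_neg]; linarith : ‖-a₄‖ ≤ δ) (by linarith : ‖R‖ ≤ δ)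
    (by rwa [norm_neg] : ‖-A₀‖ ≤ δ)
  rw [← hv] at hr₁
  rw [← hs] at hr₄
  have hlv : ‖log v‖ ≤ 5 * δ := by
    have e1 := norm_le_norm_add_norm_sub' (log v) (A₀ + R + -a₁ + -T)
    have e2 := norm_add_le (A₀ + R + -a₁) (-T)
    have e3 := norm_add₃_le (a := A₀) (b := R) (c := -a₁)
    rw [norm_neg] at e2 e3
    linarith
  have hls : ‖log s‖ ≤ 5 * δ := by
    have e1 := norm_le_norm_add_norm_sub' (log s) (B + -a₄ + R + -A₀)
    have e2 := norm_add_le (B + -a₄ + R) (-A₀)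
    have e3 := norm_add₃_le (a := B) (b := -a₄) (c := R)
    rw [norm_neg] at e2 e3
    linarith
  have hw : w = lieExp W * lieExp a₂ * lieExp T * lieExp (-log v) := by
    rw [h.exp_neg, h.exp_log, ← h₂]; group
  have hr₂ := h.log_mul_four (η := 5 * δ) (by linarith) rfl rfl rfl rfl
    (by linarith : ‖W‖ ≤ 5 * δ) (by linarith : ‖a₂‖ ≤ 5 * δ) (by linarith : ‖T‖ ≤ 5 * δ)
    (by rwa [norm_neg] : ‖-log v‖ ≤ 5 * δ)
  rw [← hw] at hr₂
  have hlw : ‖log w‖ ≤ 9 * δ := by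
    have e1 := norm_le_norm_add_norm_sub' (log w) (W + a₂ + T + -log v)
    have e2 := norm_add_le (W + a₂ + T) (-log v)
    have e3 := norm_add₃_le (a := W) (b := a₂) (c := T)
    rw [norm_neg] at e2
    nlinarith
  have ha₃ : (lieExp a₃ : G) = lieExp B * lieExp (log s) * lieExp (-log w) * lieExp (-W) := by
    rw [h.exp_neg, h.exp_neg, h.exp_log, h.exp_log, ← h₃]
  have hr₃ := h.log_mul_four (η := 9 * δ) (by linarith) rfl rfl rfl rfl
    (by linarith : ‖B‖ ≤ 9 * δ) (by linarith : ‖log s‖ ≤ 9 * δ)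
    (by rwa [norm_neg] : ‖-log w‖ ≤ 9 * δ) (by rw [norm_neg]; linarith : ‖-W‖ ≤ 9 * δ)
  rw [← ha₃, h.log_exp a₃ (by linarith)] at hr₃
  set r₁ := log v - (A₀ + R + -a₁ + -T) with hr₁d
  set r₂ := log w - (W + a₂ + T + -log v) with hr₂d
  set r₃ := a₃ - (B + log s + -log w + -W) with hr₃d
  set r₄ := log s - (B + -a₄ + R + -A₀) with hr₄d
  have hCδ2 : 0 ≤ C * δ ^ 2 := by positivity
  -- each error below is a combination of the remainders; the weights of `r₁ … r₄` come from solving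
  -- the linearized equations
  have q : ∀ c₁ c₂ c₃ c₄ : ℝ, |c₁| ≤ 2 → |c₂| ≤ 2 → |c₃| ≤ 2 → |c₄| ≤ 2 →
      ‖c₁ • r₁ + c₂ • r₂ + c₃ • r₃ + c₄ • r₄‖ ≤ 10000 * C * δ ^ 2 := by
    intro c₁ c₂ c₃ c₄ k₁ k₂ k₃ k₄
    have e1 := norm_add_le (c₁ • r₁ + c₂ • r₂ + c₃ • r₃) (c₄ • r₄)
    have e2 := norm_add₃_le (a := c₁ • r₁) (b := c₂ • r₂) (c := c₃ • r₃)
    simp only [norm_smul, Real.norm_eq_abs] at e1 e2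
    have f1 := mul_le_mul k₁ hr₁ (norm_nonneg _) (by norm_num)
    have f2 := mul_le_mul k₂ hr₂ (norm_nonneg _) (by norm_num)
    have f3 := mul_le_mul k₃ hr₃ (norm_nonneg _) (by norm_num)
    have f4 := mul_le_mul k₄ hr₄ (norm_nonneg _) (by norm_num)
    nlinarith
  refine ⟨?_, ?_, ?_⟩
  · convert q (3 / 4) (1 / 4) (-1 / 4) (-1 / 4) ?_ ?_ ?_ ?_ using 2
    · rw [hr₁d, hr₂d, hr₃d, hr₄d, hA]; module
    all_goals norm_num [abs_le]
  · convert q (-1 / 2) (1 / 2) (1 / 2) (1 / 2) ?_ ?_ ?_ ?_ using 2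
    · rw [hr₁d, hr₂d, hr₃d, hr₄d, hA]; module
    all_goals norm_num [abs_le]
  · convert q (-1 / 4) (1 / 4) (-1 / 4) (3 / 4) ?_ ?_ ?_ ?_ using 2
    · rw [hr₁d, hr₂d, hr₃d, hr₄d, hA]; module
    all_goals norm_num [abs_le]

/-- Version of `interior_small` without smallness assumption: if the data are not small, then the
boundedness of the logarithm suffices. -/
theorem interior_bound {M : ℝ} (hM : ∀ x, ‖log x‖ ≤ M) {K : ℝ}
    (hK : 10000 * C ≤ K) (hK' : 2 * M * (1100 / ε) ^ 2 + 1100 / ε ≤ K)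
    {T B R W A₀ : E} {v w s p₁ p₂ p₃ p₄ : G} {u₁ u₂ u₃ u₄ : ℝ}
    (n₁ : 0 ≤ u₁) (n₂ : 0 ≤ u₂) (n₃ : 0 ≤ u₃) (n₄ : 0 ≤ u₄)
    (k₁ : u₁ < ε → ‖log p₁‖ = u₁) (k₂ : u₂ < ε → ‖log p₂‖ = u₂) (k₃ : u₃ < ε → ‖log p₃‖ = u₃)
    (k₄ : u₄ < ε → ‖log p₄‖ = u₄)
    (hA : A₀ = (1 / 2 : ℝ) • (T + B) + (3 / 8 : ℝ) • (log p₁ - log p₄)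
      + (1 / 8 : ℝ) • (log p₂ - log p₃))
    (h₁ : (lieExp T : G)⁻¹ * v⁻¹ * lieExp A₀ * lieExp R = p₁)
    (h₂ : (lieExp W : G)⁻¹ * w * v * (lieExp T)⁻¹ = p₂)
    (h₃ : (lieExp B : G) * s * w⁻¹ * (lieExp W)⁻¹ = p₃)
    (h₄ : (lieExp R : G) * (lieExp A₀)⁻¹ * s⁻¹ * lieExp B = p₄) :
    ‖log v - ((1 / 2 : ℝ) • (R + W) + (3 / 8 : ℝ) • (log p₂ - log p₁)
        + (1 / 8 : ℝ) • (log p₃ - log p₄))‖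
      ≤ K * (u₁ + u₂ + u₃ + u₄ + (‖T‖ + ‖B‖ + ‖R‖ + ‖W‖)) ^ 2 ∧
    ‖log w - ((1 / 2 : ℝ) • (T + B) + (3 / 8 : ℝ) • (log p₂ - log p₃)
        + (1 / 8 : ℝ) • (log p₁ - log p₄))‖
      ≤ K * (u₁ + u₂ + u₃ + u₄ + (‖T‖ + ‖B‖ + ‖R‖ + ‖W‖)) ^ 2 ∧
    ‖log s - ((1 / 2 : ℝ) • (R + W) + (3 / 8 : ℝ) • (log p₃ - log p₄)
        + (1 / 8 : ℝ) • (log p₂ - log p₁))‖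
      ≤ K * (u₁ + u₂ + u₃ + u₄ + (‖T‖ + ‖B‖ + ‖R‖ + ‖W‖)) ^ 2 := by
  have hε := h.pos
  have nT := norm_nonneg T
  have nB := norm_nonneg B
  have nR := norm_nonneg R
  have nW := norm_nonneg W
  set δ := u₁ + u₂ + u₃ + u₄ + (‖T‖ + ‖B‖ + ‖R‖ + ‖W‖) with hδ
  rcases lt_or_ge (1100 * δ) ε with hlt | hge
  · have := h.interior_small hlt (v := v) (w := w) (s := s) (T := T) (B := B) (R := R) (W := W)
      (a₁ := log p₁) (a₂ := log p₂) (a₃ := log p₃) (a₄ := log p₄) (A₀ := A₀)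
      (by rw [k₁ (by linarith), k₂ (by linarith), k₃ (by linarith), k₄ (by linarith)])
      hA (by rw [h.exp_log, h₁]) (by rw [h.exp_log, h₂]) (by rw [h.exp_log, h₃])
      (by rw [h.exp_log, h₄])
    have hmono : 10000 * C * δ ^ 2 ≤ K * δ ^ 2 := mul_le_mul_of_nonneg_right hK (by positivity)
    exact ⟨this.1.trans hmono, this.2.1.trans hmono, this.2.2.trans hmono⟩
  · -- `δ` is bounded below, so that the right-hand side dominates `2 M + δ`
    have hM0 : 0 ≤ M := (norm_nonneg _).trans (hM 1)
    have hone : 1 ≤ 1100 / ε * δ := by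
      rw [div_mul_eq_mul_div, le_div_iff₀ hε]; linarith
    have hδ0 : 0 ≤ δ := by positivity
    have hbig : 2 * M + δ ≤ K * δ ^ 2 := by
      have e1 : K * δ ^ 2 ≥ (2 * M * (1100 / ε) ^ 2 + 1100 / ε) * δ ^ 2 :=
        mul_le_mul_of_nonneg_right hK' (by positivity)
      have e3 : (2 * M * (1100 / ε) ^ 2 + 1100 / ε) * δ ^ 2
          = 2 * M * (1100 / ε * δ) ^ 2 + δ * (1100 / ε * δ) := by ring
      have e2 : 2 * M ≤ 2 * M * (1100 / ε * δ) ^ 2 :=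
        le_mul_of_one_le_right (by positivity) (one_le_pow₀ hone)
      have e4 : δ ≤ δ * (1100 / ε * δ) := le_mul_of_one_le_right hδ0 hone
      linarith
    have gen : ∀ (z : G) (X Y a b c d : E), ‖X‖ + ‖Y‖ ≤ δ → ‖a‖ ≤ M → ‖b‖ ≤ M → ‖c‖ ≤ M →
        ‖d‖ ≤ M → ‖log z - ((1 / 2 : ℝ) • (X + Y) + (3 / 8 : ℝ) • (a - b)
          + (1 / 8 : ℝ) • (c - d))‖ ≤ K * δ ^ 2 := by
      intro z X Y a b c d hXY ha hb hc hd
      have e1 := norm_sub_le (log z) ((1 / 2 : ℝ) • (X + Y) + (3 / 8 : ℝ) • (a - b)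
          + (1 / 8 : ℝ) • (c - d))
      have e2 := norm_add₃_le (a := (1 / 2 : ℝ) • (X + Y)) (b := (3 / 8 : ℝ) • (a - b))
        (c := (1 / 8 : ℝ) • (c - d))
      rw [norm_smul, norm_smul, norm_smul, Real.norm_of_nonneg (by norm_num),
        Real.norm_of_nonneg (by norm_num), Real.norm_of_nonneg (by norm_num)] at e2
      have := norm_add_le X Y
      have := norm_sub_le a b
      have := norm_sub_le c d
      have := hM z
      linarith
    exact ⟨gen _ _ _ _ _ _ _ (by linarith) (hM _) (hM _) (hM _) (hM _),
      gen _ _ _ _ _ _ _ (by linarith) (hM _) (hM _) (hM _) (hM _),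
      gen _ _ _ _ _ _ _ (by linarith) (hM _) (hM _) (hM _) (hM _)⟩

end LocalCalculus

end Existence

/-! ### Refinement of a gauge by one level -/

section Refinement

variable {E : Type*} [NormedAddCommGroup E] [InnerProductSpace ℝ E]
  {G : Type*} [TopologicalSpace G] [ChartedSpace E G] [Group G] {N : ℕ}

/-- The gauge transform on `Λ_{N+1}` that extends `g` on `Λ_N`: at the midpoints of bonds it makes
the two half bonds carry `exp (A / 2)`, at the centres of plaquettes it takes the values `c`. -/
noncomputable def refineGauge (U : GaugeField G (N + 1)) (A : OneForm E N) (g : Site N → G)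
    (c : Site (N + 1) → G) (x : Site (N + 1)) : G :=
  open Classical in
  if Even (x 0).val then
    if Even (x 1).val then g (half x)
    else (lieExp ((1 / 2 : ℝ) • A 1 (half x)))⁻¹ * g (half x) * U 1 (x - step 1)
  else
    if Even (x 1).val then
      (lieExp ((1 / 2 : ℝ) • A 0 (half x)))⁻¹ * g (half x) * U 0 (x - step 0)
    else c x

/-- The value that the interior rule prescribes on the bond from the centre `x` of a plaquette of
`Λ_N` to the right. The holonomies involve the gauge transform at sites of `Λ_N` only, so that the
choice of `refineGauge` at the centres is immaterial. -/
noncomputable def centreValue (log : G → E) (U : GaugeField G (N + 1)) (A : OneForm E N)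
    (g : Site N → G) (x : Site (N + 1)) : E :=
  let V := U.transform (refineGauge U A g 1)
  (1 / 2 : ℝ) • ((1 / 2 : ℝ) • A 0 (half (x + step 1)) + (1 / 2 : ℝ) • A 0 (half (x - step 1)))
    + (3 / 8 : ℝ) • (log (plaqHol V x) - log (plaqHol V (x - step 1)))
    + (1 / 8 : ℝ) • (log (plaqHol V (x - step 0)) - log (plaqHol V (x - step 0 - step 1)))

/-- The gauge transform of the next level. At a centre `x` it is the solution `c` of
`exp (centreValue x) = c * U 0 x * (value at x + step 0)⁻¹`. -/
noncomputable def nextGauge (log : G → E) (U : GaugeField G (N + 1)) (A : OneForm E N)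
    (g : Site N → G) : Site (N + 1) → G :=
  refineGauge U A g fun x =>
    lieExp (centreValue log U A g x) * refineGauge U A g 1 (x + step 0) * (U 0 x)⁻¹

/-- The one-form of the next level: half of the old value on the half bonds, the prescribed value on
the bond from a centre to the right, and the logarithm of the transformed gauge field on the other
three inner bonds. -/
noncomputable def nextForm (log : G → E) (U : GaugeField G (N + 1)) (A : OneForm E N)
    (g : Site N → G) : OneForm E (N + 1) := fun μ x =>
  open Classical in
  if μ = 0 then
    if Even (x 1).val then (1 / 2 : ℝ) • A 0 (half x)
    else if Even (x 0).val then log (U.transform (nextGauge log U A g) 0 x)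
    else centreValue log U A g x
  else
    if Even (x 0).val then (1 / 2 : ℝ) • A 1 (half x)
    else log (U.transform (nextGauge log U A g) 1 x)

variable (U : GaugeField G (N + 1)) (A : OneForm E N) (g : Site N → G)

theorem refineGauge_even_even (c : Site (N + 1) → G) (a b : ℤ) :
    refineGauge U A g c (pt (N + 1) (2 * a) (2 * b)) = g (pt N a b) := by
  rw [refineGauge, if_pos ((even_pt_zero _ _).2 (by simp)), if_pos ((even_pt_one _ _).2 (by simp)),
    half_pt]
  congr 2 <;> omega

theorem refineGauge_odd_even (c : Site (N + 1) → G) (a b : ℤ) :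
    refineGauge U A g c (pt (N + 1) (2 * a + 1) (2 * b)) =
      (lieExp ((1 / 2 : ℝ) • A 0 (pt N a b)))⁻¹ * g (pt N a b) * U 0 (pt (N + 1) (2 * a) (2 * b)) := by
  rw [refineGauge, if_neg (mt (even_pt_zero _ _).1 (by simp)),
    if_pos ((even_pt_one _ _).2 (by simp)), half_pt, pt_sub_step_zero,
    show (2 * a + 1) / 2 = a by omega, show 2 * b / 2 = b by omega, add_sub_cancel_right]

theorem refineGauge_even_odd (c : Site (N + 1) → G) (a b : ℤ) :
    refineGauge U A g c (pt (N + 1) (2 * a) (2 * b + 1)) =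
      (lieExp ((1 / 2 : ℝ) • A 1 (pt N a b)))⁻¹ * g (pt N a b) * U 1 (pt (N + 1) (2 * a) (2 * b)) := by
  rw [refineGauge, if_pos ((even_pt_zero _ _).2 (by simp)),
    if_neg (mt (even_pt_one _ _).1 (by simp)), half_pt, pt_sub_step_one,
    show (2 * b + 1) / 2 = b by omega, show 2 * a / 2 = a by omega, add_sub_cancel_right]

theorem refineGauge_odd_odd (c : Site (N + 1) → G) (a b : ℤ) :
    refineGauge U A g c (pt (N + 1) (2 * a + 1) (2 * b + 1)) =
      c (pt (N + 1) (2 * a + 1) (2 * b + 1)) := by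
  rw [refineGauge, if_neg (mt (even_pt_zero _ _).1 (by simp)),
    if_neg (mt (even_pt_one _ _).1 (by simp))]

theorem plaqHol_refineGauge (c c' : Site (N + 1) → G) (a b : ℤ) :
    plaqHol (U.transform (refineGauge U A g c)) (pt (N + 1) a b) =
      plaqHol (U.transform (refineGauge U A g c')) (pt (N + 1) a b) := by
  rw [plaqHol_transform, plaqHol_transform, refineGauge_even_even, refineGauge_even_even]

variable {log : G → E}

variable {ε C : ℝ} {L : E →L[ℝ] (E →L[ℝ] E)}

/-- The next level again satisfies `exp A = U^g`. -/
theorem LocalCalculus.lieExp_nextForm (h : LocalCalculus log ε C L)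
    (hA : ∀ μ y, lieExp (A μ y) = (U.restr N).transform g μ y) (μ : Fin 2) (x : Site (N + 1)) :
    lieExp (nextForm log U A g μ x) = U.transform (nextGauge log U A g) μ x := by
  obtain ⟨a, b, rfl⟩ := exists_pt x
  fin_cases μ
  · simp only [Fin.zero_eta, nextForm, if_pos]
    rcases Int.even_or_odd' b with ⟨b, rfl | rfl⟩
    · rw [if_pos ((even_pt_one _ _).2 (by simp)), half_pt, GaugeField.transform, pt_add_step_zero]
      rcases Int.even_or_odd' a with ⟨a, rfl | rfl⟩
      · rw [nextGauge, refineGauge_even_even, refineGauge_odd_even,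
          show 2 * a / 2 = a by omega, show 2 * b / 2 = b by omega]
        group
      · rw [nextGauge, show 2 * a + 1 + 1 = 2 * (a + 1) by ring, refineGauge_even_even,
          refineGauge_odd_even, show (2 * a + 1) / 2 = a by omega, show 2 * b / 2 = b by omega]
        have h1 := hA 0 (pt N a b)
        rw [GaugeField.transform, pt_add_step_zero, GaugeField.restr_pt_zero,
          ← h.exp_half (A 0 (pt N a b))] at h1
        rw [← mul_right_inj (lieExp ((1 / 2 : ℝ) • A 0 (pt N a b))), h1]
        group
    · rw [if_neg (mt (even_pt_one _ _).1 (by simp))]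
      rcases Int.even_or_odd' a with ⟨a, rfl | rfl⟩
      · rw [if_pos ((even_pt_zero _ _).2 (by simp)), h.exp_log]
      · rw [if_neg (mt (even_pt_zero _ _).1 (by simp)), GaugeField.transform, nextGauge,
          refineGauge_odd_odd, pt_add_step_zero, show 2 * a + 1 + 1 = 2 * (a + 1) by ring,
          refineGauge_even_odd, refineGauge_even_odd]
        group
  · simp only [Fin.mk_one, nextForm, one_ne_zero, if_false]
    rcases Int.even_or_odd' a with ⟨a, rfl | rfl⟩
    · rw [if_pos ((even_pt_zero _ _).2 (by simp)), half_pt, GaugeField.transform, pt_add_step_one]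
      rcases Int.even_or_odd' b with ⟨b, rfl | rfl⟩
      · rw [nextGauge, refineGauge_even_even, refineGauge_even_odd,
          show 2 * a / 2 = a by omega, show 2 * b / 2 = b by omega]
        group
      · rw [nextGauge, show 2 * b + 1 + 1 = 2 * (b + 1) by ring, refineGauge_even_even,
          refineGauge_even_odd, show (2 * b + 1) / 2 = b by omega, show 2 * a / 2 = a by omega]
        have h1 := hA 1 (pt N a b)
        rw [GaugeField.transform, pt_add_step_one, GaugeField.restr_pt_one,
          ← h.exp_half (A 1 (pt N a b))] at h1
        rw [← mul_right_inj (lieExp ((1 / 2 : ℝ) • A 1 (pt N a b))), h1]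
        group
    · rw [if_neg (mt (even_pt_zero _ _).1 (by simp)), h.exp_log]

theorem nextGauge_incl (y : Site N) : nextGauge log U A g (incl y) = g y := by
  obtain ⟨a, b, rfl⟩ := exists_pt y
  rw [incl_pt_succ, nextGauge, refineGauge_even_even]

theorem nextForm_incl (μ : Fin 2) (y : Site N) :
    nextForm log U A g μ (incl y) = (1 / 2 : ℝ) • A μ y ∧
    nextForm log U A g μ (incl y + step μ) = (1 / 2 : ℝ) • A μ y := by
  obtain ⟨a, b, rfl⟩ := exists_pt y
  rw [incl_pt_succ]
  fin_cases μ
  · simp only [Fin.zero_eta, nextForm, if_pos, pt_add_step_zero]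
    rw [if_pos ((even_pt_one _ _).2 (by simp)), half_pt, if_pos ((even_pt_one _ _).2 (by simp)),
      half_pt, show 2 * a / 2 = a by omega, show 2 * b / 2 = b by omega,
      show (2 * a + 1) / 2 = a by omega]
    exact ⟨rfl, rfl⟩
  · simp only [Fin.mk_one, nextForm, one_ne_zero, if_false, pt_add_step_one]
    rw [if_pos ((even_pt_zero _ _).2 (by simp)), half_pt, if_pos ((even_pt_zero _ _).2 (by simp)),
      half_pt, show 2 * a / 2 = a by omega, show 2 * b / 2 = b by omega,
      show (2 * b + 1) / 2 = b by omega]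
    exact ⟨rfl, rfl⟩

theorem LocalCalculus.interiorRule_next (h : LocalCalculus log ε C L) {M : ℝ}
    (hM : ∀ x, ‖log x‖ ≤ M) {K : ℝ}
    (hK : 10000 * C ≤ K) (hK' : 2 * M * (1100 / ε) ^ 2 + 1100 / ε ≤ K)
    (hA : ∀ μ y, lieExp (A μ y) = (U.restr N).transform g μ y) (y : Site N) :
    InteriorRule log K U (nextGauge log U A g) (nextForm log U A g)
      (incl y + step 0 + step 1) := by
  obtain ⟨a, b, rfl⟩ := exists_pt y
  have hexp := h.lieExp_nextForm U A g hA
  set g' := nextGauge log U A g with hg'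
  set A' := nextForm log U A g with hA'
  have hodd : ∀ n : ℤ, ¬ Even (2 * n + 1) := fun n => by simp
  have heven : ∀ n : ℤ, Even (2 * n) := fun n => by simp
  -- the values of `A'` on the bonds around the centre
  have v1 : A' 1 (pt (N + 1) (2 * a + 1) (2 * b + 1))
      = log (U.transform g' 1 (pt (N + 1) (2 * a + 1) (2 * b + 1))) := by
    simp only [hA', nextForm, one_ne_zero, if_false]
    rw [if_neg (mt (even_pt_zero _ _).1 (by simp))]
  have v2 : A' 1 (pt (N + 1) (2 * a + 1) (2 * b))
      = log (U.transform g' 1 (pt (N + 1) (2 * a + 1) (2 * b))) := by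
    simp only [hA', nextForm, one_ne_zero, if_false]
    rw [if_neg (mt (even_pt_zero _ _).1 (by simp))]
  have v3 : A' 0 (pt (N + 1) (2 * a) (2 * b + 1))
      = log (U.transform g' 0 (pt (N + 1) (2 * a) (2 * b + 1))) := by
    simp only [hA', nextForm, if_pos]
    rw [if_neg (mt (even_pt_one _ _).1 (by simp)), if_pos ((even_pt_zero _ _).2 (by simp))]
  have o0 : ∀ m n : ℤ, A' 0 (pt (N + 1) m (2 * n)) = (1 / 2 : ℝ) • A 0 (pt N (m / 2) n) := by
    intro m n
    simp only [hA', nextForm, if_pos]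
    rw [if_pos ((even_pt_one _ _).2 (by simp)), half_pt, show 2 * n / 2 = n by omega]
  have o1 : ∀ m n : ℤ, A' 1 (pt (N + 1) (2 * m) n) = (1 / 2 : ℝ) • A 1 (pt N m (n / 2)) := by
    intro m n
    simp only [hA', nextForm, one_ne_zero, if_false]
    rw [if_pos ((even_pt_zero _ _).2 (by simp)), half_pt, show 2 * m / 2 = m by omega]
  have hplaq : ∀ m n : ℤ, plaqHol (U.transform g') (pt (N + 1) m n)
      = plaqHol (U.transform (refineGauge U A g 1)) (pt (N + 1) m n) := fun m n =>
    plaqHol_refineGauge U A g _ _ m n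
  have v0 : A' 0 (pt (N + 1) (2 * a + 1) (2 * b + 1)) =
      (1 / 2 : ℝ) • (A' 0 (pt (N + 1) (2 * a + 1) (2 * (b + 1)))
        + A' 0 (pt (N + 1) (2 * a + 1) (2 * b)))
      + (3 / 8 : ℝ) • (log (plaqHol (U.transform g') (pt (N + 1) (2 * a + 1) (2 * b + 1)))
        - log (plaqHol (U.transform g') (pt (N + 1) (2 * a + 1) (2 * b))))
      + (1 / 8 : ℝ) • (log (plaqHol (U.transform g') (pt (N + 1) (2 * a) (2 * b + 1)))
        - log (plaqHol (U.transform g') (pt (N + 1) (2 * a) (2 * b)))) := by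
    rw [hplaq, hplaq, hplaq, hplaq, o0, o0]
    simp only [hA', nextForm, if_pos]
    rw [if_neg (mt (even_pt_one _ _).1 (by simp)), if_neg (mt (even_pt_zero _ _).1 (by simp))]
    simp only [centreValue, pt_add_step_one, pt_sub_step_one, pt_sub_step_zero, half_pt,
      add_sub_cancel_right, show 2 * b + 1 + 1 = 2 * (b + 1) by ring,
      show 2 * (b + 1) / 2 = b + 1 by omega, show 2 * b / 2 = b by omega]
  have hconj : ∀ m n : ℤ, ‖log (plaqHol U (pt (N + 1) m n))‖ < ε →
      ‖log (plaqHol (U.transform g') (pt (N + 1) m n))‖ = ‖log (plaqHol U (pt (N + 1) m n))‖ := by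
    intro m n hlt
    rw [plaqHol_transform, h.norm_log_conj hlt]
  have same0 : A' 0 (pt (N + 1) (2 * a) (2 * (b + 1))) = A' 0 (pt (N + 1) (2 * a + 1) (2 * (b + 1)))
      := by rw [o0, o0]; congr 3; omega
  have same0' : A' 0 (pt (N + 1) (2 * a) (2 * b)) = A' 0 (pt (N + 1) (2 * a + 1) (2 * b)) := by
    rw [o0, o0]; congr 3; omega
  have same1 : A' 1 (pt (N + 1) (2 * (a + 1)) (2 * b)) = A' 1 (pt (N + 1) (2 * (a + 1)) (2 * b + 1))
      := by rw [o1, o1]; congr 3; omega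
  have same1' : A' 1 (pt (N + 1) (2 * a) (2 * b)) = A' 1 (pt (N + 1) (2 * a) (2 * b + 1)) := by
    rw [o1, o1]; congr 3; omega
  have key := h.interior_bound hM hK hK'
    (T := A' 0 (pt (N + 1) (2 * a + 1) (2 * (b + 1))))
    (B := A' 0 (pt (N + 1) (2 * a + 1) (2 * b)))
    (R := A' 1 (pt (N + 1) (2 * (a + 1)) (2 * b + 1)))
    (W := A' 1 (pt (N + 1) (2 * a) (2 * b + 1)))
    (A₀ := A' 0 (pt (N + 1) (2 * a + 1) (2 * b + 1)))
    (v := U.transform g' 1 (pt (N + 1) (2 * a + 1) (2 * b + 1)))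
    (w := U.transform g' 0 (pt (N + 1) (2 * a) (2 * b + 1)))
    (s := U.transform g' 1 (pt (N + 1) (2 * a + 1) (2 * b)))
    (norm_nonneg _) (norm_nonneg _) (norm_nonneg _) (norm_nonneg _)
    (hconj (2 * a + 1) (2 * b + 1)) (hconj (2 * a) (2 * b + 1))
    (hconj (2 * a) (2 * b)) (hconj (2 * a + 1) (2 * b)) v0 ?_ ?_ ?_ ?_
  · simp only [InteriorRule, incl_pt_succ, pt_add_step_zero, pt_add_step_one, pt_sub_step_zero,
      pt_sub_step_one, add_sub_cancel_right]
    rw [show 2 * b + 1 + 1 = 2 * (b + 1) by ring, show 2 * a + 1 + 1 = 2 * (a + 1) by ring, v1, v2,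
      v3]
    exact ⟨v0, key.1, key.2.1, key.2.2⟩
  · rw [plaqHol_odd_odd _ (hodd a) (hodd b), hexp, hexp, hexp,
      show 2 * b + 1 + 1 = 2 * (b + 1) by ring, show 2 * a + 1 + 1 = 2 * (a + 1) by ring]
  · rw [plaqHol_even_odd _ (heven a) (hodd b), ← same0, hexp, hexp,
      show 2 * b + 1 + 1 = 2 * (b + 1) by ring]
  · rw [plaqHol_even_even _ (heven a) (heven b), ← same0', ← same1', hexp, hexp]
  · rw [plaqHol_odd_even _ (hodd a) (heven b), ← same1, hexp, hexp, hexp,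
      show 2 * a + 1 + 1 = 2 * (a + 1) by ring]

/-- Every gauge field has a binary Landau gauge: start with `A = log U` and `g = 1` and refine level
by level. -/
theorem LocalCalculus.exists_isBinaryLandau (h : LocalCalculus log ε C L) {M : ℝ}
    (hM : ∀ x, ‖log x‖ ≤ M) {K : ℝ}
    (hK : 10000 * C ≤ K) (hK' : 2 * M * (1100 / ε) ^ 2 + 1100 / ε ≤ K) {N₀ N₁ : ℕ}
    (hN : N₀ ≤ N₁) : ∀ U : GaugeField G N₁,
      ∃ (A : OneForm E N₁) (g : Site N₁ → G), IsBinaryLandau log K N₀ U A g := by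
  induction N₁, hN using Nat.le_induction with
  | base =>
    intro U
    refine ⟨fun μ x => log (U μ x), 1, fun y => rfl, fun μ y => ?_, fun N h1 h2 μ y => ?_,
      fun M h1 h2 => by omega, fun M h1 h2 => by omega⟩
    · rw [OneForm.restr_self, GaugeField.restr_self]
    · obtain rfl : N = N₀ := le_antisymm h2 h1
      rw [OneForm.restr_self, GaugeField.restr_self, h.exp_log]
      simp [GaugeField.transform]
  | succ N hN ih =>
    intro U
    obtain ⟨A, g, hL⟩ := ih (U.restr N)
    have hA : ∀ μ y, lieExp (A μ y) = (U.restr N).transform g μ y := by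
      intro μ y
      have := hL.exp_eq N hN le_rfl μ y
      simpa only [OneForm.restr_self, GaugeField.restr_self, incl_self] using this
    have hr : (nextForm log U A g).restr N = A := by
      funext μ y
      rw [OneForm.restr]
      simp only [Nat.add_sub_cancel_left, pow_one, Finset.sum_range_succ, Finset.sum_range_zero,
        zero_add, zero_smul, add_zero, one_smul]
      rw [(nextForm_incl U A g μ y).1, (nextForm_incl U A g μ y).2, ← add_smul]
      norm_num
    have hrA : ∀ M, M ≤ N → (nextForm log U A g).restr M = A.restr M := fun M hM => by
      rw [← OneForm.restr_restr hM (Nat.le_succ N), hr]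
    have hgi : ∀ M, M ≤ N → ∀ y : Site M, nextGauge log U A g (incl y) = g (incl y) := by
      intro M hM y
      rw [← incl_incl hM (Nat.le_succ N), nextGauge_incl]
    have hUr : ∀ M, M ≤ N → GaugeField.restr (U.restr N) M = U.restr M := fun M hM =>
      GaugeField.restr_restr hM (Nat.le_succ N) U
    refine ⟨nextForm log U A g, nextGauge log U A g, fun y => ?_, fun μ y => ?_, ?_, ?_, ?_⟩
    · rw [hgi N₀ hN]
      exact hL.gauge_init y
    · rw [hrA N₀ hN, hL.form_init, hUr N₀ hN]
    · intro M h1 h2 μ y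
      rcases Nat.lt_or_ge N M with hlt | hge
      · obtain rfl : M = N + 1 := by omega
        rw [OneForm.restr_self, GaugeField.restr_self]
        simp only [incl_self]
        exact h.lieExp_nextForm U A g hA μ y
      · have h3 := hL.exp_eq M h1 hge μ y
        rw [hrA M hge, h3, hUr M hge]
        congr 1
        funext x
        exact (hgi M hge x).symm
    · intro M h1 h2 μ y
      rcases Nat.lt_or_ge M N with hlt | hge
      · have h3 := hL.halving M h1 hlt μ y
        rwa [hrA M hlt.le, hrA (M + 1) hlt]
      · obtain rfl : M = N := by omega
        rw [OneForm.restr_self, hr]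
        exact nextForm_incl U A g μ y
    · intro M h1 h2 y
      rcases Nat.lt_or_ge M N with hlt | hge
      · have h3 := hL.interior M h1 hlt y
        rw [hUr (M + 1) hlt] at h3
        rw [hrA (M + 1) hlt]
        convert h3 using 2
        exact hgi (M + 1) hlt _
      · obtain rfl : M = N := by omega
        rw [OneForm.restr_self, GaugeField.restr_self]
        simp only [incl_self]
        exact h.interiorRule_next U A g hM hK hK' hA y

end Refinement

/-! ### Sequences of finite variation -/

section Variation

variable {E : Type*} [NormedAddCommGroup E]

/-- `X` has `q`-variation at most `V` on `{0, …, k}`, formulated with monotone (not necessarily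
strictly monotone) partitions. -/
def VariationLE (q V : ℝ) (k : ℕ) (X : ℕ → E) : Prop :=
  ∀ (n : ℕ) (t : ℕ → ℕ), Monotone t → t n ≤ k →
    ∑ i ∈ Finset.range n, ‖X (t (i + 1)) - X (t i)‖ ^ q ≤ V ^ q

/-- Repeated points of a partition can be dropped. -/
theorem exists_strict_partition {q : ℝ} (hq : 0 < q) (X : ℕ → E) (t : ℕ → ℕ) (ht : Monotone t)
    (n : ℕ) : ∃ (m : ℕ) (s : ℕ → ℕ), (∀ i < m, s i < s (i + 1)) ∧ s m = t n ∧
      ∑ i ∈ Finset.range n, ‖X (t (i + 1)) - X (t i)‖ ^ q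
        = ∑ i ∈ Finset.range m, ‖X (s (i + 1)) - X (s i)‖ ^ q := by
  induction n with
  | zero => exact ⟨0, t, by simp, rfl, by simp⟩
  | succ n ih =>
    obtain ⟨m, s, hs, hm, hsum⟩ := ih
    rcases (ht (Nat.le_succ n)).eq_or_lt with heq | hlt
    · refine ⟨m, s, hs, hm.trans heq, ?_⟩
      rw [Finset.sum_range_succ, hsum, Nat.succ_eq_add_one] at *
      rw [← heq, sub_self, norm_zero, Real.zero_rpow hq.ne', add_zero]
    · refine ⟨m + 1, fun i => if i ≤ m then s i else t (n + 1), fun i hi => ?_, by simp, ?_⟩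
      · rcases Nat.lt_or_ge i m with h1 | h1
        · simp only [if_pos h1.le, if_pos (Nat.succ_le_of_lt h1)]
          exact hs i h1
        · obtain rfl : i = m := by omega
          simpa [hm] using hlt
      · rw [Finset.sum_range_succ, Finset.sum_range_succ, hsum]
        congr 1
        · refine Finset.sum_congr rfl fun i hi => ?_
          have h1 := Finset.mem_range.1 hi
          simp only [if_pos h1.le, if_pos (Nat.succ_le_of_lt h1)]
        · simp [hm]

theorem le_of_strict_partition {m : ℕ} {s : ℕ → ℕ} (hs : ∀ i < m, s i < s (i + 1)) :
    ∀ i ≤ m, i ≤ s i ∧ s i + (m - i) ≤ s m := by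
  intro i hi
  constructor
  · induction i with
    | zero => simp
    | succ i ih =>
      have := hs i hi
      have := ih (by omega)
      omega
  · induction hi using Nat.decreasingInduction with
    | self => simp
    | of_succ i hi ih =>
      have := hs i hi
      omega

/-- The `q`-variation is a supremum of a bounded set, because partitions of `{0, …, k}` have at most
`k` steps; so it does bound the variation along every partition. -/
theorem variationLE_qVar {q : ℝ} (hq : 1 ≤ q) (k : ℕ) (X : ℕ → E) :
    0 ≤ qVar q k X ∧ VariationLE q (qVar q k X) k X := by
  have hq0 : 0 < q := by linarith
  have hbdd : BddAbove {v : ℝ | ∃ (n : ℕ) (t : ℕ → ℕ), (∀ i < n, t i < t (i + 1)) ∧ t n ≤ k ∧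
      v = (∑ i ∈ Finset.range n, ‖X (t (i + 1)) - X (t i)‖ ^ q) ^ (1 / q)} := by
    set D := ∑ j ∈ Finset.range (k + 1), ‖X j‖ with hD
    have hXD : ∀ j ≤ k, ‖X j‖ ≤ D := fun j hj =>
      Finset.single_le_sum (f := fun j => ‖X j‖) (fun _ _ => norm_nonneg _)
        (Finset.mem_range.2 (by omega))
    have hD0 : 0 ≤ D := Finset.sum_nonneg fun _ _ => norm_nonneg _
    refine ⟨((k : ℝ) * (2 * D) ^ q) ^ (1 / q), ?_⟩
    rintro v ⟨n, t, ht, htn, rfl⟩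
    have hle := le_of_strict_partition ht
    have hnk : n ≤ k := (hle n le_rfl).1.trans htn
    refine Real.rpow_le_rpow (Finset.sum_nonneg fun _ _ => by positivity) ?_ (by positivity)
    calc ∑ i ∈ Finset.range n, ‖X (t (i + 1)) - X (t i)‖ ^ q
        ≤ ∑ _i ∈ Finset.range n, (2 * D) ^ q := by
          refine Finset.sum_le_sum fun i hi => ?_
          have h1 := Finset.mem_range.1 hi
          have h2 := (hle i h1.le).2
          have h3 := (hle (i + 1) h1).2
          refine Real.rpow_le_rpow (norm_nonneg _) ?_ hq0.le
          have := norm_sub_le (X (t (i + 1))) (X (t i))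
          have := hXD (t (i + 1)) (by omega)
          have := hXD (t i) (by omega)
          linarith
      _ = n * (2 * D) ^ q := by simp
      _ ≤ k * (2 * D) ^ q := by
          refine mul_le_mul_of_nonneg_right (by exact_mod_cast hnk) (by positivity)
  have h0 : 0 ≤ qVar q k X := by
    refine Real.sSup_nonneg ?_
    rintro v ⟨n, t, -, -, rfl⟩
    exact Real.rpow_nonneg (Finset.sum_nonneg fun _ _ => by positivity) _
  refine ⟨h0, fun n t ht htn => ?_⟩
  obtain ⟨m, s, hs, hm, hsum⟩ := exists_strict_partition hq0 X t ht n
  have h1 := le_csSup hbdd ⟨m, s, hs, hm.le.trans htn, rfl⟩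
  have hnn : 0 ≤ ∑ i ∈ Finset.range m, ‖X (s (i + 1)) - X (s i)‖ ^ q :=
    Finset.sum_nonneg fun _ _ => by positivity
  have h2 := Real.rpow_le_rpow (Real.rpow_nonneg hnn _) h1 hq0.le
  rw [← Real.rpow_mul hnn, one_div_mul_cancel hq0.ne', Real.rpow_one] at h2
  rw [hsum]
  exact h2

theorem VariationLE.norm_sub_le {q V : ℝ} (hq : 1 ≤ q) (hV : 0 ≤ V) {k : ℕ} {X : ℕ → E}
    (h : VariationLE q V k X) {i j : ℕ} (hij : i ≤ j) (hj : j ≤ k) : ‖X j - X i‖ ≤ V := by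
  have h1 := h 1 (fun n => if n = 0 then i else j) (by
    intro a b hab
    by_cases ha : a = 0 <;> by_cases hb : b = 0 <;> simp [ha, hb, hij]
    omega) (by simpa using hj)
  simp only [Finset.sum_range_one] at h1
  simp only [zero_add, one_ne_zero, if_false, if_true] at h1
  exact (Real.rpow_le_rpow_iff (norm_nonneg _) hV (by linarith)).1 h1

end Variation

/-! ### Young's inequality -/

section Young

/-- Hölder's inequality for the passage from `q`-th powers to the sum. -/
theorem sum_norm_le_of_sum_rpow_le {E : Type*} [NormedAddCommGroup E] {q V : ℝ} (hq : 1 ≤ q)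
    (hV : 0 ≤ V) (m : ℕ) (y : ℕ → E)
    (hy : ∑ i ∈ Finset.range m, ‖y i‖ ^ q ≤ V ^ q) :
    ∑ i ∈ Finset.range m, ‖y i‖ ≤ (m : ℝ) ^ (1 - q⁻¹) * V := by
  have hq0 : 0 < q := by linarith
  have h1 := Real.rpow_sum_le_const_mul_sum_rpow (Finset.range m) (fun i => ‖y i‖) hq
  simp only [abs_norm, Finset.card_range] at h1
  have h2 : (∑ i ∈ Finset.range m, ‖y i‖) ^ q ≤ ((m : ℝ) ^ (1 - q⁻¹) * V) ^ q := by
    rw [Real.mul_rpow (by positivity) hV, ← Real.rpow_mul (by positivity), sub_mul, one_mul,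
      inv_mul_cancel₀ hq0.ne']
    exact h1.trans (mul_le_mul_of_nonneg_left hy (by positivity))
  exact (Real.rpow_le_rpow_iff (Finset.sum_nonneg fun _ _ => norm_nonneg _) (by positivity) hq0).1 h2

variable {E : Type*} [NormedAddCommGroup E] [NormedSpace ℝ E]

/-- Discrete Young inequality on `2 ^ n` steps, by passing to the coarser mesh: merging the steps
`2 j` and `2 j + 1` costs `∑ (O_{2j+1} - O_{2j}) (Y_{2j+2} - Y_{2j+1})`, which is controlled by
Hölder's inequality. -/
theorem young_dyadic {q b V : ℝ} (hq : 1 ≤ q) (hb : 0 ≤ b) (hV : 0 ≤ V) (n : ℕ) :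
    ∀ (η : ℝ) (O : ℕ → E →L[ℝ] E) (Y : ℕ → E), 0 ≤ η → ‖O 0‖ ≤ 1 →
      (∀ s t, s ≤ t → ‖O t - O s‖ ≤ η * ((t - s : ℕ) : ℝ) ^ b) → VariationLE q V (2 ^ n) Y →
      ‖∑ i ∈ Finset.range (2 ^ n), O i (Y (i + 1) - Y i)‖ ≤
        V * (1 + η * 2 ^ (n * b) * ∑ i ∈ Finset.range n, ((2 : ℝ) ^ (-(b - 1 + q⁻¹))) ^ i) := by
  induction n with
  | zero =>
    intro η O Y hη hO hH hY
    simp only [pow_zero, Finset.sum_range_one, Finset.sum_range_zero, mul_zero, add_zero, mul_one]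
    exact ((O 0).le_of_opNorm_le_of_le hO
      (hY.norm_sub_le hq hV (Nat.zero_le 1) (by simp))).trans (by simp)
  | succ n ih =>
    intro η O Y hη hO hH hY
    have hY' : VariationLE q V (2 ^ n) fun i => Y (2 * i) := by
      intro m t ht htm
      exact hY m (fun i => 2 * t i) (fun i j hij => Nat.mul_le_mul_left 2 (ht hij))
        (by rw [pow_succ]; omega)
    have h1 := ih (η * 2 ^ b) (fun i => O (2 * i)) (fun i => Y (2 * i)) (by positivity) hO
      (fun s t hst => by
        refine (hH (2 * s) (2 * t) (by omega)).trans ?_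
        rw [← Nat.mul_sub, Nat.cast_mul, Real.mul_rpow (by positivity) (by positivity), mul_assoc]
        simp) hY'
    have hsplit : ∑ i ∈ Finset.range (2 ^ (n + 1)), O i (Y (i + 1) - Y i)
        = ∑ i ∈ Finset.range (2 ^ n), O (2 * i) (Y (2 * (i + 1)) - Y (2 * i))
          + ∑ i ∈ Finset.range (2 ^ n),
            (O (2 * i + 1) - O (2 * i)) (Y (2 * i + 1 + 1) - Y (2 * i + 1)) := by
      rw [pow_succ, sum_range_mul, ← Finset.sum_add_distrib]
      refine Finset.sum_congr rfl fun i _ => ?_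
      simp only [Finset.sum_range_succ, Finset.sum_range_zero, zero_add, add_zero, mul_comm i 2,
        sub_apply, map_sub, mul_add, mul_one, add_assoc]
      abel
    have h2 : ‖∑ i ∈ Finset.range (2 ^ n),
        (O (2 * i + 1) - O (2 * i)) (Y (2 * i + 1 + 1) - Y (2 * i + 1))‖
        ≤ η * (((2 ^ n : ℕ) : ℝ) ^ (1 - q⁻¹) * V) := by
      have hs : ∑ i ∈ Finset.range (2 ^ n), ‖Y (2 * i + 1 + 1) - Y (2 * i + 1)‖ ^ q ≤ V ^ q := by
        refine le_trans ?_ (hY (2 ^ (n + 1)) id monotone_id le_rfl)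
        rw [pow_succ, sum_range_mul]
        refine Finset.sum_le_sum fun i _ => ?_
        simp only [Finset.sum_range_succ, Finset.sum_range_zero, zero_add, add_zero, mul_comm i 2,
          id]
        exact le_add_of_nonneg_left (by positivity)
      have h3 := sum_norm_le_of_sum_rpow_le hq hV _ _ hs
      refine (norm_sum_le _ _).trans ?_
      refine le_trans ?_ (mul_le_mul_of_nonneg_left h3 hη)
      rw [Finset.mul_sum]
      refine Finset.sum_le_sum fun i _ => ?_
      refine ContinuousLinearMap.le_of_opNorm_le _ ?_ _
      have := hH (2 * i) (2 * i + 1) (by omega)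
      simpa using this
    rw [hsplit]
    refine (norm_add_le _ _).trans ((add_le_add h1 h2).trans ?_)
    rw [Finset.sum_range_succ]
    have e1 : (2 : ℝ) ^ (((n + 1 : ℕ) : ℝ) * b) = 2 ^ b * 2 ^ (n * b) := by
      rw [← Real.rpow_add two_pos]; congr 1; push_cast; ring
    have e2 : ((2 ^ n : ℕ) : ℝ) ^ (1 - q⁻¹)
        = 2 ^ (n * b) * ((2 : ℝ) ^ (-(b - 1 + q⁻¹))) ^ n := by
      rw [← Real.rpow_natCast ((2 : ℝ) ^ _) n, ← Real.rpow_mul two_pos.le, ← Real.rpow_add two_pos]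
      push_cast
      rw [← Real.rpow_natCast, ← Real.rpow_mul two_pos.le]
      congr 1; ring
    rw [e1, e2]
    have e3 : 1 ≤ (2 : ℝ) ^ b := Real.one_le_rpow one_le_two hb
    have e4 : 0 ≤ η * (2 ^ (n * b) * ((2 : ℝ) ^ (-(b - 1 + q⁻¹))) ^ n * V) := by positivity
    have e5 := le_mul_of_one_le_left e4 e3
    linear_combination e5

/-- Discrete Young inequality: `O` is Hölder continuous with exponent `b`, `Y` has finite
`q`-variation and `b + 1 / q > 1`. -/
theorem young_sum_le {q b V η : ℝ} (hq : 1 ≤ q) (hb : 0 ≤ b) (hbq : 1 - q⁻¹ < b) (hV : 0 ≤ V)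
    (hη : 0 ≤ η) {N k : ℕ} (hk : k ≤ 2 ^ N) (O : ℕ → E →L[ℝ] E) (Y : ℕ → E) (hO : ‖O 0‖ ≤ 1)
    (hH : ∀ s t, s ≤ t → t ≤ k → ‖O t - O s‖ ≤ η * ((t - s : ℕ) : ℝ) ^ b)
    (hY : VariationLE q V k Y) :
    ‖∑ i ∈ Finset.range k, O i (Y (i + 1) - Y i)‖ ≤
      V * (1 + η * 2 ^ (N * b) * (1 - (2 : ℝ) ^ (-(b - 1 + q⁻¹)))⁻¹) := by
  have hx0 : 0 ≤ (2 : ℝ) ^ (-(b - 1 + q⁻¹)) := by positivity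
  have hx1 : (2 : ℝ) ^ (-(b - 1 + q⁻¹)) < 1 :=
    Real.rpow_lt_one_of_one_lt_of_neg one_lt_two (by linarith)
  -- freeze both sequences after the step `k`
  have h1 := young_dyadic hq hb hV N η (fun i => O (min i k)) (fun i => Y (min i k)) hη (by simpa)
    (fun s t hst => by
      refine (hH (min s k) (min t k) (by omega) (by omega)).trans ?_
      refine mul_le_mul_of_nonneg_left (Real.rpow_le_rpow (by positivity) ?_ hb) hη
      exact_mod_cast (by omega : min t k - min s k ≤ t - s))
    (fun m t ht _ => hY m (fun i => min (t i) k)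
      (fun i j hij => min_le_min_right k (ht hij)) (min_le_right _ _))
  have h2 : ∑ i ∈ Finset.range (2 ^ N), O (min i k) (Y (min (i + 1) k) - Y (min i k))
      = ∑ i ∈ Finset.range k, O i (Y (i + 1) - Y i) := by
    rw [← Finset.sum_subset (Finset.range_subset_range.2 hk)]
    · refine Finset.sum_congr rfl fun i hi => ?_
      have := Finset.mem_range.1 hi
      rw [min_eq_left (by omega : i ≤ k), min_eq_left (by omega : i + 1 ≤ k)]
    · intro i _ hi
      have : ¬ i < k := fun h => hi (Finset.mem_range.2 h)
      rw [min_eq_right (by omega : k ≤ i), min_eq_right (by omega : k ≤ i + 1), sub_self, map_zero]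
  rw [h2] at h1
  refine h1.trans (mul_le_mul_of_nonneg_left ?_ hV)
  have h3 : ∑ i ∈ Finset.range N, ((2 : ℝ) ^ (-(b - 1 + q⁻¹))) ^ i
      ≤ (1 - (2 : ℝ) ^ (-(b - 1 + q⁻¹)))⁻¹ := by
    rw [← tsum_geometric_of_lt_one hx0 hx1]
    exact (summable_geometric_of_lt_one hx0 hx1).sum_le_tsum _ fun _ _ => by positivity
  have := mul_le_mul_of_nonneg_left h3 (by positivity : 0 ≤ η * 2 ^ (N * b))
  linarith

end Young

/-! ### Ordered products with Hölder continuous increments -/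

section Development

variable {E : Type*} [NormedAddCommGroup E] [NormedSpace ℝ E]
  {R : Type*} [NormedRing R] [NormedSpace ℝ R]

/-- Bound for an ordered product of `n` factors close to `1`, when their increments `L aᵢ` sum up
to something Hölder of exponent `b > 1 / 2`. For short products, cutting the product into two halves
and linearizing shows that the product is `1 + L (∑ aᵢ)` up to a remainder of order `η² n ^ (2 b)`. -/
theorem exists_norm_prod_sub_one_le (L : E →L[ℝ] R) {C b : ℝ} (hb : 1 / 2 < b) :
    ∃ D : ℝ, 0 ≤ D ∧ ∀ (η : ℝ) (k : ℕ) (T : ℕ → R) (a : ℕ → E), 0 ≤ η →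
      (∀ s n, s + n ≤ k → ‖((List.range n).map fun j => T (s + j)).prod‖ ≤ 1) →
      ‖(1 : R)‖ ≤ 1 →
      (∀ i < k, ‖T i - 1 - L (a i)‖ ≤ C * ‖a i‖ ^ 2) →
      (∀ s n, s + n ≤ k → ‖∑ j ∈ Finset.range n, a (s + j)‖ ≤ η * (n : ℝ) ^ b) →
      ∀ s n, s + n ≤ k → ‖((List.range n).map fun j => T (s + j)).prod - 1‖ ≤ D * (η * (n : ℝ) ^ b) := by
  -- both halves of an interval of length `n ≥ 2` have length at most `2 n / 3`; `θ` is the resulting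
  -- gain of the superadditive control `n ^ (2 b)`
  set θ : ℝ := (2 / 3 : ℝ) ^ (2 * b - 1) with hθ
  have hθ0 : 0 ≤ θ := by positivity
  have hθ1 : θ < 1 := Real.rpow_lt_one (by norm_num) (by norm_num) (by linarith)
  set C₁ : ℝ := max (max C 1) ((‖L‖ + 1) ^ 2 / (1 - θ)) with hC₁
  have hC₁C : C ≤ C₁ := (le_max_left _ _).trans (le_max_left _ _)
  have hC₁1 : 1 ≤ C₁ := (le_max_right _ _).trans (le_max_left _ _)
  have hC₁θ : C₁ * θ + (‖L‖ + 1) ^ 2 ≤ C₁ := by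
    have := (div_le_iff₀ (by linarith : 0 < 1 - θ)).1 (le_max_right (max C 1) _ :
      (‖L‖ + 1) ^ 2 / (1 - θ) ≤ C₁)
    linarith
  refine ⟨‖L‖ + 1 + 2 * C₁, by positivity, fun η k T a hη hP hone hT ha => ?_⟩
  have hpow : ∀ n : ℕ, ((n : ℝ) ^ b) ^ 2 = (n : ℝ) ^ (2 * b) := fun n => by
    rw [← Real.rpow_natCast, ← Real.rpow_mul (by positivity)]; congr 1; push_cast; ring
  have small : ∀ s n, s + n ≤ k → η * (n : ℝ) ^ b * C₁ ≤ 1 →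
      ∀ r : R, ‖r‖ ≤ C₁ * (η * (n : ℝ) ^ b) ^ 2 →
      ‖L (∑ j ∈ Finset.range n, a (s + j)) + r‖ ≤ (‖L‖ + 1) * (η * (n : ℝ) ^ b) := by
    intro s n hsn hsm r hr
    have h1 := L.le_of_opNorm_le_of_le le_rfl (ha s n hsn)
    have h2 : C₁ * (η * (n : ℝ) ^ b) ^ 2 ≤ η * (n : ℝ) ^ b := by
      have : 0 ≤ η * (n : ℝ) ^ b := by positivity
      nlinarith
    have := norm_add_le (L (∑ j ∈ Finset.range n, a (s + j))) r
    linarith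
  have main : ∀ n s, s + n ≤ k → η * (n : ℝ) ^ b * C₁ ≤ 1 →
      ‖((List.range n).map fun j => T (s + j)).prod - 1 - L (∑ j ∈ Finset.range n, a (s + j))‖
        ≤ C₁ * (η * (n : ℝ) ^ b) ^ 2 := by
    intro n
    induction n using Nat.strong_induction_on with
    | _ n ih =>
      intro s hsn hsm
      rcases Nat.lt_or_ge n 2 with hlt | hge
      · interval_cases n
        · have : 0 ≤ C₁ * (η * ((0 : ℕ) : ℝ) ^ b) ^ 2 := by positivity
          simpa using this
        · -- a single factor: the first order expansion of `T`
          have h1 := hT s (by omega)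
          have h2 := ha s 1 hsn
          simp only [Finset.sum_range_one, add_zero, Nat.cast_one, Real.one_rpow, mul_one] at h2
          simp only [List.range_one, List.map_cons, List.map_nil, List.prod_cons, List.prod_nil,
            mul_one, add_zero, Finset.sum_range_one, Nat.cast_one, Real.one_rpow]
          refine h1.trans (mul_le_mul hC₁C (pow_le_pow_left₀ (norm_nonneg _) h2 2)
            (by positivity) (by linarith))
      · obtain ⟨n₁, n₂, hn, hn₁, hn₂, h₁, h₂⟩ : ∃ n₁ n₂, n = n₁ + n₂ ∧ 0 < n₁ ∧ 0 < n₂ ∧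
            3 * n₁ ≤ 2 * n ∧ 3 * n₂ ≤ 2 * n := ⟨n / 2, n - n / 2, by omega, by omega, by omega,
              by omega, by omega⟩
        have mono : ∀ m ≤ n, η * (m : ℝ) ^ b ≤ η * (n : ℝ) ^ b := fun m hm =>
          mul_le_mul_of_nonneg_left (Real.rpow_le_rpow (by positivity) (by exact_mod_cast hm)
            (by linarith)) hη
        have c₁ : η * (n₁ : ℝ) ^ b * C₁ ≤ 1 :=
          (mul_le_mul_of_nonneg_right (mono n₁ (by omega)) (by linarith)).trans hsm
        have c₂ : η * (n₂ : ℝ) ^ b * C₁ ≤ 1 :=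
          (mul_le_mul_of_nonneg_right (mono n₂ (by omega)) (by linarith)).trans hsm
        have r₁ := ih n₁ (by omega) s (by omega) c₁
        have r₂ := ih n₂ (by omega) (s + n₁) (by omega) c₂
        have d₁ := small s n₁ (by omega) c₁ _ r₁
        have d₂ := small (s + n₁) n₂ (by omega) c₂ _ r₂
        set A₁ := ∑ j ∈ Finset.range n₁, a (s + j) with hA₁
        set A₂ := ∑ j ∈ Finset.range n₂, a (s + n₁ + j) with hA₂
        set P₁ := ((List.range n₁).map fun j => T (s + j)).prod with hP₁
        set P₂ := ((List.range n₂).map fun j => T (s + n₁ + j)).prod with hP₂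
        have eP : ((List.range n).map fun j => T (s + j)).prod = P₁ * P₂ := by
          rw [hn, List.range_add, List.map_append, List.prod_append, List.map_map]
          simp only [Function.comp_def, ← add_assoc, hP₁, hP₂]
        have eA : ∑ j ∈ Finset.range n, a (s + j) = A₁ + A₂ := by
          rw [hn, Finset.sum_range_add]
          simp only [← add_assoc, hA₁, hA₂]
        have eR : P₁ * P₂ - 1 - L (A₁ + A₂) = (P₁ - 1 - L A₁) + (P₂ - 1 - L A₂)
            + (L A₁ + (P₁ - 1 - L A₁)) * (L A₂ + (P₂ - 1 - L A₂)) := by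
          rw [map_add]; noncomm_ring
        rw [eP, eA, eR]
        have hsq : ∀ m : ℕ, 0 < m → 3 * m ≤ 2 * n →
            (m : ℝ) ^ (2 * b) ≤ θ * (n : ℝ) ^ (2 * b - 1) * m := by
          intro m hm hmn
          have hm0 : (0 : ℝ) < m := by exact_mod_cast hm
          have h3 : (m : ℝ) ≤ 2 / 3 * n := by
            have : (3 * m : ℝ) ≤ 2 * n := by exact_mod_cast hmn
            linarith
          have h4 : (m : ℝ) ^ (2 * b) = (m : ℝ) ^ (2 * b - 1) * m := by
            rw [← Real.rpow_add_one hm0.ne']; congr 1; ring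
          rw [h4, hθ, ← Real.mul_rpow (by norm_num) (by positivity)]
          exact mul_le_mul_of_nonneg_right (Real.rpow_le_rpow hm0.le h3 (by linarith)) hm0.le
        have hsum : (n₁ : ℝ) ^ (2 * b) + (n₂ : ℝ) ^ (2 * b) ≤ θ * (n : ℝ) ^ (2 * b) := by
          have hn0 : (0 : ℝ) < n := by exact_mod_cast (by omega : 0 < n)
          have h4 : (n : ℝ) ^ (2 * b) = (n : ℝ) ^ (2 * b - 1) * n := by
            rw [← Real.rpow_add_one hn0.ne']; congr 1; ring
          have h5 : (n : ℝ) = n₁ + n₂ := by exact_mod_cast hn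
          have := hsq n₁ hn₁ h₁
          have := hsq n₂ hn₂ h₂
          rw [h4]
          calc _ ≤ θ * (n : ℝ) ^ (2 * b - 1) * n₁ + θ * (n : ℝ) ^ (2 * b - 1) * n₂ := by linarith
            _ = θ * (n : ℝ) ^ (2 * b - 1) * (n₁ + n₂) := by ring
            _ = _ := by rw [← h5]; ring
        have hprod : ‖(L A₁ + (P₁ - 1 - L A₁)) * (L A₂ + (P₂ - 1 - L A₂))‖
            ≤ (‖L‖ + 1) ^ 2 * (η ^ 2 * (n : ℝ) ^ (2 * b)) := by
          refine (norm_mul_le _ _).trans ?_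
          have e₁ := d₁.trans (mul_le_mul_of_nonneg_left (mono n₁ (by omega)) (by positivity))
          have e₂ := d₂.trans (mul_le_mul_of_nonneg_left (mono n₂ (by omega)) (by positivity))
          refine (mul_le_mul e₁ e₂ (norm_nonneg _) (by positivity)).trans (le_of_eq ?_)
          rw [← hpow]; ring
        refine norm_add₃_le.trans ?_
        rw [mul_pow, hpow] at r₁ r₂ ⊢
        have hη2 : 0 ≤ C₁ * η ^ 2 := by positivity
        have f1 := mul_le_mul_of_nonneg_left hsum hη2
        have f2 := mul_le_mul_of_nonneg_right hC₁θ
          (by positivity : 0 ≤ η ^ 2 * (n : ℝ) ^ (2 * b))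
        linarith
  intro s n hsn
  have hx : 0 ≤ η * (n : ℝ) ^ b := by positivity
  rcases le_or_gt (η * (n : ℝ) ^ b * C₁) 1 with hle | hgt
  · have h1 := small s n hsn hle _ (main n s hsn hle)
    rw [add_sub_cancel] at h1
    refine h1.trans (mul_le_mul_of_nonneg_right ?_ hx)
    linarith
  · -- for long products the trivial bound `2` suffices
    have h1 := (norm_sub_le _ _).trans (add_le_add (hP s n hsn) hone)
    have := norm_nonneg L
    nlinarith

end Development

/-! ### Comparison of the two sides of a strip -/

section Ladder

variable {E : Type*} [NormedAddCommGroup E] [InnerProductSpace ℝ E]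
  {G : Type*} [TopologicalSpace G] [ChartedSpace E G] [Group G]
  {log : G → E} {ε C : ℝ} {L : E →L[ℝ] (E →L[ℝ] E)}

/-- Comparison of `A` on the two long sides of a strip of plaquettes. In the logarithm, a plaquette
holonomy is the difference of the values of `A` on the two sides, up to the telescoping transverse
bonds `e` and a quadratic error. On the other hand it is an increment of the anti-development, rotated
by the adjoint action of the holonomy `τ` along one of the sides, so that Young's inequality
applies. -/
theorem LocalCalculus.exists_ladder_le (h : LocalCalculus log ε C L) {b q : ℝ} (hb : 1 / 2 < b)
    (hq : 1 ≤ q) (hbq : 1 - q⁻¹ < b) :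
    ∃ D : ℝ, 0 ≤ D ∧ ∀ (N k : ℕ) (θ η V : ℝ) (o v e : ℕ → E) (κ : G) (lam : ℕ → G), k ≤ 2 ^ N →
      0 ≤ η → 0 ≤ V → 4 * θ < ε →
      (∀ i < k, ‖o i‖ ≤ θ) → (∀ i < k, ‖v i‖ ≤ θ) → (∀ i ≤ k, ‖e i‖ ≤ θ) →
      (∀ i < k, ‖log (lam i)‖ < ε) →
      (∀ i < k, (lieExp (e i) : G)⁻¹ * lieExp (o i) * lieExp (e (i + 1)) * (lieExp (v i))⁻¹
        = (((List.range i).map fun j => (lieExp (v j) : G)).prod)⁻¹ * (κ * lam i * κ⁻¹)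
          * ((List.range i).map fun j => (lieExp (v j) : G)).prod) →
      VariationLE q V k (fun i => ∑ j ∈ Finset.range i, log (lam j)) →
      (∀ s n, s + n ≤ k → ‖∑ j ∈ Finset.range n, v (s + j)‖ ≤ η * (n : ℝ) ^ b) →
      ‖∑ i ∈ Finset.range k, (o i - v i)‖ ≤
        V * (1 + D * (η * 2 ^ (N * b))) + 2 * θ + k * (44 * C * θ ^ 2) := by
  obtain ⟨D, hD, hdev⟩ := exists_norm_prod_sub_one_le L (C := C) hb
  have hx1 : (2 : ℝ) ^ (-(b - 1 + q⁻¹)) < 1 :=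
    Real.rpow_lt_one_of_one_lt_of_neg one_lt_two (by linarith)
  refine ⟨D * (1 - (2 : ℝ) ^ (-(b - 1 + q⁻¹)))⁻¹,
    mul_nonneg hD (inv_nonneg.2 (by linarith)), ?_⟩
  intro N k θ η V o v e κ lam hk hη hV hθ ho hv he hlam hplaq hvar hhol
  set τ : ℕ → G := fun i => ((List.range i).map fun j => (lieExp (v j) : G)).prod with hτ
  set Y : ℕ → E := fun i => ∑ j ∈ Finset.range i, log (lam j) with hY
  have hAdprod : ∀ s n, Ad (E := E) (((List.range n).map fun j => (lieExp (v (s + j)) : G)).prod)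
      = ((List.range n).map fun j => Ad (E := E) (lieExp (v (s + j)) : G)).prod := by
    intro s n
    induction n with
    | zero => simpa using h.Ad_one
    | succ n ih =>
      simp only [List.range_succ, List.map_append, List.prod_append, List.map_cons, List.map_nil,
        List.prod_cons, List.prod_nil, mul_one, h.Ad_mul, ih]
  -- the integrand of the Young sum is Hölder continuous, as `Ad` acts by isometries
  have hO : ∀ s t, s ≤ t → t ≤ k → ‖Ad (E := E) ((τ t)⁻¹ * κ) - Ad (E := E) ((τ s)⁻¹ * κ)‖
      ≤ D * η * ((t - s : ℕ) : ℝ) ^ b := by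
    intro s t hst htk
    obtain ⟨n, rfl⟩ := Nat.exists_eq_add_of_le hst
    set p : G := ((List.range n).map fun j => (lieExp (v (s + j)) : G)).prod with hp
    have hτp : τ (s + n) = τ s * p := by
      simp only [hτ, hp, List.range_add, List.map_append, List.prod_append, List.map_map,
        Function.comp_def]
    have h1 := hdev η k (fun i => Ad (E := E) (lieExp (v i) : G)) v hη
      (fun s n _ => by rw [← hAdprod]; exact h.norm_Ad_le _)
      (by rw [← h.Ad_one (log := log) (G := G)]; exact h.norm_Ad_le _)
      (fun i hi => h.Ad_exp (v i) (by
        have := hv i hi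
        have := norm_nonneg (v i)
        linarith)) hhol s n htk
    rw [← hAdprod, ← hp] at h1
    have h2 : Ad (E := E) ((τ (s + n))⁻¹ * κ) - Ad (E := E) ((τ s)⁻¹ * κ)
        = Ad (E := E) p⁻¹ * (1 - Ad (E := E) p) * Ad (E := E) ((τ s)⁻¹ * κ) := by
      rw [mul_sub, sub_mul, mul_one, ← h.Ad_mul p⁻¹ p, inv_mul_cancel, h.Ad_one, one_mul,
        ← h.Ad_mul, hτp]
      congr 2
      group
    rw [h2, Nat.add_sub_cancel_left]
    calc _ ≤ ‖Ad (E := E) p⁻¹‖ * ‖1 - Ad (E := E) p‖ * ‖Ad (E := E) ((τ s)⁻¹ * κ)‖ :=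
          (norm_mul_le _ _).trans (mul_le_mul_of_nonneg_right (norm_mul_le _ _) (norm_nonneg _))
      _ ≤ 1 * ‖1 - Ad (E := E) p‖ * 1 := by
          gcongr
          · exact h.norm_Ad_le _
          · exact h.norm_Ad_le _
      _ ≤ _ := by rw [one_mul, mul_one, norm_sub_rev]; linarith
  have hyoung := young_sum_le hq (by linarith) hbq hV (mul_nonneg hD hη) hk
    (fun i => Ad (E := E) ((τ i)⁻¹ * κ)) Y (h.norm_Ad_le _) hO hvar
  have hloc : ∀ i < k, ‖Ad (E := E) ((τ i)⁻¹ * κ) (Y (i + 1) - Y i)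
      - (-e i + o i + e (i + 1) + -v i)‖ ≤ 44 * C * θ ^ 2 := by
    intro i hi
    have h1 := h.log_mul_four hθ (h.exp_neg (e i)).symm rfl rfl (h.exp_neg (v i)).symm
      (by rw [norm_neg]; exact he i hi.le) (ho i hi) (he (i + 1) hi) (by rw [norm_neg]; exact hv i hi)
    have h2 : (τ i)⁻¹ * (κ * lam i * κ⁻¹) * τ i = ((τ i)⁻¹ * κ) * lam i * ((τ i)⁻¹ * κ)⁻¹ := by
      group
    rw [hplaq i hi, h2, h.log_conj _ (hlam i hi)] at h1
    simpa only [hY, Finset.sum_range_succ, add_sub_cancel_left] using h1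
  -- the transverse bonds telescope
  have hid : ∑ i ∈ Finset.range k, (o i - v i)
      = ∑ i ∈ Finset.range k, Ad (E := E) ((τ i)⁻¹ * κ) (Y (i + 1) - Y i)
        - ∑ i ∈ Finset.range k, (Ad (E := E) ((τ i)⁻¹ * κ) (Y (i + 1) - Y i)
          - (-e i + o i + e (i + 1) + -v i)) - (e k - e 0) := by
    rw [← Finset.sum_range_sub, ← Finset.sum_sub_distrib, ← Finset.sum_sub_distrib]
    refine Finset.sum_congr rfl fun i _ => ?_
    abel
  rw [hid]
  have e1 := norm_sub_le (∑ i ∈ Finset.range k, Ad (E := E) ((τ i)⁻¹ * κ) (Y (i + 1) - Y i)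
    - ∑ i ∈ Finset.range k, (Ad (E := E) ((τ i)⁻¹ * κ) (Y (i + 1) - Y i)
          - (-e i + o i + e (i + 1) + -v i))) (e k - e 0)
  have e2 := norm_sub_le (∑ i ∈ Finset.range k, Ad (E := E) ((τ i)⁻¹ * κ) (Y (i + 1) - Y i))
    (∑ i ∈ Finset.range k, (Ad (E := E) ((τ i)⁻¹ * κ) (Y (i + 1) - Y i)
          - (-e i + o i + e (i + 1) + -v i)))
  have e3 := norm_sub_le (e k) (e 0)
  have e4 := he k le_rfl
  have e5 := he 0 (Nat.zero_le k)
  have e6 : ‖∑ i ∈ Finset.range k, (Ad (E := E) ((τ i)⁻¹ * κ) (Y (i + 1) - Y i)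
          - (-e i + o i + e (i + 1) + -v i))‖ ≤ k * (44 * C * θ ^ 2) := by
    refine (norm_sum_le_of_le _ fun i hi => hloc i (Finset.mem_range.1 hi)).trans ?_
    simp
  linarith

end Ladder

/-! ### Strips of plaquettes on the lattice -/

section Strips

variable {G : Type*} [Group G] {N : ℕ}

/-- The site with coordinate `a` in direction `μ` and coordinate `v` in the other direction. -/
def linePt (N : ℕ) (μ : Fin 2) (a v : ℤ) : Site N := if μ = 0 then pt N a v else pt N v a

/-- The sum of `A` over `n` consecutive bonds in direction `μ`. -/
def lineSum {E : Type*} [AddCommGroup E] (A : OneForm E N) (μ : Fin 2) (a v : ℤ) (n : ℕ) : E :=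
  ∑ j ∈ Finset.range n, A μ (linePt N μ (a + (j : ℕ)) v)

/-- Adding a plaquette to a horizontal strip multiplies the holonomy by that of a lasso: up the left
side, along the upper side, and around the new plaquette from its north-west corner. -/
theorem boundaryWord_increment_horizontal (U : GaugeField G N) (a b : ℤ) (i : ℕ) :
    ((boundaryWord U (pt N a b) i 1).prod)⁻¹ * (boundaryWord U (pt N a b) (i + 1) 1).prod
      = U 1 (pt N a b) * hprod U a (b + 1) i *
        ((U 1 (pt N (a + i) b))⁻¹ * U 0 (pt N (a + i) b) * U 1 (pt N (a + i + 1) b) *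
          (U 0 (pt N (a + i) (b + 1)))⁻¹) * (U 1 (pt N a b) * hprod U a (b + 1) i)⁻¹ := by
  have hv : ∀ c d : ℤ, vprod U c d 1 = U 1 (pt N c d) := fun c d => by simp [vprod]
  rw [boundaryWord_prod, boundaryWord_prod, hprod_succ, Nat.cast_one, hprod_succ, hv, hv, hv]
  push_cast
  rw [← add_assoc]
  group

/-- For vertical strips the tail of the lasso runs up the left side to the south-west corner of the new
plaquette. -/
theorem boundaryWord_increment_vertical (U : GaugeField G N) (a b : ℤ) (i : ℕ) :
    ((boundaryWord U (pt N a b) 1 i).prod)⁻¹ * (boundaryWord U (pt N a b) 1 (i + 1)).prod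
      = vprod U a b i *
        (U 0 (pt N a (b + i)) * U 1 (pt N (a + 1) (b + i)) * (U 0 (pt N a (b + i + 1)))⁻¹ *
          (U 1 (pt N a (b + i)))⁻¹) * (vprod U a b i)⁻¹ := by
  have hv : ∀ c d : ℤ, hprod U c d 1 = U 0 (pt N c d) := fun c d => by simp [hprod]
  rw [boundaryWord_prod, boundaryWord_prod, Nat.cast_one, vprod_succ, vprod_succ, hv, hv, hv]
  push_cast
  rw [← add_assoc]
  group

theorem boundaryWord_one_one (U : GaugeField G N) (a b : ℤ) :
    (boundaryWord U (pt N a b) 1 1).prod = U 0 (pt N a b) * U 1 (pt N (a + 1) b) *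
      (U 0 (pt N a (b + 1)))⁻¹ * (U 1 (pt N a b))⁻¹ := by
  rw [boundaryWord_prod]
  simp [hprod, vprod]

theorem transform_hprod (U : GaugeField G N) (g : Site N → G) (a b : ℤ) (n : ℕ) :
    hprod (U.transform g) a b n = g (pt N a b) * hprod U a b n * (g (pt N (a + n) b))⁻¹ := by
  induction n with
  | zero => simp [hprod]
  | succ n ih =>
    rw [hprod_succ, hprod_succ, ih, GaugeField.transform, pt_add_step_zero]
    push_cast
    rw [← add_assoc]
    group

theorem transform_vprod (U : GaugeField G N) (g : Site N → G) (a b : ℤ) (n : ℕ) :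
    vprod (U.transform g) a b n = g (pt N a b) * vprod U a b n * (g (pt N a (b + n)))⁻¹ := by
  induction n with
  | zero => simp [vprod]
  | succ n ih =>
    rw [vprod_succ, vprod_succ, ih, GaugeField.transform, pt_add_step_one]
    push_cast
    rw [← add_assoc]
    group

variable {E : Type*} [NormedAddCommGroup E] [InnerProductSpace ℝ E]
  [TopologicalSpace G] [ChartedSpace E G]
  {log : G → E} {ε C : ℝ} {L : E →L[ℝ] (E →L[ℝ] E)}

/-- The ladder estimate on the lattice: comparison of `A` on two neighbouring parallel segments. Only
the strips of exactly `k` plaquettes enter. -/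
theorem LocalCalculus.exists_lineSum_sub_le (h : LocalCalculus log ε C L) {b q : ℝ} (hb : 1 / 2 < b)
    (hq : 1 ≤ q) (hbq : 1 - q⁻¹ < b) :
    ∃ D : ℝ, 0 ≤ D ∧ ∀ (N : ℕ) (U : GaugeField G N) (g : Site N → G) (A : OneForm E N)
      (θ η V : ℝ) (k : ℕ), 1 ≤ k → k < 2 ^ N → 0 ≤ η → 0 ≤ V → 4 * θ < ε →
      (∀ μ x, lieExp (A μ x) = U.transform g μ x) → (∀ μ x, ‖A μ x‖ ≤ θ) →
      (∀ x, ‖log (plaqHol U x)‖ < ε) →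
      (∀ r : Rect N, r.w * r.h = k → qVar q (r.w * r.h) (antiDev log U r) ≤ V) →
      (∀ μ a v, ∀ n ≤ 2 ^ N, ‖lineSum A μ a v n‖ ≤ η * (n : ℝ) ^ b) →
      ∀ μ a v, ‖lineSum A μ a v k - lineSum A μ a (v + 1) k‖ ≤
        V * (1 + D * (η * 2 ^ (N * b))) + 2 * θ + k * (44 * C * θ ^ 2) := by
  obtain ⟨D, hD, hlad⟩ := h.exists_ladder_le hb hq hbq
  refine ⟨D, hD, ?_⟩
  intro N U g A θ η V k hk1 hk hη hV hθ hexp hA hplaq hvar hhol μ a v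
  have hC := h.nonneg
  have hN1 : 1 < 2 ^ N := by omega
  fin_cases μ
  · -- the tail of the lassos runs along the upper side
    simp only [Fin.zero_eta]
    let r : Rect N := ⟨pt N a v, k, 1, hk1, hk, le_rfl, hN1, Or.inr rfl⟩
    obtain ⟨κ, hκ⟩ := exists_boundaryHol_horizontal U a v
    have hsub : ∀ i, subHol U r i = κ * (boundaryWord U (pt N a v) i 1).prod * κ⁻¹ := by
      intro i
      rcases Nat.eq_zero_or_pos i with rfl | hi
      · have : (boundaryWord U (pt N a v) 0 1).prod = 1 := by
          rw [boundaryWord_prod]; simp [hprod, vprod]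
        simp [subHol, this]
      · rw [← hκ i hi]
        simp [subHol, hi.ne', r]
    have hinc : ∀ i, (subHol U r i)⁻¹ * subHol U r (i + 1)
        = κ * (U 1 (pt N a v) * hprod U a (v + 1) i) *
        ((U 1 (pt N (a + i) v))⁻¹ * U 0 (pt N (a + i) v) * U 1 (pt N (a + i + 1) v) *
          (U 0 (pt N (a + i) (v + 1)))⁻¹) * (κ * (U 1 (pt N a v) * hprod U a (v + 1) i))⁻¹ := by
      intro i
      have := boundaryWord_increment_horizontal U a v i
      rw [hsub, hsub]
      calc _ = κ * (((boundaryWord U (pt N a v) i 1).prod)⁻¹ *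
            (boundaryWord U (pt N a v) (i + 1) 1).prod) * κ⁻¹ := by group
        _ = _ := by rw [this]; group
    have hτ : ∀ i : ℕ, ((List.range i).map fun j : ℕ =>
        (lieExp (A 0 (pt N (a + (j : ℕ)) (v + 1))) : G)).prod
        = g (pt N a (v + 1)) * hprod U a (v + 1) i * (g (pt N (a + i) (v + 1)))⁻¹ := by
      intro i
      rw [← transform_hprod, hprod]
      simp only [hexp]
    have hlin : lineSum A 0 a v k - lineSum A 0 a (v + 1) k
        = ∑ i ∈ Finset.range k, (A 0 (pt N (a + (i : ℕ)) v) - A 0 (pt N (a + (i : ℕ)) (v + 1))) := by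
      rw [Finset.sum_sub_distrib]; rfl
    rw [hlin]
    have hvl := variationLE_qVar hq k (antiDev log U r)
    have hqV : qVar q k (antiDev log U r) ≤ V := by
      have := hvar r (by simp [r])
      simpa [r] using this
    refine hlad N k θ η V _ _ (fun i => A 1 (pt N (a + (i : ℕ)) v))
      (g (pt N a (v + 1)) * (U 1 (pt N a v))⁻¹ * κ⁻¹)
      (fun i => (subHol U r i)⁻¹ * subHol U r (i + 1)) hk.le hη hV hθ
      (fun _ _ => hA _ _) (fun _ _ => hA _ _) (fun _ _ => hA _ _) ?_ ?_ ?_ ?_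
    · intro i _
      obtain ⟨κ', hκ'⟩ := exists_boundaryHol_horizontal U (a + i) v
      have h1 := hκ' 1 le_rfl
      rw [boundaryWord_one_one] at h1
      have h2 := hplaq (pt N (a + i) v)
      rw [plaqHol] at h2
      have h3 : (subHol U r i)⁻¹ * subHol U r (i + 1)
          = (κ * (U 1 (pt N a v) * hprod U a (v + 1) i) * (U 1 (pt N (a + i) v))⁻¹ * κ'⁻¹) *
            boundaryHol U (pt N (a + i) v) 1 1 *
            (κ * (U 1 (pt N a v) * hprod U a (v + 1) i) * (U 1 (pt N (a + i) v))⁻¹ * κ'⁻¹)⁻¹ := by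
        rw [hinc, h1]; group
      rw [h3, h.norm_log_conj h2]
      exact h2
    · intro i _
      rw [hτ, hinc]
      simp only [hexp, GaugeField.transform, pt_add_step_zero, pt_add_step_one]
      push_cast
      rw [← add_assoc]
      group
    · intro n t ht htn
      exact (hvl.2 n t ht htn).trans (Real.rpow_le_rpow hvl.1 hqV (by linarith))
    · intro s n hsn
      have := hhol 0 (a + s) (v + 1) n (by omega)
      simpa [lineSum, linePt, add_assoc] using this
  · -- the tail of the lassos runs along the left side
    simp only [Fin.mk_one]
    rcases hk1.eq_or_lt with rfl | hk2
    · have h1 := norm_sub_le (lineSum A 1 a v 1) (lineSum A 1 a (v + 1) 1)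
      simp only [lineSum, Finset.sum_range_one] at h1 ⊢
      have h2 := hA 1 (linePt N 1 (a + (0 : ℕ)) v)
      have h3 := hA 1 (linePt N 1 (a + (0 : ℕ)) (v + 1))
      have : 0 ≤ V * (1 + D * (η * 2 ^ (N * b))) := by positivity
      have : 0 ≤ ((1 : ℕ) : ℝ) * (44 * C * θ ^ 2) := by positivity
      linarith
    let r : Rect N := ⟨pt N v a, 1, k, le_rfl, hN1, hk1, hk, Or.inl rfl⟩
    obtain ⟨κ, hκ⟩ := exists_boundaryHol_vertical U v a
    have hsub : ∀ i, subHol U r i = κ * (boundaryWord U (pt N v a) 1 i).prod * κ⁻¹ := by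
      intro i
      rcases Nat.eq_zero_or_pos i with rfl | hi
      · have : (boundaryWord U (pt N v a) 1 0).prod = 1 := by
          rw [boundaryWord_prod]; simp [hprod, vprod]
        simp [subHol, this]
      · rw [← hκ i hi]
        simp [subHol, hi.ne', r, hk2.ne']
    have hinc : ∀ i, (subHol U r i)⁻¹ * subHol U r (i + 1)
        = κ * vprod U v a i *
        (U 0 (pt N v (a + i)) * U 1 (pt N (v + 1) (a + i)) * (U 0 (pt N v (a + i + 1)))⁻¹ *
          (U 1 (pt N v (a + i)))⁻¹) * (κ * vprod U v a i)⁻¹ := by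
      intro i
      have := boundaryWord_increment_vertical U v a i
      rw [hsub, hsub]
      calc _ = κ * (((boundaryWord U (pt N v a) 1 i).prod)⁻¹ *
            (boundaryWord U (pt N v a) 1 (i + 1)).prod) * κ⁻¹ := by group
        _ = _ := by rw [this]; group
    have hτ : ∀ i : ℕ, ((List.range i).map fun j : ℕ =>
        (lieExp (A 1 (pt N v (a + (j : ℕ)))) : G)).prod
        = g (pt N v a) * vprod U v a i * (g (pt N v (a + i)))⁻¹ := by
      intro i
      rw [← transform_vprod, vprod]
      simp only [hexp]
    have hlin : ‖lineSum A 1 a v k - lineSum A 1 a (v + 1) k‖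
        = ‖∑ i ∈ Finset.range k, (A 1 (pt N (v + 1) (a + (i : ℕ))) - A 1 (pt N v (a + (i : ℕ))))‖ := by
      rw [Finset.sum_sub_distrib, norm_sub_rev]; rfl
    rw [hlin]
    have hvl := variationLE_qVar hq k (antiDev log U r)
    have hqV : qVar q k (antiDev log U r) ≤ V := by
      have := hvar r (by simp [r])
      simpa [r] using this
    refine hlad N k θ η V _ _ (fun i => -A 0 (pt N v (a + (i : ℕ))))
      (g (pt N v a) * κ⁻¹)
      (fun i => (subHol U r i)⁻¹ * subHol U r (i + 1)) hk.le hη hV hθ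
      (fun _ _ => hA _ _) (fun _ _ => hA _ _) (fun _ _ => by rw [norm_neg]; exact hA _ _) ?_ ?_ ?_ ?_
    · intro i _
      obtain ⟨κ', hκ'⟩ := exists_boundaryHol_vertical U v (a + i)
      have h1 := hκ' 1 le_rfl
      rw [boundaryWord_one_one] at h1
      have h2 := hplaq (pt N v (a + i))
      rw [plaqHol] at h2
      have h3 : (subHol U r i)⁻¹ * subHol U r (i + 1)
          = (κ * vprod U v a i * κ'⁻¹) *
            boundaryHol U (pt N v (a + i)) 1 1 * (κ * vprod U v a i * κ'⁻¹)⁻¹ := by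
        rw [hinc, h1]; group
      rw [h3, h.norm_log_conj h2]
      exact h2
    · intro i _
      rw [hτ, hinc]
      simp only [h.exp_neg, inv_inv, hexp, GaugeField.transform, pt_add_step_zero, pt_add_step_one]
      push_cast
      rw [← add_assoc]
      group
    · intro n t ht htn
      exact (hvl.2 n t ht htn).trans (Real.rpow_le_rpow hvl.1 hqV (by linarith))
    · intro s n hsn
      have := hhol 1 (a + s) v n (by omega)
      simpa [lineSum, linePt, add_assoc] using this

end Strips

/-! ### Decay of the bonds over the levels -/

section BondBounds

/-- A plaquette is a rectangle with a single increment of the anti-development. -/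
theorem norm_log_plaqHol_le {E G : Type*} [NormedAddCommGroup E] [Group G] {log : G → E}
    {q α Cbar : ℝ} (hq : 1 ≤ q) {N : ℕ} (hN : 1 ≤ N) {U : GaugeField G N}
    (hvar : ∀ r : Rect N, qVar q (r.w * r.h) (antiDev log U r) ≤ Cbar * r.area ^ (α / 2))
    (x : Site N) : ‖log (plaqHol U x)‖ ≤ Cbar * ((2 : ℝ) ^ (-α)) ^ N := by
  have hN1 : 1 < 2 ^ N := Nat.one_lt_two_pow (by omega)
  let r : Rect N := ⟨x, 1, 1, le_rfl, hN1, le_rfl, hN1, Or.inl rfl⟩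
  have h1 := (variationLE_qVar hq (r.w * r.h) (antiDev log U r))
  have h2 := h1.2.norm_sub_le hq h1.1 (Nat.zero_le 1) (by simp [r])
  have h3 := h2.trans (hvar r)
  have h4 : antiDev log U r 1 - antiDev log U r 0 = log (plaqHol U x) := by
    simp [antiDev, subHol, r, plaqHol]
  have h5 : r.area ^ (α / 2) = ((2 : ℝ) ^ (-α)) ^ N := by
    simp only [Rect.area, r, Nat.cast_one, mul_one, one_div]
    rw [← Real.rpow_natCast, ← Real.rpow_natCast, ← Real.rpow_natCast, ← Real.rpow_mul two_pos.le,
      ← Real.rpow_neg two_pos.le, ← Real.rpow_mul two_pos.le, ← Real.rpow_mul two_pos.le]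
    congr 1
    push_cast
    ring
  rwa [h4, h5] at h3

variable {E : Type*} [NormedAddCommGroup E] [InnerProductSpace ℝ E]
  {G : Type*} [TopologicalSpace G] [ChartedSpace E G] [Group G]
  {log : G → E} {ε C : ℝ} {L : E →L[ℝ] (E →L[ℝ] E)}

/-- Bound for the bonds of one level by those of the previous level and by the plaquettes. Two bounds
`θ` and `θ'` for the previous level are allowed, for the linear and for the quadratic terms. -/
theorem LocalCalculus.norm_next_level_le (h : LocalCalculus log ε C L) {K : ℝ} (hK : 0 ≤ K)
    {N₀ N₁ : ℕ} {U : GaugeField G N₁} {A : OneForm E N₁} {g : Site N₁ → G}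
    (hL : IsBinaryLandau log K N₀ U A g) {M : ℕ} (hM : N₀ ≤ M) (hM' : M < N₁) {θ θ' u : ℝ}
    (hθ : ∀ μ x, ‖A.restr M μ x‖ ≤ θ) (hθ' : ∀ μ x, ‖A.restr M μ x‖ ≤ θ')
    (hu : ∀ x, ‖log (plaqHol (U.restr (M + 1)) x)‖ ≤ u) (huε : u < ε) (μ : Fin 2)
    (x : Site (M + 1)) :
    ‖A.restr (M + 1) μ x‖ ≤ θ / 2 + u + K * (4 * u + 2 * θ') ^ 2 := by
  have hu0 : 0 ≤ u := (norm_nonneg _).trans (hu x)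
  have hθ0 : 0 ≤ θ' := (norm_nonneg _).trans (hθ' 0 0)
  have hθ0' : 0 ≤ θ := (norm_nonneg _).trans (hθ 0 0)
  have hrest : 0 ≤ K * (4 * u + 2 * θ') ^ 2 := by positivity
  set B := A.restr (M + 1) with hB
  set V := (U.restr (M + 1)).transform (fun x => g (incl x)) with hV
  have hhalf : ∀ (t : ℝ), (∀ μ x, ‖A.restr M μ x‖ ≤ t) → (∀ a b : ℤ,
      ‖B 0 (pt (M + 1) a (2 * b))‖ ≤ t / 2 ∧ ‖B 1 (pt (M + 1) (2 * b) a)‖ ≤ t / 2) := by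
    intro t ht a b
    have hs : ∀ μ y, ‖(1 / 2 : ℝ) • A.restr M μ y‖ ≤ t / 2 := fun μ y => by
      rw [norm_smul, Real.norm_of_nonneg (by norm_num)]
      linarith [ht μ y]
    rcases Int.even_or_odd' a with ⟨a, rfl | rfl⟩
    · have h0 := (hL.halving M hM hM' 0 (pt M a b)).1
      have h1 := (hL.halving M hM hM' 1 (pt M b a)).1
      rw [incl_pt_succ, ← hB] at h0 h1
      rw [h0, h1]
      exact ⟨hs _ _, hs _ _⟩
    · have h0 := (hL.halving M hM hM' 0 (pt M a b)).2
      have h1 := (hL.halving M hM hM' 1 (pt M b a)).2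
      rw [incl_pt_succ, pt_add_step_zero, ← hB] at h0
      rw [incl_pt_succ, pt_add_step_one, ← hB] at h1
      rw [h0, h1]
      exact ⟨hs _ _, hs _ _⟩
  have ha : ∀ a b : ℤ, ‖log (plaqHol V (pt (M + 1) a b))‖ ≤ u := by
    intro a b
    rw [hV, plaqHol_transform, h.norm_log_conj (lt_of_le_of_lt (hu _) huε)]
    exact hu _
  have hint : ∀ a b : ℤ, ‖B 0 (pt (M + 1) (2 * a + 1) (2 * b + 1))‖ ≤
        θ / 2 + u + K * (4 * u + 2 * θ') ^ 2 ∧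
      ‖B 1 (pt (M + 1) (2 * a + 1) (2 * b + 1))‖ ≤ θ / 2 + u + K * (4 * u + 2 * θ') ^ 2 ∧
      ‖B 0 (pt (M + 1) (2 * a) (2 * b + 1))‖ ≤ θ / 2 + u + K * (4 * u + 2 * θ') ^ 2 ∧
      ‖B 1 (pt (M + 1) (2 * a + 1) (2 * b))‖ ≤ θ / 2 + u + K * (4 * u + 2 * θ') ^ 2 := by
    intro a b
    have hI := hL.interior M hM hM' (pt M a b)
    simp only [InteriorRule, incl_pt_succ, pt_add_step_zero, pt_add_step_one, pt_sub_step_zero,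
      pt_sub_step_one, add_sub_cancel_right, show 2 * b + 1 + 1 = 2 * (b + 1) by ring,
      show 2 * a + 1 + 1 = 2 * (a + 1) by ring] at hI
    rw [← hB, ← hV] at hI
    obtain ⟨i0, i1, i2, i3⟩ := hI
    have hδ : K * (‖log (plaqHol (U.restr (M + 1)) (pt (M + 1) (2 * a + 1) (2 * b + 1)))‖
        + ‖log (plaqHol (U.restr (M + 1)) (pt (M + 1) (2 * a) (2 * b + 1)))‖
        + ‖log (plaqHol (U.restr (M + 1)) (pt (M + 1) (2 * a) (2 * b)))‖
        + ‖log (plaqHol (U.restr (M + 1)) (pt (M + 1) (2 * a + 1) (2 * b)))‖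
        + (‖B 0 (pt (M + 1) (2 * a + 1) (2 * (b + 1)))‖ + ‖B 0 (pt (M + 1) (2 * a + 1) (2 * b))‖
          + ‖B 1 (pt (M + 1) (2 * (a + 1)) (2 * b + 1))‖ + ‖B 1 (pt (M + 1) (2 * a) (2 * b + 1))‖)) ^ 2
        ≤ K * (4 * u + 2 * θ') ^ 2 := by
      refine mul_le_mul_of_nonneg_left (pow_le_pow_left₀ (by positivity) ?_ 2) hK
      have := hu (pt (M + 1) (2 * a + 1) (2 * b + 1))
      have := hu (pt (M + 1) (2 * a) (2 * b + 1))
      have := hu (pt (M + 1) (2 * a) (2 * b))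
      have := hu (pt (M + 1) (2 * a + 1) (2 * b))
      have := (hhalf θ' hθ' (2 * a + 1) (b + 1)).1
      have := (hhalf θ' hθ' (2 * a + 1) b).1
      have := (hhalf θ' hθ' (2 * b + 1) (a + 1)).2
      have := (hhalf θ' hθ' (2 * b + 1) a).2
      linarith
    have main : ∀ X Y a b c d : E, ‖X‖ ≤ θ / 2 → ‖Y‖ ≤ θ / 2 → ‖a‖ ≤ u → ‖b‖ ≤ u → ‖c‖ ≤ u →
        ‖d‖ ≤ u → ‖(1 / 2 : ℝ) • (X + Y) + (3 / 8 : ℝ) • (a - b) + (1 / 8 : ℝ) • (c - d)‖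
          ≤ θ / 2 + u := by
      intro X Y a b c d hX hY ha hb hc hd
      have e2 := norm_add₃_le (a := (1 / 2 : ℝ) • (X + Y)) (b := (3 / 8 : ℝ) • (a - b))
        (c := (1 / 8 : ℝ) • (c - d))
      rw [norm_smul, norm_smul, norm_smul, Real.norm_of_nonneg (by norm_num),
        Real.norm_of_nonneg (by norm_num), Real.norm_of_nonneg (by norm_num)] at e2
      have := norm_add_le X Y
      have := norm_sub_le a b
      have := norm_sub_le c d
      linarith
    have t1 := (hhalf θ hθ (2 * a + 1) (b + 1)).1
    have t2 := (hhalf θ hθ (2 * a + 1) b).1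
    have t3 := (hhalf θ hθ (2 * b + 1) (a + 1)).2
    have t4 := (hhalf θ hθ (2 * b + 1) a).2
    refine ⟨?_, ?_, ?_, ?_⟩
    · rw [i0]
      have := main _ _ _ _ _ _ t1 t2 (ha (2 * a + 1) (2 * b + 1)) (ha (2 * a + 1) (2 * b))
        (ha (2 * a) (2 * b + 1)) (ha (2 * a) (2 * b))
      linarith
    · have e1 := norm_le_norm_add_norm_sub' (B 1 (pt (M + 1) (2 * a + 1) (2 * b + 1))) _ |>.trans
        (add_le_add (main _ _ _ _ _ _ t3 t4 (ha (2 * a) (2 * b + 1)) (ha (2 * a + 1) (2 * b + 1))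
        (ha (2 * a) (2 * b)) (ha (2 * a + 1) (2 * b))) (i1.trans hδ))
      linarith
    · have e1 := norm_le_norm_add_norm_sub' (B 0 (pt (M + 1) (2 * a) (2 * b + 1))) _ |>.trans
        (add_le_add (main _ _ _ _ _ _ t1 t2 (ha (2 * a) (2 * b + 1)) (ha (2 * a) (2 * b))
        (ha (2 * a + 1) (2 * b + 1)) (ha (2 * a + 1) (2 * b))) (i2.trans hδ))
      linarith
    · have e1 := norm_le_norm_add_norm_sub' (B 1 (pt (M + 1) (2 * a + 1) (2 * b))) _ |>.trans
        (add_le_add (main _ _ _ _ _ _ t3 t4 (ha (2 * a) (2 * b)) (ha (2 * a + 1) (2 * b))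
        (ha (2 * a) (2 * b + 1)) (ha (2 * a + 1) (2 * b + 1))) (i3.trans hδ))
      linarith
  obtain ⟨a, b, rfl⟩ := exists_pt x
  fin_cases μ
  · rcases Int.even_or_odd' b with ⟨b, rfl | rfl⟩
    · have := (hhalf θ hθ a b).1
      simp only [Fin.zero_eta]
      linarith
    · rcases Int.even_or_odd' a with ⟨a, rfl | rfl⟩
      · exact (hint a b).2.2.1
      · exact (hint a b).1
  · rcases Int.even_or_odd' a with ⟨a, rfl | rfl⟩
    · have := (hhalf θ hθ b a).2
      simp only [Fin.mk_one]
      linarith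
    · rcases Int.even_or_odd' b with ⟨b, rfl | rfl⟩
      · exact (hint a b).2.2.2
      · exact (hint a b).2.1

/-- Geometric decay of the bonds over the levels. With `x = 2 ^ (-α)`, a bootstrap from the crude
rate `16 / 25 > 2 ^ (-2 / 3)`, whose square is below `1 / 2 < x`, makes the quadratic terms
negligible; this gives a smallness threshold `c` that does not depend on `α`. -/
theorem LocalCalculus.norm_level_le (h : LocalCalculus log ε C L) {K : ℝ} (hK : 0 ≤ K) {c : ℝ}
    (hc : 0 < c) (hcε : c < ε) (hcK : 1000 * (K + 1) * c ≤ 1)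
    {N₀ N₁ : ℕ} {U : GaugeField G N₁} {A : OneForm E N₁} {g : Site N₁ → G}
    (hL : IsBinaryLandau log K N₀ U A g) {x : ℝ} (hx : 1 / 2 < x) (hx' : x ≤ 16 / 25)
    (h0 : ∀ μ y, ‖A.restr N₀ μ y‖ ≤ c)
    (hplaq : ∀ N, N₀ < N → N ≤ N₁ → ∀ y, ‖log (plaqHol (U.restr N) y)‖ ≤ c * x ^ (N - N₀)) (N : ℕ)
    (hN : N₀ ≤ N) : N ≤ N₁ → ∀ μ y, ‖A.restr N μ y‖ ≤ 20 * c * (16 / 25) ^ (N - N₀) ∧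
      ‖A.restr N μ y‖ ≤ 4 / (x - 1 / 2) * c * x ^ (N - N₀) := by
  have hx0 : 0 < x - 1 / 2 := by linarith
  have h8 : 4 ≤ 4 / (x - 1 / 2) := by
    rw [le_div_iff₀ hx0]; linarith
  induction N, hN using Nat.le_induction with
  | base =>
    intro _ μ y
    have := h0 μ y
    rw [Nat.sub_self, pow_zero, pow_zero, mul_one, mul_one]
    exact ⟨by linarith, by nlinarith⟩
  | succ M hM ih =>
    intro hM' μ y
    have ih' := ih (by omega)
    obtain ⟨n, rfl⟩ := Nat.exists_eq_add_of_le hM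
    have hn : N₀ + n + 1 - N₀ = n + 1 := by omega
    have hpl := hplaq (N₀ + n + 1) (by omega) hM'
    rw [hn] at hpl ⊢
    rw [Nat.add_sub_cancel_left] at ih'
    have hxn : x ^ n ≤ (16 / 25) ^ n := pow_le_pow_left₀ (by linarith) hx' n
    have hx1 : x ^ (n + 1) ≤ (16 / 25) ^ (n + 1) := pow_le_pow_left₀ (by linarith) hx' _
    have hle1 : ((16 : ℝ) / 25) ^ n ≤ 1 := pow_le_one₀ (by norm_num) (by norm_num)
    have hz0 : 0 < ((16 : ℝ) / 25) ^ n := by positivity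
    have hxn0 : 0 < x ^ n := by have : 0 < x := by linarith
                                positivity
    -- `(16 / 25) ^ 2 < 1 / 2 < x`: the square of the crude rate beats the optimal rate
    have hsq : (((16 : ℝ) / 25) ^ n) ^ 2 ≤ x ^ n := by
      rw [← pow_mul, mul_comm, pow_mul]
      exact pow_le_pow_left₀ (by norm_num) (by norm_num; linarith) n
    set z := ((16 : ℝ) / 25) ^ n with hz
    have hu : ∀ y, ‖log (plaqHol (U.restr (N₀ + n + 1)) y)‖ ≤ c * (x * x ^ n) := by
      intro y
      have := hpl y
      rwa [pow_succ'] at this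
    have hux : x * x ^ n ≤ 16 / 25 * z := mul_le_mul hx' hxn hxn0.le (by norm_num)
    have huc : c * (x * x ^ n) < ε := by nlinarith
    -- both rates use the crude bound for the quadratic term
    have hquad : K * (4 * (c * (x * x ^ n)) + 2 * (20 * c * z)) ^ 2 ≤ 2 * c * z ^ 2 := by
      have e1 : (4 * (c * (x * x ^ n)) + 2 * (20 * c * z)) ^ 2 ≤ (43 * (c * z)) ^ 2 := by
        refine pow_le_pow_left₀ (by positivity) ?_ 2
        nlinarith
      calc _ ≤ K * (43 * (c * z)) ^ 2 := mul_le_mul_of_nonneg_left e1 hK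
        _ = (K * c) * 1849 * (c * z ^ 2) := by ring
        _ ≤ (1 / 1000) * 1849 * (c * z ^ 2) := by
          have : K * c ≤ 1 / 1000 := by nlinarith
          gcongr
        _ ≤ 2 * c * z ^ 2 := by
          have : 0 ≤ c * z ^ 2 := by positivity
          linarith
    constructor
    · have e := h.norm_next_level_le hK hL hM (by omega) (fun μ y => (ih' μ y).1)
        (fun μ y => (ih' μ y).1) hu huc μ y
      refine e.trans ?_
      have e2 : c * z ^ 2 ≤ c * z := by
        refine mul_le_mul_of_nonneg_left ?_ hc.le
        nlinarith
      have e3 := mul_le_mul_of_nonneg_left hux hc.le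
      have e4 : 0 ≤ c * z := by positivity
      rw [pow_succ ((16 : ℝ) / 25) n, ← hz]
      linarith
    · have e := h.norm_next_level_le hK hL hM (by omega) (fun μ y => (ih' μ y).2)
        (fun μ y => (ih' μ y).1) hu huc μ y
      refine e.trans ?_
      have e2 : c * z ^ 2 ≤ c * x ^ n := mul_le_mul_of_nonneg_left hsq hc.le
      have e3 : c * (x * x ^ n) ≤ c * x ^ n := by
        refine mul_le_mul_of_nonneg_left ?_ hc.le
        nlinarith
      -- the constant `4 / (x - 1 / 2)` is chosen to make this an identity
      have e4 : 4 / (x - 1 / 2) * c * x ^ (n + 1)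
          = 4 / (x - 1 / 2) * c * x ^ n / 2 + 4 * (c * x ^ n) := by
        have e6 : 4 / (x - 1 / 2) * (x - 1 / 2) = 4 := div_mul_cancel₀ _ hx0.ne'
        rw [pow_succ]
        linear_combination (c * x ^ n) * e6
      rw [e4]
      have e5 : 0 ≤ c * x ^ n := by positivity
      linarith

end BondBounds

/-! ### Recursion over the levels and chaining -/

section Multiscale

/-- Midpoint concavity of the power function. -/
theorem rpow_add_rpow_le {b x y : ℝ} (hb : 0 ≤ b) (hb' : b ≤ 1) (hx : 0 ≤ x) (hy : 0 ≤ y) :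
    (1 / 2 : ℝ) * (x ^ b + y ^ b) ≤ ((x + y) / 2) ^ b := by
  have h := (Real.concaveOn_rpow hb hb').2 (Set.mem_Ici.2 hx) (Set.mem_Ici.2 hy)
    (by norm_num : (0 : ℝ) ≤ 1 / 2) (by norm_num : (0 : ℝ) ≤ 1 / 2) (by norm_num)
  simp only [smul_eq_mul] at h
  rw [add_div, div_eq_inv_mul x, div_eq_inv_mul y, mul_add, ← one_div]
  exact h

/-- Pairing consecutive integers: among `n` consecutive integers, the halves rounded down form two runs
of consecutive integers, one from the even and one from the odd positions. -/
theorem sum_floor_half {E : Type*} [AddCommMonoid E] (f : ℤ → E) (a : ℤ) (n : ℕ) :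
    ∑ j ∈ Finset.range n, f ((a + (j : ℕ)) / 2)
      = ∑ j ∈ Finset.range ((n + 1) / 2), f (a / 2 + (j : ℕ))
        + ∑ j ∈ Finset.range (n / 2), f ((a + 1) / 2 + (j : ℕ)) := by
  induction n with
  | zero => simp
  | succ n ih =>
    rw [Finset.sum_range_succ, ih]
    rcases Nat.even_or_odd' n with ⟨k, rfl | rfl⟩
    · rw [show (2 * k + 1) / 2 = k by omega, show (2 * k + 1 + 1) / 2 = k + 1 by omega,
        show 2 * k / 2 = k by omega, Finset.sum_range_succ _ k,
        show (a + (2 * k : ℕ)) / 2 = a / 2 + k by push_cast; omega]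
      abel
    · rw [show (2 * k + 1 + 1) / 2 = k + 1 by omega, show (2 * k + 1 + 1 + 1) / 2 = k + 1 by omega,
        show (2 * k + 1) / 2 = k by omega,
        Finset.sum_range_succ (fun j : ℕ => f ((a + 1) / 2 + j)) k,
        show (a + (2 * k + 1 : ℕ)) / 2 = (a + 1) / 2 + k by push_cast; omega]
      abel

/-- A sequence that grows by at most a geometrically decaying multiple of `1 + H (N + 1)` per step is
bounded. Since `H (N + 1)` occurs on the right as well, the small `N` are covered by an a priori
bound; from then on `1 + H N ≤ B (1 - κ y ^ N)` with `κ = (κ + C) y` is preserved. -/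
theorem exists_bound_of_recursion {C T y : ℝ} (hC : 0 ≤ C) (hT : 0 ≤ T) (hy : 0 < y) (hy' : y < 1)
    (N₀ : ℕ) : ∃ B : ℝ, 0 ≤ B ∧ ∀ (N₁ : ℕ) (H : ℕ → ℝ),
      (∀ N, N₀ ≤ N → N ≤ N₁ → 0 ≤ H N ∧ H N ≤ T * 2 ^ N) →
      (∀ N, N₀ ≤ N → N < N₁ → H (N + 1) ≤ H N + C * (1 + H (N + 1)) * y ^ (N + 1)) →
      ∀ N, N₀ ≤ N → N ≤ N₁ → H N ≤ B := by
  have h1y : 0 < 1 - y := by linarith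
  set κ := C * y / (1 - y) with hκ
  have hκ0 : 0 ≤ κ := by positivity
  have hκe : κ = (κ + C) * y := by
    have : κ * (1 - y) = C * y := div_mul_cancel₀ _ h1y.ne'
    linear_combination this
  obtain ⟨n, hn⟩ := exists_pow_lt_of_lt_one (by positivity : 0 < 1 / (2 * (κ + C + 1))) hy'
  have hsmall : ∀ N, n ≤ N → (κ + C) * y ^ N ≤ 1 / 2 := by
    intro N hN
    have h1 : y ^ N ≤ y ^ n := pow_le_pow_of_le_one hy.le hy'.le hN
    have h2 : (κ + C + 1) * y ^ N ≤ (κ + C + 1) * (1 / (2 * (κ + C + 1))) :=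
      mul_le_mul_of_nonneg_left (h1.trans hn.le) (by positivity)
    have h3 : (κ + C + 1) * (1 / (2 * (κ + C + 1))) = 1 / 2 := by field_simp
    have h4 : 0 ≤ y ^ N := by positivity
    nlinarith
  set m := n + N₀ with hm
  refine ⟨2 * (1 + T * 2 ^ m), by positivity, fun N₁ H hH hrec N hN hN' => ?_⟩
  have hT0 : 0 ≤ T * (2 : ℝ) ^ m := by positivity
  rcases le_or_gt N m with hle | hgt
  · have h1 := (hH N hN hN').2
    have h2 : T * (2 : ℝ) ^ N ≤ T * 2 ^ m :=
      mul_le_mul_of_nonneg_left (pow_le_pow_right₀ one_le_two hle) hT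
    linarith
  · have main : ∀ N, m ≤ N → N ≤ N₁ → 1 + H N ≤ 2 * (1 + T * 2 ^ m) * (1 - κ * y ^ N) := by
      intro N hN
      induction N, hN using Nat.le_induction with
      | base =>
        intro hN'
        have h1 := (hH m (by omega) hN').2
        have h2 := hsmall m (by omega)
        have h3 : 0 ≤ C * y ^ m := by positivity
        nlinarith
      | succ N hN ih =>
        intro hN'
        have h1 := ih (by omega)
        have h2 := hrec N (by omega) (by omega)
        have h3 := hsmall (N + 1) (by omega)
        have h4 : κ * y ^ N = (κ + C) * y ^ (N + 1) := by
          rw [pow_succ']; linear_combination y ^ N * hκe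
        set s := C * y ^ (N + 1) with hs
        set p := κ * y ^ (N + 1) with hp
        have hs0 : 0 ≤ s := by positivity
        have hp0 : 0 ≤ p := by positivity
        have h5 : κ * y ^ N = p + s := by rw [h4, hp, hs]; ring
        have h6 : p + s ≤ 1 / 2 := by rw [hp, hs, ← add_mul]; exact h3
        have h7 : (1 + H (N + 1)) * (1 - s) ≤ 1 + H N := by
          rw [hs]; linarith
        rw [h5] at h1
        have h8 : 2 * (1 + T * 2 ^ m) * (1 - (p + s))
            ≤ (2 * (1 + T * 2 ^ m) * (1 - p)) * (1 - s) := by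
          have : 0 ≤ 2 * (1 + T * 2 ^ m) * (p * s) := by positivity
          linarith
        exact le_of_mul_le_mul_right (h7.trans (h1.trans h8)) (by linarith)
    have h1 := main N hgt.le hN'
    have h2 : 0 ≤ 2 * (1 + T * 2 ^ m) * (κ * y ^ N) := by positivity
    linarith

/-- Dyadic chaining for a function on the integers whose increments over the steps `2 ^ m` of the
lattice `2 ^ m ℤ` are controlled, for all `m` up to `N - N₀`. -/
theorem chaining {E : Type*} [NormedAddCommGroup E] {γ W W' : ℝ} (hγ : 0 < γ) (hW : 0 ≤ W)
    (hW' : 0 ≤ W') {N₀ N : ℕ} (f : ℤ → E)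
    (hf : ∀ m, m + N₀ ≤ N → ∀ i : ℤ,
      ‖f (2 ^ m * (i + 1)) - f (2 ^ m * i)‖ ≤ W * ((2 : ℝ) ^ (-γ)) ^ (N - m))
    (hf' : ∀ i, ‖f i‖ ≤ W') (u : ℤ) (t : ℕ) (ht : 1 ≤ t) :
    ‖f (u + t) - f u‖ ≤ (W * (2 * ((2 : ℝ) ^ (-γ) / (1 - 2 ^ (-γ))) + 2)
      + 2 * W' * (2 ^ N₀) ^ γ) * ((t : ℝ) / 2 ^ N) ^ γ := by
  set ρ : ℝ := (2 : ℝ) ^ (-γ) with hρ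
  have hρ0 : 0 < ρ := by positivity
  have hρ1 : ρ < 1 := Real.rpow_lt_one_of_one_lt_of_neg one_lt_two (by linarith)
  have h1ρ : 0 < 1 - ρ := by linarith
  set κ := ρ / (1 - ρ) with hκ
  have hκ0 : 0 ≤ κ := by positivity
  have hκe : (κ + 1) * ρ = κ := by
    have : κ * (1 - ρ) = ρ := div_mul_cancel₀ _ h1ρ.ne'
    linear_combination -this
  -- rounding down to `2 ^ m ℤ`, one binary digit at a time
  have floor : ∀ m, m + N₀ ≤ N → ∀ u : ℤ, ‖f u - f (2 ^ m * (u / 2 ^ m))‖ ≤ W * κ * ρ ^ (N - m) := by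
    intro m
    induction m with
    | zero =>
      intro _ u
      simp only [pow_zero, Int.ediv_one, one_mul, sub_self, norm_zero]
      positivity
    | succ m ih =>
      intro hm u
      have h1 := ih (by omega) u
      set w := u / 2 ^ m with hw
      have h2 : u / 2 ^ (m + 1) = w / 2 := by
        rw [pow_succ, ← Int.ediv_ediv_of_nonneg (by positivity)]
      have h3 : ‖f (2 ^ m * w) - f (2 ^ (m + 1) * (w / 2))‖ ≤ W * ρ ^ (N - m) := by
        rw [show (2 : ℤ) ^ (m + 1) * (w / 2) = 2 ^ m * (2 * (w / 2)) by rw [pow_succ]; ring]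
        rcases Int.even_or_odd' w with ⟨k, hk | hk⟩
        · rw [show 2 * (w / 2) = w by omega, sub_self, norm_zero]
          positivity
        · have := hf m (by omega) (2 * (w / 2))
          rwa [show 2 * (w / 2) + 1 = w by omega] at this
      rw [h2]
      have h4 : ρ ^ (N - m) = ρ * ρ ^ (N - (m + 1)) := by
        rw [← pow_succ']; congr 1; omega
      have h5 := (norm_sub_le_norm_sub_add_norm_sub (f u) (f (2 ^ m * w))
        (f (2 ^ (m + 1) * (w / 2)))).trans (add_le_add h1 h3)
      refine h5.trans (le_of_eq ?_)
      rw [h4]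
      linear_combination (W * ρ ^ (N - (m + 1))) * hκe
  have ht0 : (0 : ℝ) < t := by exact_mod_cast ht
  have hx0 : 0 ≤ ((t : ℝ) / 2 ^ N) ^ γ := by positivity
  rcases le_or_gt (Nat.log 2 t + N₀) N with hle | hgt
  · set m := Nat.log 2 t with hm
    have h1 : 2 ^ m ≤ t := Nat.pow_log_le_self 2 (by omega)
    have h2 : t < 2 ^ (m + 1) := Nat.lt_pow_succ_log_self one_lt_two t
    have hpow : ρ ^ (N - m) ≤ ((t : ℝ) / 2 ^ N) ^ γ := by
      have e1 : ρ ^ (N - m) = ((2 : ℝ) ^ m / 2 ^ N) ^ γ := by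
        have e2 : (2 : ℝ) ^ m / 2 ^ N = ((2 : ℝ) ^ (N - m))⁻¹ := by
          have : (2 : ℝ) ^ N = 2 ^ (N - m) * 2 ^ m := by rw [← pow_add]; congr 1; omega
          rw [this]; field_simp
        rw [e2, hρ, ← Real.rpow_natCast, ← Real.rpow_natCast, ← Real.rpow_mul two_pos.le,
          ← Real.rpow_neg two_pos.le, ← Real.rpow_mul two_pos.le]
        congr 1; ring
      rw [e1]
      refine Real.rpow_le_rpow (by positivity) ?_ hγ.le
      gcongr
      exact_mod_cast h1
    obtain ⟨d, hd, hd2⟩ : ∃ d : ℕ, (u + t) / 2 ^ m = u / 2 ^ m + d ∧ d ≤ 2 := by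
      have hp : (0 : ℤ) < 2 ^ m := by positivity
      have a1 := Int.mul_ediv_add_emod u (2 ^ m)
      have a2 := Int.emod_nonneg u hp.ne'
      have a3 := Int.emod_lt_of_pos u hp
      have b1 := Int.mul_ediv_add_emod (u + t) (2 ^ m)
      have b2 := Int.emod_nonneg (u + t) hp.ne'
      have b3 := Int.emod_lt_of_pos (u + t) hp
      have ht2 : (t : ℤ) < 2 * 2 ^ m := by
        have : (t : ℤ) < 2 ^ (m + 1) := by exact_mod_cast h2
        rwa [pow_succ'] at this
      have c1 : u / 2 ^ m ≤ (u + t) / 2 ^ m := Int.ediv_le_ediv hp (by omega)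
      have c2 : (u + t) / 2 ^ m < u / 2 ^ m + 3 := by
        by_contra hcon
        push Not at hcon
        nlinarith
      exact ⟨((u + t) / 2 ^ m - u / 2 ^ m).toNat, by omega, by omega⟩
    have steps : ∀ d : ℕ, ∀ w : ℤ, ‖f (2 ^ m * (w + d)) - f (2 ^ m * w)‖ ≤ d * (W * ρ ^ (N - m)) := by
      intro d w
      induction d with
      | zero => simp
      | succ d ih =>
        have e1 := hf m hle (w + d)
        have e2 := (norm_sub_le_norm_sub_add_norm_sub (f (2 ^ m * (w + d + 1)))
          (f (2 ^ m * (w + d))) (f (2 ^ m * w))).trans (add_le_add e1 ih)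
        push_cast
        rw [← add_assoc]
        linarith
    have e1 := floor m hle (u + t)
    have e2 := floor m hle u
    have e3 := steps d (u / 2 ^ m)
    rw [← hd] at e3
    have e4 : (d : ℝ) * (W * ρ ^ (N - m)) ≤ 2 * (W * ρ ^ (N - m)) :=
      mul_le_mul_of_nonneg_right (by exact_mod_cast hd2) (by positivity)
    have e5 : f (u + t) - f u = (f (u + t) - f (2 ^ m * ((u + t) / 2 ^ m)))
        + (f (2 ^ m * ((u + t) / 2 ^ m)) - f (2 ^ m * (u / 2 ^ m)))
        - (f u - f (2 ^ m * (u / 2 ^ m))) := by abel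
    rw [e5]
    have e6 := norm_sub_le ((f (u + t) - f (2 ^ m * ((u + t) / 2 ^ m)))
        + (f (2 ^ m * ((u + t) / 2 ^ m)) - f (2 ^ m * (u / 2 ^ m)))) (f u - f (2 ^ m * (u / 2 ^ m)))
    have e7 := norm_add_le (f (u + t) - f (2 ^ m * ((u + t) / 2 ^ m)))
      (f (2 ^ m * ((u + t) / 2 ^ m)) - f (2 ^ m * (u / 2 ^ m)))
    have e8 : W * (2 * κ + 2) * ρ ^ (N - m) ≤ W * (2 * κ + 2) * ((t : ℝ) / 2 ^ N) ^ γ :=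
      mul_le_mul_of_nonneg_left hpow (by positivity)
    have e9 : 0 ≤ 2 * W' * (2 ^ N₀) ^ γ * ((t : ℝ) / 2 ^ N) ^ γ := by positivity
    linarith
  · -- the distance is macroscopic
    have h1 : 2 ^ Nat.log 2 t ≤ t := Nat.pow_log_le_self 2 (by omega)
    have h2 : (2 : ℝ) ^ N ≤ 2 ^ N₀ * t := by
      have : (2 : ℝ) ^ N ≤ 2 ^ (Nat.log 2 t + N₀) := pow_le_pow_right₀ one_le_two (by omega)
      rw [pow_add] at this
      have h3 : (2 : ℝ) ^ Nat.log 2 t ≤ t := by exact_mod_cast h1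
      have : (2 : ℝ) ^ Nat.log 2 t * 2 ^ N₀ ≤ t * 2 ^ N₀ := by gcongr
      linarith
    have h3 : 1 ≤ ((2 : ℝ) ^ N₀) ^ γ * ((t : ℝ) / 2 ^ N) ^ γ := by
      rw [← Real.mul_rpow (by positivity) (by positivity)]
      refine Real.one_le_rpow ?_ hγ.le
      rw [mul_div_assoc', le_div_iff₀ (by positivity)]
      linarith
    have h4 := norm_sub_le (f (u + t)) (f u)
    have h5 := hf' (u + t)
    have h6 := hf' u
    have h7 : 0 ≤ W * (2 * κ + 2) * ((t : ℝ) / 2 ^ N) ^ γ := by positivity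
    have h8 := mul_le_mul_of_nonneg_left h3 (by positivity : 0 ≤ 2 * W')
    linarith

end Multiscale

/-! ### Uniform Hölder bounds -/

section HolderBounds

/-- Sums `S N μ a v n` over `n` consecutive bonds of length `2 ^ (-N)` in direction `μ`, starting at
the position `a` on the line with transverse coordinate `v`, obey a uniform Hölder bound in the
length and in the transverse coordinate as soon as they are averages of sums of the previous level
on the even lines (`hhalf`), and sums over neighbouring segments differ by a fractional power of the
enclosed area, times the Hölder constant of the level (`hladder`). -/
theorem exists_holder_bound {E : Type*} [NormedAddCommGroup E] [NormedSpace ℝ E] {b γ C T : ℝ}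
    (hγ : 0 < γ) (hγb : γ ≤ b) (hbγ : b < 2 * γ) (hb : b ≤ 1) (hC : 0 ≤ C) (hT : 0 ≤ T) (N₀ : ℕ) :
    ∃ D : ℝ, 0 ≤ D ∧ ∀ (N₁ : ℕ) (S : ℕ → Fin 2 → ℤ → ℤ → ℕ → E),
      (∀ N, N₀ ≤ N → N < N₁ → ∀ μ a n, ∃ a' a'' n' n'', n' + n'' = n ∧ 2 * n' ≤ n + 1 ∧
        2 * n'' ≤ n + 1 ∧ ∀ v, S (N + 1) μ a (2 * v) n
          = (1 / 2 : ℝ) • (S N μ a' v n' + S N μ a'' v n'')) →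
      (∀ N, N₀ ≤ N → N ≤ N₁ → ∀ μ a v n, ‖S N μ a v n‖ ≤ n * T) →
      (∀ N, N₀ ≤ N → N ≤ N₁ → ∀ H : ℝ, 0 ≤ H →
        (∀ μ a v, ∀ n ≤ 2 ^ N, ‖S N μ a v n‖ ≤ H * ((n : ℝ) / 2 ^ N) ^ b) →
        ∀ μ a v, ∀ n ≤ 2 ^ N,
          ‖S N μ a v n - S N μ a (v + 1) n‖ ≤ C * (1 + H) * ((n : ℝ) / 4 ^ N) ^ γ) →
      ∀ N, N₀ ≤ N → N ≤ N₁ → ∀ μ a v, ∀ n ≤ 2 ^ N,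
        ‖S N μ a v n‖ ≤ D * ((n : ℝ) / 2 ^ N) ^ b ∧
        ∀ t : ℕ, ‖S N μ a (v + t) n - S N μ a v n‖
          ≤ D * ((n : ℝ) / 2 ^ N) ^ γ * ((t : ℝ) / 2 ^ N) ^ γ := by
  have hb0 : 0 < b := hγ.trans_le hγb
  set y : ℝ := (2 : ℝ) ^ (b - 2 * γ) with hy
  have hy0 : 0 < y := by positivity
  have hy1 : y < 1 := Real.rpow_lt_one_of_one_lt_of_neg one_lt_two (by linarith)
  obtain ⟨B, hB, hrec⟩ := exists_bound_of_recursion hC hT hy0 hy1 N₀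
  set κ : ℝ := 2 * ((2 : ℝ) ^ (-γ) / (1 - 2 ^ (-γ))) + 2 with hκ
  have hρ1 : (2 : ℝ) ^ (-γ) < 1 := Real.rpow_lt_one_of_one_lt_of_neg one_lt_two (by linarith)
  have hκ0 : 0 ≤ κ := by
    have : 0 < 1 - (2 : ℝ) ^ (-γ) := by linarith
    positivity
  set D₁ : ℝ := C * (1 + B) * κ + 2 * B * (2 ^ N₀) ^ γ with hD₁
  have hD₁0 : 0 ≤ D₁ := by positivity
  refine ⟨max B D₁, hB.trans (le_max_left _ _), fun N₁ S hhalf hcrude hladder => ?_⟩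
  have unit : ∀ (N n : ℕ), n ≤ 2 ^ N → 0 ≤ (n : ℝ) / 2 ^ N ∧ (n : ℝ) / 2 ^ N ≤ 1 := by
    intro N n hn
    refine ⟨by positivity, (div_le_one (by positivity)).2 ?_⟩
    exact_mod_cast hn
  have area : ∀ N n : ℕ, ((n : ℝ) / 4 ^ N) ^ γ = ((2 : ℝ) ^ (-γ)) ^ N * ((n : ℝ) / 2 ^ N) ^ γ := by
    intro N n
    have e : (n : ℝ) / 4 ^ N = (2 ^ N)⁻¹ * (n / 2 ^ N) := by
      rw [show (4 : ℝ) = 2 * 2 by norm_num, mul_pow]; field_simp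
    rw [e, Real.mul_rpow (by positivity) (by positivity), ← Real.rpow_natCast 2 N,
      ← Real.rpow_neg two_pos.le, ← Real.rpow_mul two_pos.le, ← Real.rpow_natCast _ N,
      ← Real.rpow_mul two_pos.le]
    congr 2; ring
  -- the area term in units of the Hölder control, using `n ≥ 1` and `γ ≤ b`
  have areab : ∀ N n : ℕ, ((n : ℝ) / 4 ^ N) ^ γ ≤ y ^ N * ((n : ℝ) / 2 ^ N) ^ b := by
    intro N n
    rw [area]
    rcases Nat.eq_zero_or_pos n with rfl | hn
    · simp [Real.zero_rpow hγ.ne', Real.zero_rpow hb0.ne']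
    have hx : 0 < (n : ℝ) / 2 ^ N := by positivity
    have h1 : ((n : ℝ) / 2 ^ N) ^ γ = ((n : ℝ) / 2 ^ N) ^ b * ((n : ℝ) / 2 ^ N) ^ (γ - b) := by
      rw [← Real.rpow_add hx]; congr 1; ring
    have h2 : ((n : ℝ) / 2 ^ N) ^ (γ - b) ≤ ((2 : ℝ) ^ (b - γ)) ^ N := by
      have h3 : ((n : ℝ) / 2 ^ N) ^ (γ - b) ≤ ((2 : ℝ) ^ N)⁻¹ ^ (γ - b) := by
        refine Real.rpow_le_rpow_of_nonpos (by positivity) ?_ (by linarith)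
        rw [inv_eq_one_div]
        gcongr
        exact_mod_cast hn
      refine h3.trans (le_of_eq ?_)
      rw [← Real.rpow_natCast 2 N, ← Real.rpow_neg two_pos.le, ← Real.rpow_mul two_pos.le,
        ← Real.rpow_natCast _ N, ← Real.rpow_mul two_pos.le]
      congr 1; ring
    have h4 : y ^ N = ((2 : ℝ) ^ (-γ)) ^ N * ((2 : ℝ) ^ (b - γ)) ^ N := by
      rw [← mul_pow, ← Real.rpow_add two_pos, hy]; congr 2; ring
    rw [h1, h4]
    have h5 := mul_le_mul_of_nonneg_left h2
      (by positivity : 0 ≤ ((2 : ℝ) ^ (-γ)) ^ N * ((n : ℝ) / 2 ^ N) ^ b)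
    linarith
  have conc : ∀ {β : ℝ}, 0 ≤ β → β ≤ 1 → ∀ N n n' n'' : ℕ, n' + n'' = n →
      (1 / 2 : ℝ) * (((n' : ℝ) / 2 ^ N) ^ β + ((n'' : ℝ) / 2 ^ N) ^ β)
        ≤ ((n : ℝ) / 2 ^ (N + 1)) ^ β := by
    intro β hβ hβ' N n n' n'' hn
    have h := rpow_add_rpow_le hβ hβ' (x := (n' : ℝ) / 2 ^ N) (y := (n'' : ℝ) / 2 ^ N)
      (by positivity) (by positivity)
    refine h.trans (le_of_eq ?_)
    rw [← hn, pow_succ]; push_cast; congr 1; field_simp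
  -- the optimal Hölder constants
  let adm : ℕ → Set ℝ := fun N => {H | 0 ≤ H ∧ ∀ μ a v, ∀ n ≤ 2 ^ N,
    ‖S N μ a v n‖ ≤ H * ((n : ℝ) / 2 ^ N) ^ b}
  have hbdd : ∀ N, BddBelow (adm N) := fun N => ⟨0, fun H hH => hH.1⟩
  have hadm : ∀ N, N₀ ≤ N → N ≤ N₁ → T * 2 ^ N ∈ adm N := by
    intro N hN hN'
    refine ⟨by positivity, fun μ a v n hn => (hcrude N hN hN' μ a v n).trans ?_⟩
    obtain ⟨hx0, hx1⟩ := unit N n hn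
    have h1 : (n : ℝ) / 2 ^ N ≤ ((n : ℝ) / 2 ^ N) ^ b := by
      simpa using Real.rpow_le_rpow_of_exponent_ge_of_imp hx0 hx1 hb (fun _ h => absurd h one_ne_zero)
    have h2 : (n : ℝ) * T = T * 2 ^ N * (n / 2 ^ N) := by field_simp
    rw [h2]
    exact mul_le_mul_of_nonneg_left h1 (by positivity)
  have hmin : ∀ N, N₀ ≤ N → N ≤ N₁ → sInf (adm N) ∈ adm N := by
    intro N hN hN'
    have hne : (adm N).Nonempty := ⟨_, hadm N hN hN'⟩
    refine ⟨le_csInf hne fun H hH => hH.1, fun μ a v n hn => ?_⟩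
    obtain ⟨hx0, -⟩ := unit N n hn
    rcases (Real.rpow_nonneg hx0 b).eq_or_lt with h0 | hpos
    · have := (hadm N hN hN').2 μ a v n hn
      rw [← h0] at this ⊢
      simpa using this
    · rw [← div_le_iff₀ hpos]
      exact le_csInf hne fun H hH => (div_le_iff₀ hpos).2 (hH.2 μ a v n hn)
  have hbound := hrec N₁ (fun N => sInf (adm N))
    (fun N hN hN' => ⟨(hmin N hN hN').1, csInf_le (hbdd N) (hadm N hN hN')⟩) (by
      intro N hN hN'
      have hm := hmin N hN hN'.le
      have hm' := hmin (N + 1) (by omega) (by omega)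
      set H := sInf (adm N) with hH
      set H' := sInf (adm (N + 1)) with hH'
      have hH0 := hm.1
      have hH0' := hm'.1
      refine csInf_le (hbdd _) ⟨by positivity, fun μ a v n hn => ?_⟩
      obtain ⟨hx0, -⟩ := unit (N + 1) n hn
      have even : ∀ w, ‖S (N + 1) μ a (2 * w) n‖ ≤ H * ((n : ℝ) / 2 ^ (N + 1)) ^ b := by
        intro w
        obtain ⟨a', a'', n', n'', e, e', e'', hS⟩ := hhalf N hN hN' μ a n
        rw [pow_succ] at hn
        rw [hS w, norm_smul, Real.norm_of_nonneg (by norm_num)]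
        have h1 := hm.2 μ a' w n' (by omega)
        have h2 := hm.2 μ a'' w n'' (by omega)
        have h3 := norm_add_le (S N μ a' w n') (S N μ a'' w n'')
        have h4 := mul_le_mul_of_nonneg_left (conc hb0.le hb N n n' n'' e) hH0
        linarith
      have hextra : 0 ≤ C * (1 + H') * y ^ (N + 1) * ((n : ℝ) / 2 ^ (N + 1)) ^ b := by positivity
      rw [add_mul]
      rcases Int.even_or_odd' v with ⟨w, rfl | rfl⟩
      · linarith [even w]
      · have h1 := hladder (N + 1) (by omega) (by omega) H' hH0' hm'.2 μ a (2 * w) n hn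
        have h2 := mul_le_mul_of_nonneg_left (areab (N + 1) n) (by positivity : 0 ≤ C * (1 + H'))
        have h3 := norm_sub_norm_le (S (N + 1) μ a (2 * w + 1) n) (S (N + 1) μ a (2 * w) n)
        rw [norm_sub_rev] at h3
        linarith [even w])
  have hB' : ∀ N, N₀ ≤ N → N ≤ N₁ → ∀ μ a v, ∀ n ≤ 2 ^ N,
      ‖S N μ a v n‖ ≤ B * ((n : ℝ) / 2 ^ N) ^ b := by
    intro N hN hN' μ a v n hn
    refine ((hmin N hN hN').2 μ a v n hn).trans ?_
    exact mul_le_mul_of_nonneg_right (hbound N hN hN') (Real.rpow_nonneg (unit N n hn).1 b)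
  have hγ1 : γ ≤ 1 := hγb.trans hb
  -- neighbouring lines of the level `j`, seen on a finer level `N`
  have adjacent : ∀ j, N₀ ≤ j → ∀ N, j ≤ N → N ≤ N₁ → ∀ μ a v, ∀ n ≤ 2 ^ N,
      ‖S N μ a (2 ^ (N - j) * (v + 1)) n - S N μ a (2 ^ (N - j) * v) n‖
        ≤ C * (1 + B) * ((2 : ℝ) ^ (-γ)) ^ j * ((n : ℝ) / 2 ^ N) ^ γ := by
    intro j hj N hjN
    induction N, hjN using Nat.le_induction with
    | base =>
      intro hN' μ a v n hn
      have h := hladder j hj hN' B hB (hB' j hj hN') μ a v n hn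
      rw [area, norm_sub_rev] at h
      simpa [mul_assoc] using h
    | succ N hjN ih =>
      intro hN' μ a v n hn
      obtain ⟨a', a'', n', n'', e, e', e'', hS⟩ := hhalf N (by omega) (by omega) μ a n
      have hp : ∀ w : ℤ, (2 : ℤ) ^ (N + 1 - j) * w = 2 * (2 ^ (N - j) * w) := by
        intro w
        rw [show N + 1 - j = N - j + 1 by omega, pow_succ']; ring
      rw [hp, hp, hS, hS, ← smul_sub, norm_smul, Real.norm_of_nonneg (by norm_num), add_sub_add_comm]
      rw [pow_succ] at hn
      have h1 := ih (by omega) μ a' v n' (by omega)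
      have h2 := ih (by omega) μ a'' v n'' (by omega)
      have h3 := norm_add_le (S N μ a' (2 ^ (N - j) * (v + 1)) n' - S N μ a' (2 ^ (N - j) * v) n')
        (S N μ a'' (2 ^ (N - j) * (v + 1)) n'' - S N μ a'' (2 ^ (N - j) * v) n'')
      have h4 := mul_le_mul_of_nonneg_left (conc hγ.le hγ1 N n n' n'' e)
        (by positivity : 0 ≤ C * (1 + B) * ((2 : ℝ) ^ (-γ)) ^ j)
      linarith
  intro N hN hN' μ a v n hn
  obtain ⟨hx0, hx1⟩ := unit N n hn
  have hxγ : 0 ≤ ((n : ℝ) / 2 ^ N) ^ γ := Real.rpow_nonneg hx0 γ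
  refine ⟨(hB' N hN hN' μ a v n hn).trans
    (mul_le_mul_of_nonneg_right (le_max_left _ _) (Real.rpow_nonneg hx0 b)), fun t => ?_⟩
  rcases Nat.eq_zero_or_pos t with rfl | ht
  · have : 0 ≤ max B D₁ := hB.trans (le_max_left _ _)
    simp only [Nat.cast_zero, add_zero, sub_self, norm_zero]
    positivity
  have h := chaining (γ := γ) (W := C * (1 + B) * ((n : ℝ) / 2 ^ N) ^ γ)
    (W' := B * ((n : ℝ) / 2 ^ N) ^ γ) (N₀ := N₀) (N := N) hγ (by positivity) (by positivity)
    (fun v => S N μ a v n) (by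
      intro m hm i
      have := adjacent (N - m) (by omega) N (by omega) hN' μ a i n hn
      rw [Nat.sub_sub_self (by omega)] at this
      exact this.trans_eq (by ring)) (by
      intro i
      refine (hB' N hN hN' μ a i n hn).trans (mul_le_mul_of_nonneg_left ?_ hB)
      exact Real.rpow_le_rpow_of_exponent_ge_of_imp hx0 hx1 hγb (fun _ h => absurd h hb0.ne')) v t ht
  refine h.trans ?_
  rw [show C * (1 + B) * ((n : ℝ) / 2 ^ N) ^ γ * (2 * ((2 : ℝ) ^ (-γ) / (1 - 2 ^ (-γ))) + 2)
    + 2 * (B * ((n : ℝ) / 2 ^ N) ^ γ) * (2 ^ N₀) ^ γ = D₁ * ((n : ℝ) / 2 ^ N) ^ γ by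
      rw [hD₁, hκ]; ring]
  gcongr
  exact le_max_right _ _

end HolderBounds

/-! ### Hölder bounds for a binary Landau gauge -/

section LandauBounds

theorem norm_lineSum_le {E : Type*} [NormedAddCommGroup E] {N : ℕ} {A : OneForm E N} {θ : ℝ}
    (hA : ∀ μ x, ‖A μ x‖ ≤ θ) (μ : Fin 2) (a v : ℤ) (n : ℕ) : ‖lineSum A μ a v n‖ ≤ n * θ := by
  refine (norm_sum_le_of_le _ fun j _ => hA μ _).trans_eq ?_
  simp

variable {E : Type*} [NormedAddCommGroup E] [InnerProductSpace ℝ E]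
  {G : Type*} [TopologicalSpace G] [ChartedSpace E G] [Group G]
  {log : G → E} {ε C : ℝ} {L : E →L[ℝ] (E →L[ℝ] E)}

/-- Halving in coordinates: bonds on even lines carry half of the bond of the previous level that
contains them. -/
theorem IsBinaryLandau.restr_succ_linePt {K : ℝ} {N₀ N₁ : ℕ} {U : GaugeField G N₁}
    {A : OneForm E N₁} {g : Site N₁ → G} (hL : IsBinaryLandau log K N₀ U A g) {N : ℕ} (hN : N₀ ≤ N)
    (hN' : N < N₁) (μ : Fin 2) (a v : ℤ) :
    A.restr (N + 1) μ (linePt (N + 1) μ a (2 * v))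
      = (1 / 2 : ℝ) • A.restr N μ (linePt N μ (a / 2) v) := by
  have h := hL.halving N hN hN' μ (linePt N μ (a / 2) v)
  fin_cases μ
  · simp only [Fin.zero_eta, linePt, if_true] at h ⊢
    rw [incl_pt_succ, pt_add_step_zero] at h
    rcases Int.even_or_odd' a with ⟨k, hk | hk⟩
    · rw [← h.1]; congr 2; omega
    · rw [← h.2]; congr 2; omega
  · simp only [Fin.mk_one, linePt, one_ne_zero, if_false] at h ⊢
    rw [incl_pt_succ, pt_add_step_one] at h
    rcases Int.even_or_odd' a with ⟨k, hk | hk⟩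
    · rw [← h.1]; congr 2; omega
    · rw [← h.2]; congr 2; omega

/-- On an even line, `n` consecutive bonds carry the average of what is carried on the previous level
by two segments whose numbers of bonds add up to `n`. -/
theorem IsBinaryLandau.lineSum_succ {K : ℝ} {N₀ N₁ : ℕ} {U : GaugeField G N₁}
    {A : OneForm E N₁} {g : Site N₁ → G} (hL : IsBinaryLandau log K N₀ U A g) {N : ℕ} (hN : N₀ ≤ N)
    (hN' : N < N₁) (μ : Fin 2) (a v : ℤ) (n : ℕ) :
    lineSum (A.restr (N + 1)) μ a (2 * v) n = (1 / 2 : ℝ) •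
      (lineSum (A.restr N) μ (a / 2) v ((n + 1) / 2)
        + lineSum (A.restr N) μ ((a + 1) / 2) v (n / 2)) := by
  simp only [lineSum]
  rw [← sum_floor_half (fun i => A.restr N μ (linePt N μ i v)) a n, Finset.smul_sum]
  exact Finset.sum_congr rfl fun j _ => hL.restr_succ_linePt hN hN' μ _ v

/-- Regularity of a binary Landau gauge on all scales, in terms of sums over lines. -/
theorem LocalCalculus.exists_lineSum_holder (h : LocalCalculus log ε C L) {K : ℝ} (hK : 0 ≤ K)
    {c : ℝ} (hc : 0 < c) (hcε : 80 * c < ε) (hcK : 1000 * (K + 1) * c ≤ 1) (N₀ : ℕ)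
    {α Cbar q b : ℝ} (hα : 2 / 3 < α) (hα' : α < 1) (hCbar : 0 ≤ Cbar) (hq : 1 ≤ q)
    (hb : 1 / 2 < b) (hbα : b < α) (hbq : 1 - q⁻¹ < b) :
    ∃ D : ℝ, 0 ≤ D ∧ ∀ (N₁ : ℕ) (U : GaugeField G N₁) (A : OneForm E N₁) (g : Site N₁ → G),
      IsBinaryLandau log K N₀ U A g →
      (∀ N, N₀ ≤ N → N ≤ N₁ → ∀ r : Rect N,
        qVar q (r.w * r.h) (antiDev log (U.restr N) r) ≤ Cbar * r.area ^ (α / 2)) →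
      Cbar * (2 : ℝ) ^ (-((N₀ : ℝ) * α)) ≤ c → (∀ μ x, ‖A.restr N₀ μ x‖ ≤ c) →
      ∀ N, N₀ ≤ N → N ≤ N₁ → ∀ μ a v, ∀ n ≤ 2 ^ N,
        ‖lineSum (A.restr N) μ a v n‖ ≤ D * ((n : ℝ) / 2 ^ N) ^ b ∧
        ∀ t : ℕ, ‖lineSum (A.restr N) μ a (v + t) n - lineSum (A.restr N) μ a v n‖
          ≤ D * ((n : ℝ) / 2 ^ N) ^ (α / 2) * ((t : ℝ) / 2 ^ N) ^ (α / 2) := by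
  obtain ⟨D₀, hD₀, hladder⟩ := h.exists_lineSum_sub_le hb hq hbq
  have hC := h.nonneg
  set x : ℝ := (2 : ℝ) ^ (-α) with hx
  have hx0 : 0 < x := by positivity
  have hx1 : 1 / 2 < x := by
    have : (2 : ℝ) ^ (-1 : ℝ) < 2 ^ (-α) := Real.rpow_lt_rpow_of_exponent_lt one_lt_two (by linarith)
    rwa [Real.rpow_neg_one, inv_eq_one_div] at this
  -- `x ^ 3 < 2 ^ (-2) < (16 / 25) ^ 3`
  have hx2 : x ≤ 16 / 25 := by
    have h1 : x ^ 3 ≤ (16 / 25 : ℝ) ^ 3 := by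
      have e : x ^ 3 = (2 : ℝ) ^ (-α * 3) := by
        rw [hx, ← Real.rpow_natCast, ← Real.rpow_mul two_pos.le]; norm_num
      have h2 : (2 : ℝ) ^ (-α * 3) ≤ 2 ^ (-2 : ℝ) :=
        Real.rpow_le_rpow_of_exponent_le one_le_two (by linarith)
      have h3 : (2 : ℝ) ^ (-2 : ℝ) = 1 / 4 := by
        rw [Real.rpow_neg two_pos.le]; norm_num
      rw [e]
      exact (h2.trans_eq h3).trans (by norm_num)
    exact le_of_pow_le_pow_left₀ three_ne_zero (by norm_num) h1
  set Cθ : ℝ := 4 / (x - 1 / 2) * c / x ^ N₀ with hCθ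
  have hCθ0 : 0 ≤ Cθ := by
    have : 0 < x - 1 / 2 := by linarith
    positivity
  set C₁ : ℝ := Cbar * (1 + D₀) + 4 * Cθ + 44 * C * Cθ ^ 2 with hC₁
  obtain ⟨D, hD, hmain⟩ := exists_holder_bound (E := E) (b := b) (γ := α / 2) (C := C₁) (T := 20 * c)
    (by linarith) (by linarith) (by linarith) (by linarith) (by positivity) (by positivity) N₀
  refine ⟨D, hD, fun N₁ U A g hL hvar hcbar hA₀ => ?_⟩
  have hxN₀ : Cbar * x ^ N₀ ≤ c := by
    refine le_trans (le_of_eq ?_) hcbar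
    rw [hx, ← Real.rpow_natCast, ← Real.rpow_mul two_pos.le]
    congr 2; ring
  have hsplit : ∀ N, N₀ ≤ N → x ^ N = x ^ N₀ * x ^ (N - N₀) := by
    intro N hN
    rw [← pow_add]; congr 1; omega
  have hplaq : ∀ N, N₀ ≤ N → 1 ≤ N → N ≤ N₁ → ∀ y,
      ‖log (plaqHol (U.restr N) y)‖ ≤ c * x ^ (N - N₀) := by
    intro N hN hN1 hN' y
    refine (norm_log_plaqHol_le hq hN1 (hvar N hN hN') y).trans ?_
    rw [hsplit N hN, ← mul_assoc]
    exact mul_le_mul_of_nonneg_right hxN₀ (by positivity)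
  have hlevel := h.norm_level_le hK hc (by linarith) hcK hL hx1 hx2 hA₀
    (fun N hN hN' y => hplaq N hN.le (by omega) hN' y)
  have hcrude : ∀ N, N₀ ≤ N → N ≤ N₁ → ∀ μ y, ‖A.restr N μ y‖ ≤ 20 * c := by
    intro N hN hN' μ y
    refine (hlevel N hN hN' μ y).1.trans (mul_le_of_le_one_right (by positivity) ?_)
    exact pow_le_one₀ (by norm_num) (by norm_num)
  have hfine : ∀ N, N₀ ≤ N → N ≤ N₁ → ∀ μ y, ‖A.restr N μ y‖ ≤ Cθ * x ^ N := by
    intro N hN hN' μ y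
    refine (hlevel N hN hN' μ y).2.trans_eq ?_
    rw [hsplit N hN, hCθ]
    field_simp
  refine hmain N₁ (fun N => lineSum (A.restr N)) ?_ ?_ ?_
  · intro N hN hN' μ a n
    exact ⟨a / 2, (a + 1) / 2, (n + 1) / 2, n / 2, by omega, by omega, by omega,
      fun v => hL.lineSum_succ hN hN' μ a v n⟩
  · intro N hN hN' μ a v n
    exact norm_lineSum_le (hcrude N hN hN') μ a v n
  · intro N hN hN' H hH hHol μ a v n hn
    -- the first bound keeps `θ` inside the ball of the local calculus, the second one decays
    set θ : ℝ := min (20 * c) (Cθ * x ^ N) with hθ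
    have hθA : ∀ μ y, ‖A.restr N μ y‖ ≤ θ := fun μ y =>
      le_min (hcrude N hN hN' μ y) (hfine N hN hN' μ y)
    have hθ0 : 0 ≤ θ := (norm_nonneg _).trans (hθA 0 0)
    have hθ1 : θ ≤ 20 * c := min_le_left _ _
    have hθ2 : θ ≤ Cθ * x ^ N := min_le_right _ _
    have hpN : (0 : ℝ) < 2 ^ N := by positivity
    have hstrict : ∀ k : ℕ, k < 2 ^ N →
        ‖lineSum (A.restr N) μ a v k - lineSum (A.restr N) μ a (v + 1) k‖
          ≤ Cbar * ((k : ℝ) / 4 ^ N) ^ (α / 2) * (1 + D₀ * H) + 2 * θ + k * (44 * C * θ ^ 2) := by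
      intro k hk
      rcases Nat.eq_zero_or_pos k with rfl | hk1
      · simp only [lineSum, Finset.range_zero, Finset.sum_empty, sub_self, norm_zero]
        positivity
      have hN1 : 1 ≤ N := by
        rcases Nat.eq_zero_or_pos N with rfl | h1
        · simp at hk; omega
        · exact h1
      have e : H / (2 ^ N) ^ b * 2 ^ ((N : ℝ) * b) = H := by
        rw [Real.rpow_mul two_pos.le, Real.rpow_natCast]
        exact div_mul_cancel₀ _ (by positivity)
      have := hladder N (U.restr N) (fun y => g (incl y)) (A.restr N) θ (H / (2 ^ N) ^ b)
        (Cbar * ((k : ℝ) / 4 ^ N) ^ (α / 2)) k hk1 hk (by positivity) (by positivity) (by linarith)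
        (hL.exp_eq N hN hN') hθA ?_ ?_ ?_ μ a v
      · rwa [e] at this
      · intro y
        have h1 : c * x ^ (N - N₀) ≤ c :=
          mul_le_of_le_one_right hc.le (pow_le_one₀ hx0.le (by linarith))
        linarith [hplaq N hN hN1 hN' y]
      · intro r hr
        refine (hvar N hN hN' r).trans_eq ?_
        rw [Rect.area, ← hr, show (4 : ℝ) = 2 ^ 2 by norm_num, ← pow_mul, ← pow_mul, mul_comm 2 N]
        push_cast
        rfl
      · intro μ a v m hm
        refine (hHol μ a v m hm).trans_eq ?_
        rw [Real.div_rpow (by positivity) (by positivity)]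
        ring
    rcases Nat.eq_zero_or_pos n with rfl | hn1
    · simp only [lineSum, Finset.range_zero, Finset.sum_empty, sub_self, norm_zero]
      positivity
    have hn1' : (1 : ℝ) ≤ n := by exact_mod_cast hn1
    -- the full circle is one bond longer than the longest strip
    have hall : ‖lineSum (A.restr N) μ a v n - lineSum (A.restr N) μ a (v + 1) n‖
        ≤ Cbar * ((n : ℝ) / 4 ^ N) ^ (α / 2) * (1 + D₀ * H) + 4 * θ + n * (44 * C * θ ^ 2) := by
      rcases hn.lt_or_eq with hlt | heq
      · linarith [hstrict n hlt]
      · obtain ⟨k, rfl⟩ : ∃ k, n = k + 1 := ⟨n - 1, by omega⟩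
        have h1 := hstrict k (by omega)
        have h2 : Cbar * ((k : ℝ) / 4 ^ N) ^ (α / 2) * (1 + D₀ * H)
            ≤ Cbar * (((k + 1 : ℕ) : ℝ) / 4 ^ N) ^ (α / 2) * (1 + D₀ * H) := by
          push_cast
          gcongr
          linarith
        have h3 : (k : ℝ) * (44 * C * θ ^ 2) ≤ ((k + 1 : ℕ) : ℝ) * (44 * C * θ ^ 2) := by
          gcongr; omega
        have e : ∀ v, lineSum (A.restr N) μ a v (k + 1) = lineSum (A.restr N) μ a v k
            + A.restr N μ (linePt N μ (a + (k : ℕ)) v) := fun v => Finset.sum_range_succ _ _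
        rw [e, e, add_sub_add_comm]
        refine (norm_add_le _ _).trans ?_
        have h4 := norm_sub_le (A.restr N μ (linePt N μ (a + (k : ℕ)) v))
          (A.restr N μ (linePt N μ (a + (k : ℕ)) (v + 1)))
        linarith [hθA μ (linePt N μ (a + (k : ℕ)) v), hθA μ (linePt N μ (a + (k : ℕ)) (v + 1))]
    refine hall.trans ?_
    set z : ℝ := ((n : ℝ) / 4 ^ N) ^ (α / 2) with hz
    have hz0 : 0 ≤ z := by positivity
    have hnz : z = (n : ℝ) ^ (α / 2) * x ^ N := by
      rw [hz, Real.div_rpow (by positivity) (by positivity), div_eq_mul_inv]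
      congr 1
      rw [← Real.rpow_neg (by positivity), show (4 : ℝ) = 2 ^ 2 by norm_num, ← pow_mul,
        ← Real.rpow_natCast, ← Real.rpow_mul two_pos.le, hx, ← Real.rpow_natCast,
        ← Real.rpow_mul two_pos.le]
      congr 1; push_cast; ring
    have hxz : x ^ N ≤ z := by
      rw [hnz]
      exact le_mul_of_one_le_left (by positivity) (Real.one_le_rpow hn1' (by linarith))
    -- the comparison of exponents `1 - α / 2 ≤ α` is the condition `α ≥ 2 / 3`
    have hnxz : n * (x ^ N) ^ 2 ≤ z := by
      have h1 : (n : ℝ) ^ (1 - α / 2) * x ^ N ≤ 1 := by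
        have h2 : (n : ℝ) ^ (1 - α / 2) ≤ ((2 : ℝ) ^ N) ^ α := by
          refine (Real.rpow_le_rpow_of_exponent_le hn1' (by linarith : 1 - α / 2 ≤ α)).trans ?_
          exact Real.rpow_le_rpow (by positivity) (by exact_mod_cast hn) (by linarith)
        have h3 : ((2 : ℝ) ^ N) ^ α * x ^ N = 1 := by
          rw [hx, Real.rpow_neg two_pos.le, inv_pow, ← Real.rpow_natCast, ← Real.rpow_natCast,
            ← Real.rpow_mul two_pos.le, ← Real.rpow_mul two_pos.le, mul_comm α]
          exact mul_inv_cancel₀ (by positivity)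
        exact (mul_le_mul_of_nonneg_right h2 (by positivity)).trans_eq h3
      have h4 : (n : ℝ) = n ^ (α / 2) * n ^ (1 - α / 2) := by
        rw [← Real.rpow_add (by linarith)]; simp
      calc n * (x ^ N) ^ 2 = z * ((n : ℝ) ^ (1 - α / 2) * x ^ N) := by
            rw [hnz]; nth_rewrite 1 [h4]; ring
        _ ≤ z := mul_le_of_le_one_right hz0 h1
    have t1 : Cbar * z * (1 + D₀ * H) ≤ Cbar * (1 + D₀) * (1 + H) * z := by
      have : 0 ≤ Cbar * z * (H + D₀) := by positivity
      linarith
    have t2 : 4 * θ ≤ 4 * Cθ * (1 + H) * z := by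
      have h1 := mul_le_mul_of_nonneg_left hxz hCθ0
      have h2 : 0 ≤ Cθ * H * z := by positivity
      linarith
    have t3 : n * (44 * C * θ ^ 2) ≤ 44 * C * Cθ ^ 2 * (1 + H) * z := by
      have h1 : θ ^ 2 ≤ (Cθ * x ^ N) ^ 2 := by gcongr
      have h2 : n * (44 * C * θ ^ 2) ≤ n * (44 * C * (Cθ * x ^ N) ^ 2) := by gcongr
      have h3 := mul_le_mul_of_nonneg_left hnxz (by positivity : 0 ≤ 44 * C * Cθ ^ 2)
      have h4 : 0 ≤ 44 * C * Cθ ^ 2 * (H * z) := by positivity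
      linarith
    rw [hC₁]
    linarith

end LandauBounds

/-! ### Axis segments -/

section Segments

variable {N : ℕ}

theorem pt_congr {a a' v v' : ℤ} (ha : (a : ZMod (2 ^ N)) = a') (hv : (v : ZMod (2 ^ N)) = v') :
    pt N a v = pt N a' v' := by
  simp only [pt, ha, hv]

theorem linePt_congr {a a' v v' : ℤ} (ha : (a : ZMod (2 ^ N)) = a') (hv : (v : ZMod (2 ^ N)) = v')
    (μ : Fin 2) : linePt N μ a v = linePt N μ a' v' := by
  simp only [linePt, pt_congr ha hv, pt_congr hv ha]

theorem linePt_add_nsmul_step (μ : Fin 2) (a v : ℤ) (j : ℕ) :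
    linePt N μ a v + j • step μ = linePt N μ (a + j) v := by
  fin_cases μ
  · exact pt_add_nsmul_step_zero a v j
  · exact pt_add_nsmul_step_one v a j

theorem two_pow_eq_zero : (2 : ZMod (2 ^ N)) ^ N = 0 := by
  exact_mod_cast ZMod.natCast_self (2 ^ N)

/-- In `Fin 2`, the direction transverse to `μ` is `1 - μ`. -/
theorem eq_linePt (μ : Fin 2) (x : Site N) :
    x = linePt N μ (x μ).val (x (1 - μ)).val := by
  funext i
  fin_cases μ <;> fin_cases i <;> simp [linePt, pt]

theorem OneForm.eval_eq_lineSum {E : Type*} [AddCommGroup E] (A : OneForm E N) (l : Seg N) :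
    A.eval l = lineSum A l.dir (l.base l.dir).val (l.base (1 - l.dir)).val l.len := by
  simp only [OneForm.eval, lineSum, ← linePt_add_nsmul_step, ← eq_linePt]

/-- The positions on the axis of the bonds of a segment. -/
def Seg.bonds (l : Seg N) : Finset (ZMod (2 ^ N)) :=
  (Finset.range l.len).image fun j : ℕ => l.base l.dir + (j : ZMod (2 ^ N))

theorem Seg.lineSum_eq_sum_bonds {E : Type*} [AddCommGroup E] (A : OneForm E N) (l : Seg N)
    (v : ℤ) : lineSum A l.dir (l.base l.dir).val v l.len
      = ∑ z ∈ l.bonds, A l.dir (linePt N l.dir z.val v) := by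
  rw [Seg.bonds, Finset.sum_image]
  · refine Finset.sum_congr rfl fun j _ => ?_
    congr 1
    apply linePt_congr <;> simp
  · intro i hi j hj hij
    have hi' := (Finset.mem_range.1 hi).trans_le l.len_le
    have hj' := (Finset.mem_range.1 hj).trans_le l.len_le
    have h := (ZMod.natCast_eq_natCast_iff' _ _ _).1 (add_left_cancel hij)
    rwa [Nat.mod_eq_of_lt hi', Nat.mod_eq_of_lt hj'] at h

theorem unitAddCircle_coe_eq_iff (x y : ℝ) :
    (x : UnitAddCircle) = y ↔ ∃ k : ℤ, x = y + k := by
  rw [← sub_eq_zero, ← AddCircle.coe_sub, AddCircle.coe_eq_zero_iff]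
  constructor
  · rintro ⟨k, hk⟩
    exact ⟨k, by simp at hk; linarith⟩
  · rintro ⟨k, hk⟩
    exact ⟨k, by simp; linarith⟩

/-- A bond belongs to a segment if and only if the projection of the segment contains the midpoint
of the projection of the bond. -/
theorem Seg.mem_bonds_iff (l : Seg N) (z : ZMod (2 ^ N)) :
    z ∈ l.bonds ↔ ((((z.val : ℝ) + 1 / 2) / 2 ^ N : ℝ) : UnitAddCircle) ∈
      (fun p : Torus => p l.dir) '' l.carrier := by
  have hp : (0 : ℝ) < 2 ^ N := by positivity
  simp only [Seg.bonds, Finset.mem_image, Finset.mem_range, Seg.carrier, Set.mem_image,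
    Set.mem_Icc, exists_exists_and_eq_and, if_true]
  constructor
  · rintro ⟨j, hj, rfl⟩
    refine ⟨((j : ℝ) + 1 / 2) / 2 ^ N, ⟨by positivity, ?_⟩, ?_⟩
    · rw [Seg.length]
      have : (j : ℝ) + 1 ≤ l.len := by exact_mod_cast hj
      gcongr
      linarith
    · rw [unitAddCircle_coe_eq_iff]
      have h1 : ((((l.base l.dir).val + j : ℕ) : ℤ) : ZMod (2 ^ N))
          = (((l.base l.dir + (j : ZMod (2 ^ N))).val : ℤ) : ZMod (2 ^ N)) := by
        simp
      rw [ZMod.intCast_eq_intCast_iff_dvd_sub] at h1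
      obtain ⟨k, hk⟩ := h1
      refine ⟨-k, ?_⟩
      have hk' : ((l.base l.dir + (j : ZMod (2 ^ N))).val : ℝ) - ((l.base l.dir).val + j)
          = 2 ^ N * k := by
        exact_mod_cast hk
      push_cast
      field_simp
      linarith
  · rintro ⟨c, ⟨hc0, hc1⟩, hc⟩
    rw [unitAddCircle_coe_eq_iff] at hc
    obtain ⟨k, hk⟩ := hc
    rw [Seg.length, le_div_iff₀ hp] at hc1
    have h1 : c * 2 ^ N = ((z.val - (l.base l.dir).val + k * 2 ^ N : ℤ) : ℝ) + 1 / 2 := by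
      push_cast
      field_simp at hk
      linarith
    have hc0' : 0 ≤ c * 2 ^ N := by positivity
    set r : ℤ := z.val - (l.base l.dir).val + k * 2 ^ N with hr
    have hr0 : -1 < r := by
      have : (-1 : ℝ) < r := by linarith
      exact_mod_cast this
    have hr1 : r < l.len := by
      have : (r : ℝ) < l.len := by linarith
      exact_mod_cast this
    refine ⟨r.toNat, by omega, ?_⟩
    have h2 : ((r.toNat : ℕ) : ZMod (2 ^ N)) = ((r : ℤ) : ZMod (2 ^ N)) := by
      rw [← Int.cast_natCast, Int.toNat_of_nonneg (by omega)]
    rw [h2, hr]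
    push_cast
    rw [two_pow_eq_zero]
    simp

theorem Seg.Parallel.bonds_eq {l l' : Seg N} (h : l.Parallel l') : l.bonds = l'.bonds := by
  ext z
  rw [l.mem_bonds_iff, l'.mem_bonds_iff, h.2, h.1]

theorem Seg.carrier_nonempty (l : Seg N) : l.carrier.Nonempty := by
  refine Set.Nonempty.image _ ⟨0, le_rfl, ?_⟩
  rw [Seg.length]
  positivity

/-- Parallel segments are translates of each other in the transverse direction, by at most their
distance. -/
theorem Seg.Parallel.exists_translate {l l' : Seg N} (h : l.Parallel l') :
    ∃ t : ℤ, |(t : ℝ)| / 2 ^ N ≤ 1 ∧ |(t : ℝ)| / 2 ^ N ≤ l.distance l' ∧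
      ∀ {E : Type*} [AddCommGroup E] (A : OneForm E N),
        A.eval l = lineSum A l.dir (l.base l.dir).val ((l'.base (1 - l.dir)).val + t) l.len ∧
        A.eval l' = lineSum A l.dir (l.base l.dir).val (l'.base (1 - l.dir)).val l.len := by
  have hp : (0 : ℝ) < 2 ^ N := by positivity
  -- `t` represents the difference of the transverse coordinates on the circle by the integer of
  -- smallest absolute value
  set v : ℕ := (l.base (1 - l.dir)).val with hv
  set v' : ℕ := (l'.base (1 - l.dir)).val with hv'
  set d : ℝ := (v : ℝ) / 2 ^ N - (v' : ℝ) / 2 ^ N with hd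
  have habs : |(((v : ℤ) - v' - round d * 2 ^ N : ℤ) : ℝ)| / 2 ^ N = |d - round d| := by
    rw [← abs_of_pos hp, ← abs_div]
    congr 1
    rw [hd]
    push_cast
    field_simp
  refine ⟨(v : ℤ) - v' - round d * 2 ^ N, ?_, ?_, ?_⟩
  · rw [habs]
    linarith [abs_sub_round d]
  · rw [habs, ← UnitAddCircle.norm_eq]
    obtain ⟨p, hp⟩ := l.carrier_nonempty
    obtain ⟨p', hp'⟩ := l'.carrier_nonempty
    refine le_csInf ⟨_, p, hp, p', hp', rfl⟩ ?_
    rintro _ ⟨_, ⟨c, -, rfl⟩, _, ⟨c', -, rfl⟩, rfl⟩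
    have hne : 1 - l.dir ≠ l.dir := by
      generalize l.dir = μ
      fin_cases μ <;> simp
    have hne' : 1 - l.dir ≠ l'.dir := by rwa [← h.1]
    refine le_trans (le_of_eq ?_) (PiLp.dist_apply_le _ _ (1 - l.dir))
    rw [dist_eq_norm]
    simp only [hne, hne', if_false, add_zero]
    rw [← AddCircle.coe_sub]
  · intro E _ A
    constructor
    · rw [A.eval_eq_lineSum l]
      simp only [lineSum]
      refine Finset.sum_congr rfl fun j _ => ?_
      congr 1
      refine linePt_congr rfl ?_ _
      push_cast
      rw [two_pow_eq_zero]
      ring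
    · rw [A.eval_eq_lineSum l', l'.lineSum_eq_sum_bonds, l.lineSum_eq_sum_bonds, h.bonds_eq, hv', h.1]

end Segments

end BinaryLandau

/-! ### Existence and regularity of the binary Landau gauge -/

open BinaryLandau in
theorem theorem4p9
    {E : Type*} [NormedAddCommGroup E] [InnerProductSpace ℝ E] [FiniteDimensional ℝ E]
    [MeasurableSpace E] [BorelSpace E]
    {G : Type*} [TopologicalSpace G] [ChartedSpace E G] [Group G] [LieGroup 𝓘(ℝ, E) ∞ G]
    [CompactSpace G] [ConnectedSpace G] [T2Space G] [MeasurableSpace G] [BorelSpace G]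
    (hAd : ∀ (y : G) (X Y : E), inner ℝ (Ad y X) (Ad y Y) = inner ℝ X Y)
    (log : G → E) (hlog : IsLogMap log) :
    ∃ K₀ : ℝ, 0 ≤ K₀ ∧ ∀ K : ℝ, K₀ ≤ K →
      (∀ (N₀ N₁ : ℕ), N₀ ≤ N₁ → ∀ U : GaugeField G N₁,
        ∃ (A : OneForm E N₁) (g : Site N₁ → G), IsBinaryLandau log K N₀ U A g) ∧
      ∃ c : ℝ, 0 < c ∧
        ∀ (N₀ : ℕ) (α Cbar q αbar : ℝ), 2 / 3 < α → α < 1 → 0 ≤ Cbar →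
          1 ≤ q → q < 1 / (1 - α) → 1 - q⁻¹ < αbar → αbar < α →
          ∃ C : ℝ, 0 ≤ C ∧
            ∀ (N₁ : ℕ), N₀ ≤ N₁ →
            ∀ (U : GaugeField G N₁) (A : OneForm E N₁) (g : Site N₁ → G),
              IsBinaryLandau log K N₀ U A g →
              (∀ N, N₀ ≤ N → N ≤ N₁ → ∀ r : Rect N,
                qVar q (r.w * r.h) (antiDev log (U.restr N) r) ≤ Cbar * r.area ^ (α / 2)) →
              (∀ (μ : Fin 2) (x : Site N₀),
                Cbar * (2 : ℝ) ^ (-((N₀ : ℝ) * α)) + ‖A.restr N₀ μ x‖ ≤ c) →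
              ∀ N, N₀ ≤ N → N ≤ N₁ → ∀ l l' : Seg N, l.Parallel l' →
                ‖(A.restr N).eval l‖ ≤ C * l.length ^ αbar ∧
                ‖(A.restr N).eval l - (A.restr N).eval l'‖
                  ≤ C * l.length ^ (α / 2) * l.distance l' ^ (αbar / 2) := by
  obtain ⟨ε, C, L, h⟩ := hlog.exists_localCalculus hAd
  obtain ⟨M, hM⟩ := hlog.bounded
  have hε := h.pos
  refine ⟨max (10000 * C) (2 * M * (1100 / ε) ^ 2 + 1100 / ε),
    le_max_of_le_left (mul_nonneg (by norm_num) h.nonneg), fun K hK => ?_⟩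
  have hK0 : 0 ≤ K := le_trans (le_max_of_le_left (mul_nonneg (by norm_num) h.nonneg)) hK
  refine ⟨fun N₀ N₁ hN U => h.exists_isBinaryLandau hM ((le_max_left _ _).trans hK)
    ((le_max_right _ _).trans hK) hN U, min (ε / 100) (1 / (1000 * (K + 1))), by positivity, ?_⟩
  set c : ℝ := min (ε / 100) (1 / (1000 * (K + 1))) with hc
  have hc0 : 0 < c := by positivity
  have hcε : 80 * c < ε := by
    have : c ≤ ε / 100 := min_le_left _ _
    linarith
  have hcK : 1000 * (K + 1) * c ≤ 1 := by
    have : c ≤ 1 / (1000 * (K + 1)) := min_le_right _ _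
    rw [le_div_iff₀ (by positivity)] at this
    linarith
  intro N₀ α Cbar q αbar hα hα' hCbar hq _ hαbar hαbar'
  have hαbar0 : 0 < αbar := by
    have : q⁻¹ ≤ 1 := inv_le_one_of_one_le₀ hq
    linarith
  -- the bound for ordered products needs an exponent above `1 / 2`; lengths are at most `1`, so that a
  -- larger exponent than `αbar` is harmless
  obtain ⟨D, hD, hmain⟩ := h.exists_lineSum_holder hK0 hc0 hcε hcK N₀ (b := max αbar (2 / 3)) hα hα'
    hCbar hq (lt_max_of_lt_right (by norm_num)) (max_lt hαbar' hα) (lt_max_of_lt_left hαbar)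
  refine ⟨D, hD, fun N₁ _ U A g hL hvar hsmall N hN hN' l l' hp => ?_⟩
  have hc1 : 0 ≤ Cbar * (2 : ℝ) ^ (-((N₀ : ℝ) * α)) := by positivity
  have hline := hmain N₁ U A g hL hvar (by linarith [hsmall 0 0, norm_nonneg (A.restr N₀ 0 0)])
    (fun μ x => by linarith [hsmall μ x]) N hN hN'
  have hlen0 : 0 < l.length := by
    have : (0 : ℝ) < l.len := by exact_mod_cast l.one_le_len
    rw [Seg.length]
    positivity
  have hlen1 : l.length ≤ 1 := by
    rw [Seg.length, div_le_one (by positivity)]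
    exact_mod_cast l.len_le
  obtain ⟨t, ht1, htd, heval⟩ := hp.exists_translate
  obtain ⟨h1, h2⟩ := heval (A.restr N)
  constructor
  · rw [h1]
    refine (hline _ _ _ _ l.len_le).1.trans (mul_le_mul_of_nonneg_left ?_ hD)
    exact Real.rpow_le_rpow_of_exponent_ge hlen0 hlen1 (le_max_left _ _)
  · have hdist : (|(t : ℝ)| / 2 ^ N) ^ (α / 2) ≤ l.distance l' ^ (αbar / 2) := by
      refine (Real.rpow_le_rpow_of_exponent_ge_of_imp (by positivity) ht1
        (by linarith : αbar / 2 ≤ α / 2) fun _ h => ?_).trans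
        (Real.rpow_le_rpow (by positivity) htd (by positivity))
      exact absurd h (by positivity)
    refine le_trans ?_ (mul_le_mul_of_nonneg_left hdist
      (mul_nonneg hD (Real.rpow_nonneg hlen0.le _)))
    rw [h1, h2]
    rcases le_total 0 t with ht | ht
    · have := (hline l.dir (l.base l.dir).val (l'.base (1 - l.dir)).val l.len l.len_le).2 t.natAbs
      rw [Int.natAbs_of_nonneg ht, Nat.cast_natAbs, Int.cast_abs] at this
      exact this
    · have := (hline l.dir (l.base l.dir).val ((l'.base (1 - l.dir)).val + t) l.len l.len_le).2
        t.natAbs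
      rw [Int.ofNat_natAbs_of_nonpos ht, add_neg_cancel_right, Nat.cast_natAbs, Int.cast_abs,
        norm_sub_rev] at this
      exact this
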